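/- For $i=1,2$ let $(X_i,\rho_i,\mu_i)$ be a space of homogeneous type in the sense of Coifman and Weiss: $\rho_i$ is a quasi-metric, $X_i$ carries the topology induced by $\rho_i$, and $\mu_i$ is a nonzero Borel measure with $\mu_i(B(x,2r))\le C_{\mu_i}\,\mu_i(B(x,r))<\infty$ for all $x$ and all $r>0$. Let $\mathcal D_i$ be a system of dyadic cubes on $X_i$, that is, a countable family of Borel sets $Q^k_\alpha$ ($k\in\mathbb Z$) with centers $x^k_\alpha$ and parameters $\delta\in(0,1)$, $0<c_1\le C_1$, such that: for each $k$ the cubes of generation $k$ partition $X_i$; the cubes are nested; each cube has a unique ancestor in each earlier generation; each cube $Q$ of generation $k$ is the union of its children (the cubes of generation $k+1$ contained in $Q$), whose number $M_Q$ satisfies $1\le M_Q\le M$; $B(x^k_\alpha,c_1\delta^k)\subseteq Q^k_\alpha\subseteq B(x^k_\alpha,C_1\delta^k)$; and $Q^\ell_\beta\subseteq Q^k_\alpha$ with $\ell\ge k$ implies $B(x^\ell_\beta,C_1\delta^\ell)\subseteq B(x^k_\alpha,C_1\delta^k)$. For each cube $Q$ enumerate its children $Q_1,\dots,Q_{M_Q}$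 so that $\sum_{j\ge u}\mu_i(Q_j)\ge(1-\frac{u-1}{M_Q})\mu_i(Q)$ for every $u$, put $E_u=\bigcup_{j\ge u}Q_j$, and for $1\le u\le M_Q-1$ define the Haar function $$h_Q^u=\Big(\tfrac{\mu_i(E_{u+1})}{\mu_i(Q_u)\mu_i(E_u)}\Big)^{1/2}1_{Q_u}-\Big(\tfrac{\mu_i(Q_u)}{\mu_i(E_u)\mu_i(E_{u+1})}\Big)^{1/2}1_{E_{u+1}}.$$ Let $\mu=\mu_1\times\mu_2$ on $X_1\times X_2$ (with the product topology) and $$S_{d,d}(f)(x_1,x_2)=\Big(\sum_{Q_1\in\mathcal D_1}\sum_{Q_2\in\mathcal D_2}\sum_{u_1=1}^{M_{Q_1}-1}\sum_{u_2=1}^{M_{Q_2}-1}\big|\langle f,h_{Q_1}^{u_1}h_{Q_2}^{u_2}\rangle\big|^2\frac{1_{Q_1}(x_1)1_{Q_2}(x_2)}{\mu_1(Q_1)\mu_2(Q_2)}\Big)^{1/2},$$ where the sums run over the cubes of all generations, and a set that occurs as a cube of several generations is counted once for each of them. Let $H^1_{\mathcal D_1,\mathcal D_2}$ be the space of all real-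 or complex-valued $f\in L^1(\mu)$ with $\|f\|_{H^1_{\mathcal D_1,\mathcal D_2}}:=\|S_{d,d}(f)\|_{L^1(\mu)}<\infty$. A function $a\in L^2(\mu)$ is a dyadic atom if there is an open set $\Omega\subseteq X_1\times X_2$ with $\mu(\Omega)<\infty$ such that (1) $a$ vanishes outside $\Omega$; (2) $\|a\|_{L^2}\le\mu(\Omega)^{-1/2}$; (3) $a=\sum_{R\in m(\Omega)}a_R$ with unconditional convergence in $L^2(\mu)$, where $m(\Omega)$ is the set of maximal (with respect to inclusion) dyadic rectangles $R=Q_1\times Q_2$ ($Q_i\in\mathcal D_i$) contained in $\Omega$, and the $a_R\in L^2(\mu)$ satisfy: $a_R$ vanishes outside $R$; $\int_{X_1}a_R(x_1,x_2)\,d\mu_1(x_1)=0$ for a.e. $x_2$ and $\int_{X_2}a_R(x_1,x_2)\,d\mu_2(x_2)=0$ for a.e. $x_1$; and $\sum_{R\in m(\Omega)}\|a_R\|_{L^2}^2\le\mu(\Omega)^{-1}$. Theorem. There is a constant $C<\infty$, independent of the functions, atoms and scalars below, such that the following hold. (a) Let $f\in H^1_{\mathcal D_1,\mathcal D_2}\cap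 L^2(\mu)$. Suppose that $\mu_1(X_1)=\infty$ or $\int_{X_1}f(x_1,x_2)\,d\mu_1(x_1)=0$ for a.e. $x_2$, and that $\mu_2(X_2)=\infty$ or $\int_{X_2}f(x_1,x_2)\,d\mu_2(x_2)=0$ for a.e. $x_1$. Then there are dyadic atoms $a_k$ and scalars $\lambda_k$ with $f=\sum_k\lambda_ka_k$, with unconditional convergence in $L^2(\mu)$ and in $L^1(\mu)$, and $\sum_k|\lambda_k|\le C\|f\|_{H^1_{\mathcal D_1,\mathcal D_2}}$. (b) Conversely, let $a_k$ be dyadic atoms and $\lambda_k$ scalars with $\sum_k|\lambda_k|<\infty$. Then $\sum_k\lambda_ka_k$ converges unconditionally in $L^1(\mu)$. If $f=\sum_k\lambda_ka_k$ with unconditional convergence in $L^1(\mu)$ or in $L^2(\mu)$, then $f\in H^1_{\mathcal D_1,\mathcal D_2}$ and $\|f\|_{H^1_{\mathcal D_1,\mathcal D_2}}\le C\sum_k|\lambda_k|$. -/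

import Mathlib

open MeasureTheory Filter Topology
open scoped ENNReal NNReal

noncomputable section

namespace DyadicHardy

/-! ### Spaces of homogeneous type -/

/-- The quasi-metric ball `B(x, r)`; it need not be an open set. -/
def qball {X : Type*} (ρ : X → X → ℝ) (x : X) (r : ℝ) : Set X := {y | ρ y x < r}

/-- `ρ` is a quasi-metric: a metric except that the triangle inequality holds up to a factor. -/
structure IsQuasiMetric {X : Type*} (ρ : X → X → ℝ) : Prop where
  nonneg : ∀ x y, 0 ≤ ρ x y
  symm : ∀ x y, ρ x y = ρ y x
  eq_zero_iff : ∀ x y, ρ x y = 0 ↔ x = y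
  quasi_triangle : ∃ A₀ : ℝ, 1 ≤ A₀ ∧ ∀ x y z, ρ x y ≤ A₀ * (ρ x z + ρ z y)

/-- `(X, ρ, μ)` is a space of homogeneous type (Coifman and Weiss). The topology of `X` is the one
induced by `ρ`: a set is open iff with each of its points it contains a ball around that point. -/
structure IsHomogeneousType {X : Type*} [TopologicalSpace X] [MeasurableSpace X]
    (ρ : X → X → ℝ) (μ : Measure X) : Prop where
  quasiMetric : IsQuasiMetric ρ
  isOpen_iff : ∀ U : Set X, IsOpen U ↔ ∀ x ∈ U, ∃ ε : ℝ, 0 < ε ∧ qball ρ x ε ⊆ U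
  measure_ne_zero : μ ≠ 0
  doubling : ∃ Cμ : ℝ≥0, ∀ (x : X) (r : ℝ), 0 < r →
    μ (qball ρ x (2 * r)) ≤ Cμ * μ (qball ρ x r) ∧ μ (qball ρ x r) < ⊤

/-! ### Systems of dyadic cubes -/

/-- A system of dyadic cubes `Q^k_α` (`k ∈ ℤ`, `α ∈ idx k`) in `(X, ρ)`, with parameters
`δ ∈ (0, 1)` and `0 < c₁ ≤ C₁`. -/
structure DyadicSystem {X : Type*} [MeasurableSpace X] (ρ : X → X → ℝ) where
  δ : ℝ
  c₁ : ℝ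
  C₁ : ℝ
  δ_pos : 0 < δ
  δ_lt_one : δ < 1
  c₁_pos : 0 < c₁
  c₁_le_C₁ : c₁ ≤ C₁
  /-- the index set of the cubes of generation `k` -/
  idx : ℤ → Type
  countable_idx : ∀ k, Countable (idx k)
  /-- the cube `Q^k_α` -/
  cube : (k : ℤ) → idx k → Set X
  /-- the center point of `Q^k_α` -/
  center : (k : ℤ) → idx k → X
  measurableSet_cube : ∀ k α, MeasurableSet (cube k α)
  iUnion_cube : ∀ k, ⋃ α, cube k α = Set.univ
  disjoint_cube : ∀ k (α β : idx k), α ≠ β → Disjoint (cube k α) (cube k β)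
  nested : ∀ k l (α : idx k) (β : idx l), k ≤ l →
    cube l β ⊆ cube k α ∨ Disjoint (cube k α) (cube l β)
  existsUnique_ancestor : ∀ k l (α : idx k), l ≤ k → ∃! β : idx l, cube k α ⊆ cube l β
  /-- the uniform bound for the number of children -/
  M : ℕ
  one_le_ncard_children : ∀ k (α : idx k),
    1 ≤ {β : idx (k + 1) | cube (k + 1) β ⊆ cube k α}.ncard
  ncard_children_le : ∀ k (α : idx k),
    {β : idx (k + 1) | cube (k + 1) β ⊆ cube k α}.ncard ≤ M
  cube_eq_iUnion_children : ∀ k (α : idx k),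
    cube k α = ⋃ β ∈ {β : idx (k + 1) | cube (k + 1) β ⊆ cube k α}, cube (k + 1) β
  ball_subset_cube : ∀ k α, qball ρ (center k α) (c₁ * δ ^ k) ⊆ cube k α
  cube_subset_ball : ∀ k α, cube k α ⊆ qball ρ (center k α) (C₁ * δ ^ k)
  ball_mono : ∀ k l (α : idx k) (β : idx l), k ≤ l → cube l β ⊆ cube k α →
    qball ρ (center l β) (C₁ * δ ^ l) ⊆ qball ρ (center k α) (C₁ * δ ^ k)

namespace DyadicSystem

variable {X : Type*} [MeasurableSpace X] {ρ : X → X → ℝ}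

/-- Indices of all dyadic cubes, of all generations. -/
abbrev Index (D : DyadicSystem ρ) : Type := Σ k : ℤ, D.idx k

/-- The cube with a given index. -/
def Q (D : DyadicSystem ρ) (p : D.Index) : Set X := D.cube p.1 p.2

/-- The (indices of the) children of a cube of generation `k`: the cubes of generation `k + 1`
that it contains. -/
def children (D : DyadicSystem ρ) (p : D.Index) : Set (D.idx (p.1 + 1)) :=
  {β | D.cube (p.1 + 1) β ⊆ D.cube p.1 p.2}

/-- The number `M_Q` of children of a cube. -/
def numChildren (D : DyadicSystem ρ) (p : D.Index) : ℕ := (D.children p).ncard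

end DyadicSystem

/-! ### Haar functions -/

/-- An enumeration `Q_0, …, Q_{M_Q - 1}` of the children of every dyadic cube `Q`, ordered so that
`∑_{j ≥ u} μ(Q_j) ≥ (1 - u / M_Q) μ(Q)` for every `u` (for example, by increasing measure). The
numbering starts from `0`. -/
structure ChildIndexing {X : Type*} [MeasurableSpace X] {ρ : X → X → ℝ}
    (D : DyadicSystem ρ) (μ : Measure X) where
  enum : (p : D.Index) → Fin (D.numChildren p) ≃ D.children p
  tail_ge : ∀ (p : D.Index) (u : Fin (D.numChildren p)),
    (1 - ((u : ℕ) : ℝ) / (D.numChildren p : ℝ)) * μ.real (D.Q p) ≤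
      ∑ j ∈ Finset.Ici u, μ.real (D.cube (p.1 + 1) (enum p j))

namespace ChildIndexing

variable {X : Type*} [MeasurableSpace X] {ρ : X → X → ℝ} {D : DyadicSystem ρ} {μ : Measure X}

/-- The child `Q_u` of the cube `Q`. -/
def child (I : ChildIndexing D μ) (p : D.Index) (u : Fin (D.numChildren p)) : Set X :=
  D.cube (p.1 + 1) (I.enum p u)

/-- `E_u`, the union of the children `Q_j` with `j ≥ u`. -/
def tail (I : ChildIndexing D μ) (p : D.Index) (u : ℕ) : Set X :=
  ⋃ (j : Fin (D.numChildren p)) (_ : u ≤ j), I.child p j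

/-- The cancellative Haar function `h_Q^u = a_u 1_{Q_u} - b_u 1_{E_{u+1}}`, one for each of the
children of `Q` but the last (and `0` if `μ(Q_u) = 0`), where
`a_u = (μ(E_{u+1}) / (μ(Q_u) μ(E_u)))^{1/2}` and `b_u = (μ(Q_u) / (μ(E_u) μ(E_{u+1})))^{1/2}`. -/
def haar (I : ChildIndexing D μ) (p : D.Index) (u : Fin (D.numChildren p - 1)) : X → ℝ :=
  open Classical in
  let Qu : Set X := I.child p (u.castLE (Nat.sub_le _ _))
  let E : Set X := I.tail p (u : ℕ)
  let E' : Set X := I.tail p ((u : ℕ) + 1)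
  let a : ℝ := √(μ.real E') / (√(μ.real Qu) * √(μ.real E))
  let b : ℝ := √(μ.real Qu) / (√(μ.real E) * √(μ.real E'))
  fun x => if μ Qu = 0 then 0
    else a * Qu.indicator (fun _ => (1 : ℝ)) x - b * E'.indicator (fun _ => (1 : ℝ)) x

end ChildIndexing

/-! ### The dyadic product Hardy space -/

section Product

variable {X₁ X₂ : Type*} [MeasurableSpace X₁] [MeasurableSpace X₂]
  {ρ₁ : X₁ → X₁ → ℝ} {ρ₂ : X₂ → X₂ → ℝ}
  {D₁ : DyadicSystem ρ₁} {D₂ : DyadicSystem ρ₂} {μ₁ : Measure X₁} {μ₂ : Measure X₂}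
  {𝕜 : Type*} [RCLike 𝕜]

/-- The Haar coefficient `⟨f, h_{Q₁}^{u₁} h_{Q₂}^{u₂}⟩`. -/
def haarCoeff (I₁ : ChildIndexing D₁ μ₁) (I₂ : ChildIndexing D₂ μ₂) (f : X₁ × X₂ → 𝕜)
    (p : D₁.Index) (q : D₂.Index)
    (u : Fin (D₁.numChildren p - 1)) (v : Fin (D₂.numChildren q - 1)) : 𝕜 :=
  ∫ z, (I₁.haar p u z.1 * I₂.haar q v z.2) • f z ∂(μ₁.prod μ₂)

/-- The normalised indicator function `χ_Q μ(Q)^{-1/2}`. -/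
def normIndicator {X : Type*} [MeasurableSpace X] (μ : Measure X) (Q : Set X) (x : X) : ℝ≥0∞ :=
  Q.indicator (fun _ => μ Q ^ (-(1 / 2) : ℝ)) x

/-- The dyadic product square function `S_{d,d}(f)`, with values in `[0, ∞]`. -/
def squareFunction (I₁ : ChildIndexing D₁ μ₁) (I₂ : ChildIndexing D₂ μ₂) (f : X₁ × X₂ → 𝕜)
    (z : X₁ × X₂) : ℝ≥0∞ :=
  (∑' (p : D₁.Index) (q : D₂.Index),
    ∑ u : Fin (D₁.numChildren p - 1), ∑ v : Fin (D₂.numChildren q - 1),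
      (‖haarCoeff I₁ I₂ f p q u v‖ₑ *
        normIndicator μ₁ (D₁.Q p) z.1 * normIndicator μ₂ (D₂.Q q) z.2) ^ 2) ^ (1 / 2 : ℝ)

/-- The norm `‖f‖_{H¹_{d,d}} = ‖S_{d,d}(f)‖_{L¹}`. -/
def hardyNorm (I₁ : ChildIndexing D₁ μ₁) (I₂ : ChildIndexing D₂ μ₂) (f : X₁ × X₂ → 𝕜) : ℝ≥0∞ :=
  ∫⁻ z, squareFunction I₁ I₂ f z ∂(μ₁.prod μ₂)

/-- `f ∈ H¹_{d,d}`: both `f` and `S_{d,d}(f)` belong to `L¹`. -/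
def MemHardy (I₁ : ChildIndexing D₁ μ₁) (I₂ : ChildIndexing D₂ μ₂) (f : X₁ × X₂ → 𝕜) : Prop :=
  MemLp f 1 (μ₁.prod μ₂) ∧ hardyNorm I₁ I₂ f < ⊤

/-! ### Dyadic atoms -/

/-- `R` is a dyadic rectangle `Q₁ × Q₂` with `Q₁ ∈ 𝒟₁` and `Q₂ ∈ 𝒟₂`. -/
def IsDyadicRect (D₁ : DyadicSystem ρ₁) (D₂ : DyadicSystem ρ₂) (R : Set (X₁ × X₂)) : Prop :=
  ∃ (p : D₁.Index) (q : D₂.Index), R = D₁.Q p ×ˢ D₂.Q q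

/-- `m(Ω)`, the set of maximal dyadic rectangles contained in `Ω`. -/
def maxRects (D₁ : DyadicSystem ρ₁) (D₂ : DyadicSystem ρ₂) (Ω : Set (X₁ × X₂)) :
    Set (Set (X₁ × X₂)) :=
  {R | Maximal (fun R' => IsDyadicRect D₁ D₂ R' ∧ R' ⊆ Ω) R}

/-- `b` is square integrable, vanishes outside the rectangle `R`, and has vanishing integral in
each variable. -/
structure IsRectAtom (μ₁ : Measure X₁) (μ₂ : Measure X₂) (R : Set (X₁ × X₂))
    (b : X₁ × X₂ → 𝕜) : Prop where
  memLp : MemLp b 2 (μ₁.prod μ₂)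
  support_subset : Function.support b ⊆ R
  integral_fst : ∀ᵐ x₂ ∂μ₂, ∫ x₁, b (x₁, x₂) ∂μ₁ = 0
  integral_snd : ∀ᵐ x₁ ∂μ₁, ∫ x₂, b (x₁, x₂) ∂μ₂ = 0

/-- `a` is a dyadic product atom. The series of rectangle atoms converges to `a` unconditionally
in `L²`. -/
def IsDyadicAtom [TopologicalSpace X₁] [TopologicalSpace X₂]
    (D₁ : DyadicSystem ρ₁) (D₂ : DyadicSystem ρ₂) (μ₁ : Measure X₁) (μ₂ : Measure X₂)
    (a : X₁ × X₂ → 𝕜) : Prop :=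
  ∃ Ω : Set (X₁ × X₂), IsOpen Ω ∧ μ₁.prod μ₂ Ω < ⊤ ∧
    Function.support a ⊆ Ω ∧
    MemLp a 2 (μ₁.prod μ₂) ∧ eLpNorm a 2 (μ₁.prod μ₂) ≤ μ₁.prod μ₂ Ω ^ (-(1 / 2) : ℝ) ∧
    ∃ b : maxRects D₁ D₂ Ω → X₁ × X₂ → 𝕜,
      (∀ R : maxRects D₁ D₂ Ω, IsRectAtom μ₁ μ₂ R.1 (b R)) ∧
      Tendsto (fun s : Finset (maxRects D₁ D₂ Ω) =>
        eLpNorm (a - ∑ R ∈ s, b R) 2 (μ₁.prod μ₂)) atTop (𝓝 0) ∧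
      ∑' R, eLpNorm (b R) 2 (μ₁.prod μ₂) ^ 2 ≤ (μ₁.prod μ₂ Ω)⁻¹

/-- `f = ∑_k c_k a_k`, with unconditional convergence in `L^r(μ)`. -/
def IsSeriesSum {Y : Type*} [MeasurableSpace Y] (r : ℝ≥0∞) (μ : Measure Y)
    (c : ℕ → 𝕜) (a : ℕ → Y → 𝕜) (f : Y → 𝕜) : Prop :=
  MemLp f r μ ∧
    Tendsto (fun s : Finset ℕ => eLpNorm (f - ∑ k ∈ s, c k • a k) r μ) atTop (𝓝 0)

end Product

end DyadicHardy

end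

open DyadicHardy

/-!
The proof follows the scheme of Chang and Fefferman; dyadic rectangles make it simpler than in the
continuous setting.

*Series of atoms.* A product Haar function `h_P` has a nonzero coefficient against a rectangle atom
on `R` only if its rectangle `P` lies inside `R`: otherwise one of its factors is constant on the
corresponding side of `R`, and the atom has cancellation in that variable
(`coeff_eq_zero_of_isRectAtom`). Hence the square function of an atom is supported in its open set
`Ω`, and Hölder's and Bessel's inequalities give `‖S a‖₁ ≤ μ(Ω)^{1/2} ‖a‖₂ ≤ 1`
(`IsDyadicAtom.bounds`). Minkowski's inequality in `ℓ²` makes the square function countably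
sublinear, and the bound for series follows (`memHardy_of_isSeriesSum`).

*Atomic decomposition.* The Haar system is complete up to the means over factors of finite measure
(`hasSum_coeff_smul_haarLp`). On one factor this is because a set function that annihilates the Haar
functions of a cube has the same average over its children as over itself, and hence the same over a
cube as over its ancestors; the ancestors either have unbounded measure, which forces the average to
vanish for a functional bounded on `L²`, or exhaust the space (`ChildIndexing.apply_Q_eq_zero`).

With `E_k = {S f > 2^k}`, each rectangle `R` with a nonzero coefficient is assigned the greatest `k`
such that `E_k` fills more than half of `R` (`exists_greatest_level`). The union of the rectangles
more than half filled by `E_k` has measure at most `16 μ(E_k)`, by two one-parameter weak type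
estimates (`measure_enlargement_le`), and is covered by an open set `O_k` of at most twice that
measure. The part `f_k` of the Haar expansion of `f` at level `k` satisfies
`‖f_k‖₂² ≤ 2 ∫_{O_k ∖ E_{k+1}} (S f)² ≤ 2 (2^{k+1})² μ(O_k)`, because at least half of every
rectangle at level `k` lies outside `E_{k+1}` (`tsum_enorm_coeff_sq_le_of_squareFunction_le`).
Grouping its terms by maximal dyadic rectangles of `O_k` shows that `f_k` is a multiple of an atom,
with a factor at most `4 · 2^k μ(O_k)` (`exists_isDyadicAtom_of_hasSum`). Maximal rectangles exist
since a strictly larger dyadic rectangle is larger in measure by a fixed factor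
(`exists_subset_maxRects`). The sum over `k` of `2^k μ(E_k)` is at most `2 ‖S f‖₁`.
-/

noncomputable section

namespace DyadicHardy

/-! ### Topology and measure of spaces of homogeneous type -/

section Homogeneous

variable {X : Type*} {ρ : X → X → ℝ}

theorem qball_mono (x : X) {r s : ℝ} (h : r ≤ s) : qball ρ x r ⊆ qball ρ x s :=
  fun _ hy => lt_of_lt_of_le (show ρ _ x < r from hy) h

theorem iUnion_qball (x : X) {r : ℝ} (hr : 0 < r) : ⋃ n : ℕ, qball ρ x (n * r) = Set.univ := by
  refine Set.eq_univ_of_forall fun y => ?_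
  obtain ⟨n, hn⟩ := exists_nat_gt (ρ y x / r)
  exact Set.mem_iUnion.2 ⟨n, by simpa [qball, div_lt_iff₀ hr] using hn⟩

theorem monotone_qball (x : X) {r : ℝ} (hr : 0 < r) :
    Monotone fun n : ℕ => qball ρ x (n * r) := by
  intro m n hmn
  exact qball_mono x (by gcongr)

/-- The uniformity of a quasi-metric, generated by the sets `{ρ < ε}`. -/
def IsQuasiMetric.core (h : IsQuasiMetric ρ) : UniformSpace.Core X :=
  UniformSpace.Core.mk' (comap (fun p : X × X => ρ p.2 p.1) (𝓝 0))
    (by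
      rintro r ⟨t, ht, htr⟩ x
      exact htr (by simpa [(h.eq_zero_iff x x).2 rfl] using mem_of_mem_nhds ht))
    (by
      rintro r ⟨t, ht, htr⟩
      refine ⟨t, ht, fun p hp => htr ?_⟩
      simpa [h.symm p.1 p.2] using hp)
    (by
      rintro r ⟨t, ht, htr⟩
      obtain ⟨ε, hε, hεt⟩ := Metric.mem_nhds_iff.1 ht
      obtain ⟨A, hA, htri⟩ := h.quasi_triangle
      have hA0 : 0 < A := by linarith
      refine ⟨_, preimage_mem_comap (Metric.ball_mem_nhds 0 (ε := ε / (2 * A)) (by positivity)), ?_⟩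
      rintro ⟨x, z⟩ ⟨y, hxy, hyz⟩
      refine htr (hεt ?_)
      simp only [Set.mem_preimage, Metric.mem_ball, dist_zero_right, Real.norm_eq_abs,
        abs_of_nonneg (h.nonneg _ _)] at hxy hyz ⊢
      calc ρ z x ≤ A * (ρ z y + ρ y x) := htri _ _ _
        _ < A * (ε / (2 * A) + ε / (2 * A)) := by gcongr
        _ = ε := by field_simp; ring)

theorem IsQuasiMetric.mem_comap_core (h : IsQuasiMetric ρ) (x : X) (U : Set X) :
    U ∈ comap (Prod.mk x) h.core.uniformity ↔ ∃ ε : ℝ, 0 < ε ∧ qball ρ x ε ⊆ U := by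
  change U ∈ comap (Prod.mk x) (comap (fun p : X × X => ρ p.2 p.1) (𝓝 0)) ↔ _
  rw [comap_comap, mem_comap]
  constructor
  · rintro ⟨t, ht, htU⟩
    obtain ⟨ε, hε, hεt⟩ := Metric.mem_nhds_iff.1 ht
    refine ⟨ε, hε, fun y hy => htU (hεt ?_)⟩
    simpa [abs_of_nonneg (h.nonneg _ _), qball] using hy
  · rintro ⟨ε, hε, hU⟩
    refine ⟨_, Metric.ball_mem_nhds 0 hε, fun y hy => hU ?_⟩
    simpa [abs_of_nonneg (h.nonneg _ _), qball] using hy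

theorem tendsto_measure_qball [MeasurableSpace X] {μ : Measure X} (x : X) {r : ℝ} (hr : 0 < r) :
    Tendsto (fun n : ℕ => μ (qball ρ x (n * r))) atTop (𝓝 (μ Set.univ)) := by
  rw [← iUnion_qball (ρ := ρ) x hr]
  exact tendsto_measure_iUnion_atTop (monotone_qball x hr)

variable [TopologicalSpace X] [MeasurableSpace X] {μ : Measure X}

namespace IsHomogeneousType

/-- The topology is that of a uniformity with a countable basis, and hence pseudometrizable. -/
theorem topology_eq (h : IsHomogeneousType ρ μ) :
    ‹TopologicalSpace X› = h.quasiMetric.core.toTopologicalSpace := by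
  refine TopologicalSpace.ext_iff.2 fun U => ?_
  refine (h.isOpen_iff U).trans (Iff.symm ?_)
  refine (@isOpen_iff_mem_nhds _ h.quasiMetric.core.toTopologicalSpace U).trans ?_
  simp_rw [UniformSpace.Core.nhds_toTopologicalSpace, h.quasiMetric.mem_comap_core]

theorem mem_nhds_iff (h : IsHomogeneousType ρ μ) {x : X} {U : Set X} :
    U ∈ 𝓝 x ↔ ∃ ε : ℝ, 0 < ε ∧ qball ρ x ε ⊆ U := by
  have := h.quasiMetric.core.nhds_toTopologicalSpace x
  rw [← h.topology_eq] at this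
  rw [this, h.quasiMetric.mem_comap_core]

theorem pseudoMetrizableSpace (h : IsHomogeneousType ρ μ) :
    TopologicalSpace.PseudoMetrizableSpace X := by
  let _ : UniformSpace X := UniformSpace.ofCoreEq h.quasiMetric.core _ h.topology_eq
  have : (uniformity X).IsCountablyGenerated :=
    inferInstanceAs (comap (fun p : X × X => ρ p.2 p.1) (𝓝 0)).IsCountablyGenerated
  infer_instance

theorem isLocallyFiniteMeasure (h : IsHomogeneousType ρ μ) : IsLocallyFiniteMeasure μ := by
  obtain ⟨C, hC⟩ := h.doubling
  exact ⟨fun x => ⟨qball ρ x 1, h.mem_nhds_iff.2 ⟨1, one_pos, subset_rfl⟩, (hC x 1 one_pos).2⟩⟩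

theorem measure_qball_lt_top (h : IsHomogeneousType ρ μ) (x : X) (r : ℝ) :
    μ (qball ρ x r) < ⊤ := by
  obtain ⟨C, hC⟩ := h.doubling
  refine (measure_mono ?_).trans_lt (hC x (max r 1) (by positivity)).2
  exact qball_mono x (le_max_left _ _)

/-- Iterated doubling: dilating a ball by `K` costs a factor that depends on `K` only. -/
theorem exists_measure_qball_le (h : IsHomogeneousType ρ μ) (K : ℝ) :
    ∃ C : ℝ≥0, ∀ (x : X) (r : ℝ), 0 < r → μ (qball ρ x (K * r)) ≤ C * μ (qball ρ x r) := by
  obtain ⟨C, hC⟩ := h.doubling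
  obtain ⟨n, hn⟩ := pow_unbounded_of_one_lt K (one_lt_two)
  refine ⟨C ^ n, fun x r hr => ?_⟩
  have key : ∀ m : ℕ, μ (qball ρ x (2 ^ m * r)) ≤ (C : ℝ≥0∞) ^ m * μ (qball ρ x r) := by
    intro m
    induction m with
    | zero => simp
    | succ m ih =>
      calc μ (qball ρ x (2 ^ (m + 1) * r)) = μ (qball ρ x (2 * (2 ^ m * r))) := by ring_nf
        _ ≤ C * μ (qball ρ x (2 ^ m * r)) := (hC x _ (by positivity)).1
        _ ≤ C * (C ^ m * μ (qball ρ x r)) := by gcongr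
        _ = _ := by ring
  refine (measure_mono (qball_mono x ?_)).trans ((key n).trans_eq (by simp))
  gcongr

theorem measure_qball_pos (h : IsHomogeneousType ρ μ) (x : X) {r : ℝ} (hr : 0 < r) :
    0 < μ (qball ρ x r) := by
  by_contra h0
  have h0 : μ (qball ρ x r) = 0 := by simpa using h0
  refine h.measure_ne_zero (Measure.measure_univ_eq_zero.1 ?_)
  rw [← iUnion_qball (ρ := ρ) x hr, measure_iUnion_null_iff]
  intro n
  obtain ⟨C, hC⟩ := h.exists_measure_qball_le n
  simpa [h0] using hC x r hr

/-- A ball need not be open, but a smaller concentric ball lies in its interior. -/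
theorem exists_qball_subset_interior (h : IsHomogeneousType ρ μ) :
    ∃ L : ℝ, 1 ≤ L ∧ ∀ (x : X) (r : ℝ), 0 < r → qball ρ x r ⊆ interior (qball ρ x (L * r)) := by
  obtain ⟨A, hA, htri⟩ := h.quasiMetric.quasi_triangle
  refine ⟨2 * A, by linarith, fun x r hr y hy => ?_⟩
  refine mem_interior_iff_mem_nhds.2 (h.mem_nhds_iff.2 ⟨r, hr, fun z hz => ?_⟩)
  have hy : ρ y x < r := hy
  have hz : ρ z y < r := hz
  have := htri z x y
  change ρ z x < _
  nlinarith

/-- A space of homogeneous type with finite measure is bounded: otherwise there would be balls far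
from the bulk of the measure whose dilates, by a bounded factor, contain that bulk. -/
theorem exists_qball_eq_univ [BorelSpace X] (h : IsHomogeneousType ρ μ)
    (hfin : μ Set.univ ≠ ⊤) (x : X) : ∃ R : ℝ, 0 < R ∧ qball ρ x R = Set.univ := by
  obtain ⟨A, hA, htri⟩ := h.quasiMetric.quasi_triangle
  have hA0 : 0 < A := by linarith
  obtain ⟨L, hL, hint⟩ := h.exists_qball_subset_interior
  obtain ⟨C, hC⟩ := h.exists_measure_qball_le (L * (A * (1 + 2 * A)))
  have hpos : 0 < μ Set.univ := pos_iff_ne_zero.2 (by simpa using h.measure_ne_zero)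
  set V := μ.real Set.univ with hV
  have hV0 : 0 < V := ENNReal.toReal_pos hpos.ne' hfin
  have : IsFiniteMeasure μ := ⟨hfin.lt_top⟩
  have ht : Tendsto (fun n : ℕ => μ.real (qball ρ x (n * 1))) atTop (𝓝 V) :=
    (ENNReal.tendsto_toReal hfin).comp (tendsto_measure_qball x one_pos)
  have hlt : C * V / (C + 1) < V := by
    rw [div_lt_iff₀ (by positivity)]; nlinarith
  obtain ⟨n, hn, hn1⟩ := ((ht.eventually (lt_mem_nhds hlt)).and (eventually_ge_atTop 1)).exists
  have hn1' : (1 : ℝ) ≤ n := by exact_mod_cast hn1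
  rw [mul_one] at hn
  refine ⟨2 * A * n, by positivity, Set.eq_univ_of_forall fun y => ?_⟩
  by_contra hy
  have hy : 2 * A * n ≤ ρ y x := not_lt.1 hy
  set r := ρ y x / (2 * A) with hr
  have hyr : ρ y x = 2 * A * r := by rw [hr]; field_simp
  have hnr : (n : ℝ) ≤ r := by rw [hr, le_div_iff₀ (by positivity)]; linarith
  have hr0 : 0 < r := by linarith
  have hdisj : qball ρ x n ⊆ (qball ρ y r)ᶜ := by
    intro z hz hz'
    have hz : ρ z x < n := hz
    have hz' : ρ z y < r := hz'
    have h1 := htri y x z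
    rw [h.quasiMetric.symm y z] at h1
    have h2 : A * (ρ z y + ρ z x) < A * (r + r) := by gcongr; linarith
    linarith
  have hsub : qball ρ x n ⊆ qball ρ y (A * (1 + 2 * A) * r) := by
    intro z hz
    have hz : ρ z x < n := hz
    have h1 := htri z y x
    rw [h.quasiMetric.symm x y] at h1
    have h2 : A * (ρ z x + ρ y x) < A * (r + 2 * A * r) := by
      rw [hyr]; gcongr; linarith
    change ρ z y < _
    linarith
  have hL0 : 0 < L := by linarith
  have h1 : μ.real (qball ρ x n) ≤ C * μ.real (qball ρ y (r / L)) := by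
    have := hC y (r / L) (by positivity)
    rw [show L * (A * (1 + 2 * A)) * (r / L) = A * (1 + 2 * A) * r by field_simp] at this
    have := (measure_mono hsub).trans this
    have := ENNReal.toReal_mono (ENNReal.mul_ne_top ENNReal.coe_ne_top
      (h.measure_qball_lt_top y _).ne) this
    simpa [Measure.real] using this
  -- the balls need not be measurable, so disjointness is used through an interior
  have h2 : μ.real (qball ρ x n) + μ.real (qball ρ y (r / L)) ≤ V := by
    have hm : MeasurableSet (interior (qball ρ y r)) := isOpen_interior.measurableSet
    have hi : qball ρ y (r / L) ⊆ interior (qball ρ y r) := by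
      have := hint y (r / L) (by positivity)
      rwa [mul_div_cancel₀ _ hL0.ne'] at this
    rw [hV, ← measureReal_add_measureReal_compl hm, add_comm]
    exact add_le_add (measureReal_mono hi)
      (measureReal_mono (hdisj.trans (Set.compl_subset_compl.2 interior_subset)))
  rw [div_lt_iff₀ (by positivity)] at hn
  have hC0 : (0 : ℝ) ≤ C := C.2
  nlinarith

end IsHomogeneousType

end Homogeneous

/-! ### Dyadic cubes -/

namespace DyadicSystem

section Combinatorics

variable {X : Type*} [MeasurableSpace X] {ρ : X → X → ℝ} (D : DyadicSystem ρ)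

instance (k : ℤ) : Countable (D.idx k) := D.countable_idx k

theorem exists_mem_cube (k : ℤ) (x : X) : ∃ α, x ∈ D.cube k α := by
  have : x ∈ ⋃ α, D.cube k α := D.iUnion_cube k ▸ Set.mem_univ x
  simpa using this

theorem measurableSet_Q (p : D.Index) : MeasurableSet (D.Q p) := D.measurableSet_cube _ _

variable {D}

theorem cube_subset_of_mem {k l : ℤ} {α : D.idx k} {β : D.idx l} (hkl : k ≤ l) {x : X}
    (hα : x ∈ D.cube k α) (hβ : x ∈ D.cube l β) : D.cube l β ⊆ D.cube k α :=
  (D.nested k l α β hkl).resolve_right fun h => Set.disjoint_left.1 h hα hβ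

theorem eq_of_mem_cube {k : ℤ} {α β : D.idx k} {x : X} (hα : x ∈ D.cube k α)
    (hβ : x ∈ D.cube k β) : α = β :=
  by_contra fun h => Set.disjoint_left.1 (D.disjoint_cube k α β h) hα hβ

theorem Q_subset_or (p q : D.Index) : D.Q p ⊆ D.Q q ∨ D.Q q ⊆ D.Q p ∨ Disjoint (D.Q p) (D.Q q) := by
  rcases le_total p.1 q.1 with h | h
  · rcases D.nested p.1 q.1 p.2 q.2 h with h | h
    exacts [Or.inr (Or.inl h), Or.inr (Or.inr h)]
  · rcases D.nested q.1 p.1 q.2 p.2 h with h | h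
    exacts [Or.inl h, Or.inr (Or.inr h.symm)]

theorem center_mem (h : IsQuasiMetric ρ) (k : ℤ) (α : D.idx k) : D.center k α ∈ D.cube k α := by
  refine D.ball_subset_cube k α ?_
  have := D.c₁_pos
  have := D.δ_pos
  change ρ _ _ < _
  rw [(h.eq_zero_iff _ _).2 rfl]
  positivity

/-- The cubes together with the empty set are closed under intersections. -/
theorem isPiSystem_cubes : IsPiSystem (Set.range D.Q) := by
  rintro _ ⟨p, rfl⟩ _ ⟨q, rfl⟩ hne
  rcases Q_subset_or p q with h | h | h
  · exact ⟨p, (Set.inter_eq_left.2 h).symm⟩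
  · exact ⟨q, (Set.inter_eq_right.2 h).symm⟩
  · exact absurd h (Set.not_disjoint_iff_nonempty_inter.2 hne)

/-- A weak type estimate: if `E` fills a fixed proportion of each cube of a family, then the
measure of the union of the family is controlled by that of `E`. -/
theorem measure_biUnion_Q_le {μ : Measure X} {E : Set X} {C : ℝ≥0∞} {S : Set D.Index}
    (hS : ∀ p ∈ S, μ (D.Q p) ≤ C * μ (E ∩ D.Q p)) : μ (⋃ p ∈ S, D.Q p) ≤ C * μ E := by
  classical
  -- for a finite family, discard a largest cube and everything inside it, and use induction
  have key : ∀ n : ℕ, ∀ F : Finset D.Index, F.card ≤ n → (∀ p ∈ F, p ∈ S) →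
      μ (⋃ p ∈ F, D.Q p) ≤ C * μ (E ∩ ⋃ p ∈ F, D.Q p) := by
    intro n
    induction n with
    | zero =>
      intro F hF _
      have : F = ∅ := Finset.card_eq_zero.1 (Nat.le_zero.1 hF)
      simp [this]
    | succ n ih =>
      intro F hF hFS
      rcases F.eq_empty_or_nonempty with rfl | hne
      · simp
      obtain ⟨q, hq, hmin⟩ := F.exists_min_image (fun p : D.Index => p.1) hne
      set F' := F.filter fun p => Disjoint (D.Q q) (D.Q p) ∧ p ≠ q with hF'
      have hcard : F'.card ≤ n := by
        have : F'.card < F.card := by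
          refine Finset.card_lt_card (Finset.filter_ssubset.2 ⟨q, hq, by simp⟩)
        omega
      have hU : (⋃ p ∈ F, D.Q p) = D.Q q ∪ ⋃ p ∈ F', D.Q p := by
        refine Set.Subset.antisymm ?_ ?_
        · refine Set.iUnion₂_subset fun p hp => ?_
          by_cases hpq : p = q
          · subst hpq; exact Set.subset_union_left
          rcases D.nested q.1 p.1 q.2 p.2 (hmin p hp) with h | h
          · exact Set.subset_union_of_subset_left h _
          · refine Set.subset_union_of_subset_right ?_ _
            exact Set.subset_biUnion_of_mem (u := fun p => D.Q p)
              (show p ∈ F' from Finset.mem_filter.2 ⟨hp, h, hpq⟩)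
        · refine Set.union_subset (Set.subset_biUnion_of_mem (u := fun p => D.Q p) hq) ?_
          exact Set.biUnion_subset_biUnion_left fun p hp => (Finset.mem_filter.1 hp).1
      have hdisj : Disjoint (D.Q q) (⋃ p ∈ F', D.Q p) := by
        simp only [Set.disjoint_iUnion_right]
        exact fun p hp => (Finset.mem_filter.1 hp).2.1
      rw [hU, Set.inter_union_distrib_left]
      calc μ (D.Q q ∪ ⋃ p ∈ F', D.Q p) ≤ μ (D.Q q) + μ (⋃ p ∈ F', D.Q p) := measure_union_le _ _
        _ ≤ C * μ (E ∩ D.Q q) + C * μ (E ∩ ⋃ p ∈ F', D.Q p) :=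
            add_le_add (hS q (hFS q hq))
              (ih F' hcard fun p hp => hFS p (Finset.mem_filter.1 hp).1)
        _ = C * μ ((E ∩ D.Q q) ∪ (E ∩ ⋃ p ∈ F', D.Q p)) := by
            rw [← mul_add]
            have hm : MeasurableSet (D.Q q) := D.measurableSet_Q q
            rw [← measure_inter_add_sdiff ((E ∩ D.Q q) ∪ (E ∩ ⋃ p ∈ F', D.Q p)) hm]
            congr 3
            · rw [Set.union_inter_distrib_right, Set.inter_assoc, Set.inter_self, Set.inter_assoc,
                hdisj.symm.inter_eq, Set.inter_empty, Set.union_empty]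
            · rw [Set.union_sdiff_distrib, Set.sdiff_eq_empty.2 Set.inter_subset_right,
                Set.empty_union, Set.inter_sdiff_assoc, hdisj.symm.sdiff_eq_left]
  have hcover : (⋃ p ∈ S, D.Q p) = ⋃ F : Finset S, ⋃ p ∈ F.image Subtype.val, D.Q p := by
    refine Set.Subset.antisymm ?_ ?_
    · refine Set.iUnion₂_subset fun p hp => ?_
      refine Set.subset_iUnion_of_subset {⟨p, hp⟩} ?_
      simp
    · refine Set.iUnion_subset fun F => Set.iUnion₂_subset fun p hp => ?_
      obtain ⟨⟨p', hp'⟩, -, rfl⟩ := Finset.mem_image.1 hp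
      exact Set.subset_biUnion_of_mem (u := fun p => D.Q p) hp'
  rw [hcover, Directed.measure_iUnion]
  · refine iSup_le fun F => (key _ _ le_rfl ?_).trans ?_
    · intro p hp
      obtain ⟨⟨p', hp'⟩, -, rfl⟩ := Finset.mem_image.1 hp
      exact hp'
    · gcongr; exact Set.inter_subset_left
  · refine directed_of_isDirected_le fun F G hFG => ?_
    exact Set.biUnion_subset_biUnion_left (Finset.image_subset_image hFG)

/-- For `l → -∞`, the scale `δ ^ l` exceeds any bound. -/
theorem exists_scale_gt (D : DyadicSystem ρ) (k : ℤ) (K : ℝ) : ∃ l ≤ k, K < D.δ ^ l := by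
  obtain ⟨n, hn⟩ := pow_unbounded_of_one_lt (K / D.δ ^ k) (one_lt_inv_iff₀.2 ⟨D.δ_pos, D.δ_lt_one⟩)
  have hδ := D.δ_pos
  refine ⟨k - n, by omega, ?_⟩
  rw [div_lt_iff₀ (by positivity)] at hn
  rw [zpow_sub₀ hδ.ne', zpow_natCast, div_eq_inv_mul, ← inv_pow]
  exact hn

theorem exists_rho_lt_of_mem_cube (h : IsQuasiMetric ρ) (D : DyadicSystem ρ) :
    ∃ K : ℝ, 0 < K ∧ ∀ (k : ℤ) (α : D.idx k), ∀ x ∈ D.cube k α, ∀ y ∈ D.cube k α,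
      ρ y x < K * D.δ ^ k := by
  obtain ⟨A, hA, htri⟩ := h.quasi_triangle
  have hc := D.c₁_pos.trans_le D.c₁_le_C₁
  refine ⟨A * (D.C₁ + D.C₁), by positivity, fun k α x hx y hy => ?_⟩
  have hx' : ρ x (D.center k α) < D.C₁ * D.δ ^ k := D.cube_subset_ball k α hx
  have hy' : ρ y (D.center k α) < D.C₁ * D.δ ^ k := D.cube_subset_ball k α hy
  have h1 := htri y x (D.center k α)
  rw [h.symm (D.center k α) x] at h1
  have : A * (ρ y (D.center k α) + ρ x (D.center k α))
    < A * (D.C₁ * D.δ ^ k + D.C₁ * D.δ ^ k) := by gcongr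
  nlinarith

end Combinatorics

section Geometry

variable {X : Type*} [TopologicalSpace X] [MeasurableSpace X] {ρ : X → X → ℝ} {μ : Measure X}
  {D : DyadicSystem ρ}

theorem exists_measure_qball_le_cube (h : IsHomogeneousType ρ μ) (D : DyadicSystem ρ) (K : ℝ) :
    ∃ C : ℝ≥0, ∀ (l : ℤ) (β : D.idx l), ∀ x ∈ D.cube l β,
      μ (qball ρ x (K * D.δ ^ l)) ≤ C * μ (D.cube l β) := by
  obtain ⟨A, hA, htri⟩ := h.quasiMetric.quasi_triangle
  have hc := D.c₁_pos
  have hδ := D.δ_pos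
  obtain ⟨C, hC⟩ := h.exists_measure_qball_le (A * (K + D.C₁) / D.c₁)
  refine ⟨C, fun l β x hx => ?_⟩
  have hx' : ρ x (D.center l β) < D.C₁ * D.δ ^ l := D.cube_subset_ball l β hx
  calc μ (qball ρ x (K * D.δ ^ l))
      ≤ μ (qball ρ (D.center l β) (A * (K + D.C₁) / D.c₁ * (D.c₁ * D.δ ^ l))) := by
        refine measure_mono fun y hy => ?_
        have hy : ρ y x < K * D.δ ^ l := hy
        have h1 := htri y (D.center l β) x
        have h2 : A * (ρ y x + ρ x (D.center l β)) < A * (K * D.δ ^ l + D.C₁ * D.δ ^ l) := by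
          gcongr
        change ρ y _ < _
        have h3 : A * (K + D.C₁) / D.c₁ * (D.c₁ * D.δ ^ l)
          = A * (K * D.δ ^ l + D.C₁ * D.δ ^ l) := by field_simp
        linarith
    _ ≤ C * μ (qball ρ (D.center l β) (D.c₁ * D.δ ^ l)) := hC _ _ (by positivity)
    _ ≤ C * μ (D.cube l β) := by gcongr; exact D.ball_subset_cube l β

theorem measure_cube_pos (h : IsHomogeneousType ρ μ) (k : ℤ) (α : D.idx k) :
    0 < μ (D.cube k α) := by
  have := D.c₁_pos
  have := D.δ_pos
  exact (h.measure_qball_pos _ (by positivity)).trans_le (measure_mono (D.ball_subset_cube k α))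

theorem measure_cube_lt_top (h : IsHomogeneousType ρ μ) (k : ℤ) (α : D.idx k) :
    μ (D.cube k α) < ⊤ :=
  (measure_mono (D.cube_subset_ball k α)).trans_lt (h.measure_qball_lt_top _ _)

theorem measureReal_cube_pos (h : IsHomogeneousType ρ μ) (k : ℤ) (α : D.idx k) :
    0 < μ.real (D.cube k α) :=
  ENNReal.toReal_pos (measure_cube_pos h k α).ne' (measure_cube_lt_top h k α).ne

/-- The dyadic filtration is regular: a cube and its parent have comparable measure. -/
theorem exists_measure_parent_le (h : IsHomogeneousType ρ μ) (D : DyadicSystem ρ) :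
    ∃ C : ℝ≥0, ∀ (k l : ℤ) (α : D.idx k) (β : D.idx l), l = k + 1 →
      D.cube l β ⊆ D.cube k α → μ (D.cube k α) ≤ C * μ (D.cube l β) := by
  obtain ⟨K, hK, hρ⟩ := exists_rho_lt_of_mem_cube h.quasiMetric D
  obtain ⟨C, hC⟩ := exists_measure_qball_le_cube h D (K / D.δ)
  have hδ := D.δ_pos
  refine ⟨C, fun k l α β hl hsub => ?_⟩
  have hx := center_mem h.quasiMetric l β
  refine (measure_mono fun y hy => ?_).trans (hC l β _ hx)
  have := hρ k α _ (hsub hx) y hy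
  have hs : K / D.δ * D.δ ^ l = K * D.δ ^ k := by
    rw [hl, zpow_add_one₀ hδ.ne']; field_simp
  rw [hs]
  exact this

/-- A dyadic cube that strictly contains another one is larger by a fixed factor. -/
theorem exists_measure_growth (h : IsHomogeneousType ρ μ) (D : DyadicSystem ρ) :
    ∃ η : ℝ≥0, 1 < η ∧ ∀ p q : D.Index, D.Q p ⊂ D.Q q → η * μ (D.Q p) ≤ μ (D.Q q) := by
  obtain ⟨C, hC⟩ := exists_measure_parent_le h D
  have hC1 : ∀ (k l : ℤ) (α : D.idx k) (β : D.idx l), l = k + 1 →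
      D.cube l β ⊆ D.cube k α → ((C + 1)⁻¹ : ℝ≥0) * μ (D.cube k α) ≤ μ (D.cube l β) := by
    intro k l α β hl hsub
    rw [ENNReal.coe_inv (by positivity), ← ENNReal.div_eq_inv_mul]
    refine ENNReal.div_le_of_le_mul' ((hC k l α β hl hsub).trans ?_)
    gcongr
    simp
  refine ⟨1 + (C + 1)⁻¹, by simp, ?_⟩
  have key : ∀ (n : ℕ) (k l : ℤ) (α : D.idx k) (β : D.idx l), l = k + n →
      D.cube l β ⊂ D.cube k α →
      ((1 + (C + 1)⁻¹ : ℝ≥0) : ℝ≥0∞) * μ (D.cube l β) ≤ μ (D.cube k α) := by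
    intro n
    induction n with
    | zero =>
      intro k l α β hl hsub
      obtain rfl : l = k := by simpa using hl
      have hx := center_mem h.quasiMetric l β
      obtain rfl := eq_of_mem_cube hx (hsub.1 hx)
      exact absurd hsub (ssubset_irrefl _)
    | succ n ih =>
      intro k l α β hl hsub
      have hx := center_mem h.quasiMetric l β
      obtain ⟨γ, hγ⟩ := D.exists_mem_cube (k + n) (D.center l β)
      have hγα : D.cube (k + n) γ ⊆ D.cube k α := cube_subset_of_mem (by omega) (hsub.1 hx) hγ
      have hβγ : D.cube l β ⊆ D.cube (k + n) γ :=
        cube_subset_of_mem (by push_cast at hl; omega) hγ hx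
      by_cases heq : D.cube l β = D.cube (k + n) γ
      · rw [heq] at hsub ⊢
        exact ih k (k + n) α γ rfl hsub
      · obtain ⟨y, hyγ, hyβ⟩ := Set.exists_of_ssubset (hβγ.ssubset_of_ne heq)
        obtain ⟨β', hβ'⟩ := D.exists_mem_cube l y
        have hl' : l = k + n + 1 := by push_cast at hl; omega
        have hβ'γ : D.cube l β' ⊆ D.cube (k + n) γ := cube_subset_of_mem (by omega) hyγ hβ'
        have hne : β ≠ β' := by rintro rfl; exact hyβ hβ'
        calc ((1 + (C + 1)⁻¹ : ℝ≥0) : ℝ≥0∞) * μ (D.cube l β)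
            = μ (D.cube l β) + ((C + 1)⁻¹ : ℝ≥0) * μ (D.cube l β) := by
              rw [ENNReal.coe_add, add_mul]; simp
          _ ≤ μ (D.cube l β) + ((C + 1)⁻¹ : ℝ≥0) * μ (D.cube (k + n) γ) := by gcongr
          _ ≤ μ (D.cube l β) + μ (D.cube l β') := by gcongr; exact hC1 _ _ _ _ hl' hβ'γ
          _ = μ (D.cube l β ∪ D.cube l β') :=
              (measure_union (D.disjoint_cube l β β' hne) (D.measurableSet_cube _ _)).symm
          _ ≤ μ (D.cube k α) := measure_mono ((Set.union_subset hβγ hβ'γ).trans hγα)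
  intro p q hpq
  have hle : q.1 ≤ p.1 := by
    by_contra hlt
    have hx := center_mem h.quasiMetric p.1 p.2
    exact hpq.2 (cube_subset_of_mem (by omega) hx (hpq.1 hx))
  exact key (p.1 - q.1).toNat q.1 p.1 q.2 p.2 (by omega) hpq

/-- In a space of infinite measure, the ancestors of a cube have unbounded measure. -/
theorem exists_ancestor_measure_ge (h : IsHomogeneousType ρ μ) (htop : μ Set.univ = ⊤)
    (p : D.Index) (K : ℝ≥0) :
    ∃ q : D.Index, q.1 ≤ p.1 ∧ D.Q p ⊆ D.Q q ∧ (K : ℝ≥0∞) ≤ μ (D.Q q) := by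
  obtain ⟨C, hC⟩ := exists_measure_qball_le_cube h D 1
  have hx := center_mem h.quasiMetric p.1 p.2
  have ht := tendsto_measure_qball (ρ := ρ) (μ := μ) (D.center p.1 p.2) one_pos
  rw [htop] at ht
  obtain ⟨n, hn⟩ := (ht.eventually (lt_mem_nhds (a := ((C * K : ℝ≥0) : ℝ≥0∞))
    ENNReal.coe_lt_top)).exists
  obtain ⟨l, hl, hln⟩ := D.exists_scale_gt p.1 n
  obtain ⟨β, hβ⟩ := D.exists_mem_cube l (D.center p.1 p.2)
  refine ⟨⟨l, β⟩, hl, cube_subset_of_mem hl hβ hx, ?_⟩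
  have h1 : ((C * K : ℝ≥0) : ℝ≥0∞) < C * μ (D.cube l β) :=
    (hn.trans_le (measure_mono (qball_mono _ (by simpa using hln.le)))).trans_le (hC l β _ hβ)
  rw [ENNReal.coe_mul] at h1
  exact (lt_of_mul_lt_mul_left' h1).le

/-- In a space of finite measure, all cubes of sufficiently early generations are the whole
space. -/
theorem exists_ancestor_eq_univ [BorelSpace X] (h : IsHomogeneousType ρ μ)
    (hfin : μ Set.univ ≠ ⊤) (p : D.Index) :
    ∃ q : D.Index, q.1 ≤ p.1 ∧ D.Q p ⊆ D.Q q ∧ D.Q q = Set.univ := by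
  obtain ⟨A, hA, htri⟩ := h.quasiMetric.quasi_triangle
  have hx := center_mem h.quasiMetric p.1 p.2
  set x := D.center p.1 p.2
  obtain ⟨R, hR, hRu⟩ := h.exists_qball_eq_univ hfin x
  have hc := D.c₁_pos
  obtain ⟨l, hl, hlR⟩ := D.exists_scale_gt p.1 (A * (R + R) / D.c₁)
  obtain ⟨β, hβ⟩ := D.exists_mem_cube l x
  have hu : D.cube l β = Set.univ := by
    refine Set.eq_univ_of_forall fun y => D.ball_subset_cube l β ?_
    rw [div_lt_iff₀ hc] at hlR
    have h1 : ρ y x < R := (hRu ▸ Set.mem_univ y : y ∈ qball ρ x R)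
    have h2 : ρ (D.center l β) x < R := (hRu ▸ Set.mem_univ _ : _ ∈ qball ρ x R)
    have h3 := htri y (D.center l β) x
    rw [h.quasiMetric.symm x] at h3
    have : A * (ρ y x + ρ (D.center l β) x) < A * (R + R) := by gcongr
    change ρ _ _ < _
    linarith
  exact ⟨⟨l, β⟩, hl, cube_subset_of_mem hl hβ hx, hu⟩

/-- Small cubes around a point of an open set are contained in that set. -/
theorem exists_cube_subset_of_isOpen (h : IsHomogeneousType ρ μ) (D : DyadicSystem ρ) {U : Set X}
    (hU : IsOpen U) {x : X} (hx : x ∈ U) : ∃ p : D.Index, x ∈ D.Q p ∧ D.Q p ⊆ U := by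
  obtain ⟨ε, hε, hεU⟩ := (h.isOpen_iff U).1 hU x hx
  obtain ⟨K, hK, hρ⟩ := exists_rho_lt_of_mem_cube h.quasiMetric D
  obtain ⟨n, hn⟩ := exists_pow_lt_of_lt_one (show 0 < ε / K by positivity) D.δ_lt_one
  obtain ⟨α, hα⟩ := D.exists_mem_cube n x
  refine ⟨⟨n, α⟩, hα, fun y hy => hεU ?_⟩
  have := hρ n α x hα y hy
  rw [lt_div_iff₀ hK] at hn
  rw [zpow_natCast] at this
  change ρ _ _ < _
  linarith

theorem secondCountableTopology (h : IsHomogeneousType ρ μ) (D : DyadicSystem ρ) :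
    SecondCountableTopology X := by
  have := h.pseudoMetrizableSpace
  let _ : UniformSpace X := TopologicalSpace.pseudoMetrizableSpaceUniformity X
  have := TopologicalSpace.pseudoMetrizableSpaceUniformity_countably_generated X
  have : TopologicalSpace.SeparableSpace X := by
    refine ⟨Set.range fun p : D.Index => D.center p.1 p.2, Set.countable_range _, ?_⟩
    refine dense_iff_inter_open.2 fun U hU ⟨x, hx⟩ => ?_
    obtain ⟨p, -, hpU⟩ := exists_cube_subset_of_isOpen h D hU hx
    exact ⟨_, hpU (center_mem h.quasiMetric _ _), p, rfl⟩
  exact UniformSpace.secondCountable_of_separable X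

theorem generateFrom_cubes [BorelSpace X] (h : IsHomogeneousType ρ μ) (D : DyadicSystem ρ) :
    ‹MeasurableSpace X› = MeasurableSpace.generateFrom (Set.range D.Q) := by
  refine le_antisymm ?_ (MeasurableSpace.generateFrom_le ?_)
  · refine (BorelSpace.measurable_eq (α := X)).le.trans ?_
    refine MeasurableSpace.generateFrom_le fun U (hU : IsOpen U) => ?_
    have : U = ⋃ p ∈ {p : D.Index | D.Q p ⊆ U}, D.Q p := by
      refine Set.Subset.antisymm (fun x hx => ?_) (Set.iUnion₂_subset fun p hp => hp)
      obtain ⟨p, hxp, hpU⟩ := exists_cube_subset_of_isOpen h D hU hx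
      exact Set.mem_biUnion (show p ∈ {p : D.Index | D.Q p ⊆ U} from hpU) hxp
    rw [this]
    exact MeasurableSet.biUnion (Set.to_countable _) fun p _ =>
      MeasurableSpace.measurableSet_generateFrom ⟨p, rfl⟩
  · rintro _ ⟨p, rfl⟩
    exact D.measurableSet_Q p

theorem sigmaFinite (h : IsHomogeneousType ρ μ) (D : DyadicSystem ρ) : SigmaFinite μ := by
  have := secondCountableTopology h D
  have := h.isLocallyFiniteMeasure
  infer_instance

end Geometry

end DyadicSystem

/-! ### Haar functions on one factor -/

namespace ChildIndexing

section Children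

variable {X : Type*} [MeasurableSpace X] {ρ : X → X → ℝ} {D : DyadicSystem ρ} {μ : Measure X}
  (I : ChildIndexing D μ)

theorem child_subset (p : D.Index) (u : Fin (D.numChildren p)) : I.child p u ⊆ D.Q p :=
  (I.enum p u).2

theorem measurableSet_child (p : D.Index) (u : Fin (D.numChildren p)) :
    MeasurableSet (I.child p u) := D.measurableSet_cube _ _

theorem disjoint_child (p : D.Index) {u v : Fin (D.numChildren p)} (huv : u ≠ v) :
    Disjoint (I.child p u) (I.child p v) :=
  D.disjoint_cube _ _ _ fun h => huv ((I.enum p).injective (Subtype.ext h))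

theorem exists_child_eq {k l : ℤ} {α : D.idx k} {β : D.idx l} (hl : l = k + 1)
    (hsub : D.cube l β ⊆ D.cube k α) : ∃ u, I.child ⟨k, α⟩ u = D.cube l β := by
  subst hl
  obtain ⟨u, hu⟩ := (I.enum ⟨k, α⟩).surjective ⟨β, hsub⟩
  exact ⟨u, by rw [child, hu]⟩

theorem measurableSet_tail (p : D.Index) (u : ℕ) : MeasurableSet (I.tail p u) :=
  MeasurableSet.iUnion fun _ => MeasurableSet.iUnion fun _ => I.measurableSet_child _ _

theorem tail_subset (p : D.Index) (u : ℕ) : I.tail p u ⊆ D.Q p :=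
  Set.iUnion₂_subset fun _ _ => I.child_subset _ _

theorem tail_anti (p : D.Index) {u v : ℕ} (h : u ≤ v) : I.tail p v ⊆ I.tail p u :=
  Set.iUnion₂_subset fun j hj => Set.subset_iUnion₂_of_subset j (h.trans hj) subset_rfl

theorem child_subset_tail (p : D.Index) {u : ℕ} {j : Fin (D.numChildren p)} (h : u ≤ j) :
    I.child p j ⊆ I.tail p u :=
  Set.subset_iUnion₂_of_subset j h subset_rfl

theorem tail_zero (p : D.Index) : I.tail p 0 = D.Q p := by
  refine (I.tail_subset p 0).antisymm fun x hx => ?_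
  have hx' := hx
  rw [DyadicSystem.Q, D.cube_eq_iUnion_children] at hx'
  obtain ⟨β, hβ, hxβ⟩ := Set.mem_iUnion₂.1 hx'
  obtain ⟨u, hu⟩ := I.exists_child_eq rfl hβ
  exact I.child_subset_tail p (Nat.zero_le u) (hu ▸ hxβ)

theorem tail_eq_union (p : D.Index) (u : Fin (D.numChildren p)) :
    I.tail p u = I.child p u ∪ I.tail p (u + 1) := by
  refine Set.Subset.antisymm (Set.iUnion₂_subset fun j hj => ?_)
    (Set.union_subset (I.child_subset_tail p le_rfl) (I.tail_anti p (Nat.le_succ _)))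
  rcases hj.eq_or_lt with h | h
  · rw [Fin.ext h]; exact Set.subset_union_left
  · exact Set.subset_union_of_subset_right (I.child_subset_tail p h) _

theorem disjoint_child_tail (p : D.Index) (u : Fin (D.numChildren p)) :
    Disjoint (I.child p u) (I.tail p (u + 1)) := by
  refine Set.disjoint_iUnion₂_right.2 fun j hj => I.disjoint_child p fun h => ?_
  subst h
  omega

theorem tail_eq_empty (p : D.Index) {u : ℕ} (h : D.numChildren p ≤ u) : I.tail p u = ∅ := by
  refine Set.subset_empty_iff.1 (Set.iUnion₂_subset fun j hj => ?_)
  have := j.2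
  omega

/-- A Haar function is constant on each cube of a later generation than its own. -/
theorem exists_haar_eq_const (p q : D.Index) (u : Fin (D.numChildren p - 1)) (hpq : p.1 < q.1) :
    ∃ c : ℝ, ∀ x ∈ D.Q q, I.haar p u x = c := by
  have hchild : ∀ v, D.Q q ⊆ I.child p v ∨ Disjoint (I.child p v) (D.Q q) := fun v =>
    D.nested (p.1 + 1) q.1 _ q.2 hpq
  have hsplit : ∀ S : Set X, (D.Q q ⊆ S ∨ Disjoint S (D.Q q)) →
      ∃ c : ℝ, ∀ x ∈ D.Q q, S.indicator (fun _ => (1 : ℝ)) x = c := by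
    rintro S (h | h)
    · exact ⟨1, fun x hx => Set.indicator_of_mem (h hx) _⟩
    · exact ⟨0, fun x hx => Set.indicator_of_notMem (fun hS => Set.disjoint_left.1 h hS hx) _⟩
  have htail : D.Q q ⊆ I.tail p (u + 1) ∨ Disjoint (I.tail p (u + 1)) (D.Q q) := by
    by_cases h : ∃ j : Fin (D.numChildren p), (u : ℕ) + 1 ≤ j ∧ D.Q q ⊆ I.child p j
    · obtain ⟨j, hj, hq⟩ := h
      exact Or.inl (hq.trans (I.child_subset_tail p hj))
    · push Not at h
      exact Or.inr (Set.disjoint_iUnion₂_left.2 fun j hj => (hchild j).resolve_left (h j hj))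
  obtain ⟨c, hc⟩ := hsplit _ (hchild (u.castLE (Nat.sub_le _ _)))
  obtain ⟨d, hd⟩ := hsplit _ htail
  by_cases h0 : μ (I.child p (u.castLE (Nat.sub_le _ _))) = 0
  · exact ⟨0, fun x _ => by simp [haar, h0]⟩
  · exact ⟨_, fun x hx => by simp only [haar, h0, if_false, hc x hx, hd x hx]; rfl⟩

theorem haar_eq_zero_of_notMem {p : D.Index} {u : Fin (D.numChildren p - 1)} {x : X}
    (hx : x ∉ D.Q p) : I.haar p u x = 0 := by
  have h1 : x ∉ I.child p (u.castLE (Nat.sub_le _ _)) := fun h => hx (I.child_subset _ _ h)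
  have h2 : x ∉ I.tail p ((u : ℕ) + 1) := fun h => hx (I.tail_subset _ _ h)
  simp [haar, h1, h2]

/-- Relative to a fixed cube, a Haar function either has its cube inside, or is constant there. -/
theorem Q_subset_or_haar_eq_const (p q : D.Index) (u : Fin (D.numChildren p - 1)) :
    D.Q p ⊆ D.Q q ∨ ∃ c : ℝ, ∀ x ∈ D.Q q, I.haar p u x = c := by
  rcases lt_or_ge p.1 q.1 with h | h
  · exact Or.inr (I.exists_haar_eq_const p q u h)
  · rcases D.nested q.1 p.1 q.2 p.2 h with h | h
    · exact Or.inl h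
    · exact Or.inr ⟨0, fun x hx => I.haar_eq_zero_of_notMem (Set.disjoint_left.1 h hx)⟩

theorem measurable_haar (p : D.Index) (u : Fin (D.numChildren p - 1)) :
    Measurable (I.haar p u) := by
  by_cases h0 : μ (I.child p (u.castLE (Nat.sub_le _ _))) = 0
  · simp only [haar, h0, if_true]
    exact measurable_const
  · simp only [haar, h0, if_false]
    exact ((measurable_const.indicator (I.measurableSet_child _ _)).const_mul _).sub
      ((measurable_const.indicator (I.measurableSet_tail _ _)).const_mul _)

theorem exists_abs_haar_le (p : D.Index) (u : Fin (D.numChildren p - 1)) :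
    ∃ K : ℝ, ∀ x, |I.haar p u x| ≤ K := by
  by_cases h0 : μ (I.child p (u.castLE (Nat.sub_le _ _))) = 0
  · exact ⟨0, fun x => by simp [haar, h0]⟩
  have key : ∀ (a b : ℝ) (S T : Set X), ∃ K : ℝ, ∀ x,
      |a * S.indicator (fun _ => (1 : ℝ)) x - b * T.indicator (fun _ => (1 : ℝ)) x| ≤ K := by
    refine fun a b S T => ⟨|a| + |b|, fun x => (abs_sub _ _).trans (add_le_add ?_ ?_)⟩
    all_goals
      rw [abs_mul]
      refine mul_le_of_le_one_right (abs_nonneg _) ?_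
      rw [← Real.norm_eq_abs]
      exact (norm_indicator_le_norm_self _ _).trans (by simp)
  simp only [haar, h0, if_false]
  exact key _ _ _ _

end Children

section Haar

variable {X : Type*} [TopologicalSpace X] [MeasurableSpace X] {ρ : X → X → ℝ} {μ : Measure X}
  {D : DyadicSystem ρ} (h : IsHomogeneousType ρ μ) (I : ChildIndexing D μ)
include h

theorem measure_tail_lt_top (p : D.Index) (u : ℕ) : μ (I.tail p u) < ⊤ :=
  (measure_mono (I.tail_subset p u)).trans_lt (D.measure_cube_lt_top h _ _)

theorem measureReal_child_pos (p : D.Index) (u : Fin (D.numChildren p)) :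
    0 < μ.real (I.child p u) := DyadicSystem.measureReal_cube_pos h _ _

theorem measureReal_tail_pos (p : D.Index) {u : ℕ} (hu : u < D.numChildren p) :
    0 < μ.real (I.tail p u) :=
  (measureReal_child_pos h I p ⟨u, hu⟩).trans_le
    (measureReal_mono (I.child_subset_tail p le_rfl) (measure_tail_lt_top h I p u).ne)

theorem measureReal_tail (p : D.Index) (u : Fin (D.numChildren p)) :
    μ.real (I.tail p u) = μ.real (I.child p u) + μ.real (I.tail p (u + 1)) := by
  rw [I.tail_eq_union, measureReal_union (I.disjoint_child_tail p u) (I.measurableSet_tail _ _)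
    (DyadicSystem.measure_cube_lt_top h _ _).ne (measure_tail_lt_top h I _ _).ne]

/-- A Haar function is a positive multiple of `μ(E_{u+1}) 1_{Q_u} - μ(Q_u) 1_{E_{u+1}}`. -/
theorem haar_apply (p : D.Index) (u : Fin (D.numChildren p - 1)) (x : X) :
    I.haar p u x = (√(μ.real (I.child p (u.castLE (Nat.sub_le _ _))) * μ.real (I.tail p u) *
        μ.real (I.tail p (u + 1))))⁻¹ *
      (μ.real (I.tail p (u + 1)) *
          (I.child p (u.castLE (Nat.sub_le _ _))).indicator (fun _ => (1 : ℝ)) x -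
        μ.real (I.child p (u.castLE (Nat.sub_le _ _))) *
          (I.tail p (u + 1)).indicator (fun _ => (1 : ℝ)) x) := by
  have hu := u.2
  have h1 := measureReal_child_pos h I p (u.castLE (Nat.sub_le _ _))
  have h2 := measureReal_tail_pos h I p (u := u) (by omega)
  have h3 := measureReal_tail_pos h I p (u := u + 1) (by omega)
  have h0 : μ (I.child p (u.castLE (Nat.sub_le _ _))) ≠ 0 := fun h0 => by
    simp [Measure.real, h0] at h1
  simp only [haar, h0, if_false]
  set a := μ.real (I.child p (u.castLE (Nat.sub_le _ _)))
  set b := μ.real (I.tail p u)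
  set c := μ.real (I.tail p (u + 1))
  rw [Real.sqrt_mul (by positivity), Real.sqrt_mul h1.le]
  have ha := Real.sqrt_pos.2 h1
  have hb := Real.sqrt_pos.2 h2
  have hc := Real.sqrt_pos.2 h3
  have ha2 := Real.sq_sqrt h1.le
  have hc2 := Real.sq_sqrt h3.le
  field_simp
  rw [ha2, hc2]
  ring

theorem memLp_haar (p : D.Index) (u : Fin (D.numChildren p - 1)) (r : ℝ≥0∞) :
    MemLp (I.haar p u) r μ := by
  have : I.haar p u = fun x => _ := funext (haar_apply h I p u)
  rw [this]
  refine MemLp.const_mul (MemLp.sub (MemLp.const_mul ?_ _) (MemLp.const_mul ?_ _)) _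
  · exact memLp_indicator_const _ (I.measurableSet_child _ _) _
      (Or.inr (DyadicSystem.measure_cube_lt_top h _ _).ne)
  · exact memLp_indicator_const _ (I.measurableSet_tail _ _) _
      (Or.inr (measure_tail_lt_top h I _ _).ne)

theorem integrable_indicator_child (p : D.Index) (u : Fin (D.numChildren p)) :
    Integrable ((I.child p u).indicator fun _ => (1 : ℝ)) μ :=
  (integrable_indicator_iff (I.measurableSet_child p u)).2
    (integrableOn_const (DyadicSystem.measure_cube_lt_top h _ _).ne)

theorem integrable_indicator_tail (p : D.Index) (u : ℕ) :
    Integrable ((I.tail p u).indicator fun _ => (1 : ℝ)) μ :=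
  (integrable_indicator_iff (I.measurableSet_tail p u)).2
    (integrableOn_const (measure_tail_lt_top h I _ _).ne)

theorem integral_haar (p : D.Index) (u : Fin (D.numChildren p - 1)) :
    ∫ x, I.haar p u x ∂μ = 0 := by
  simp_rw [haar_apply h I p u]
  rw [integral_const_mul, integral_sub ((integrable_indicator_child h I _ _).const_mul _)
    ((integrable_indicator_tail h I _ _).const_mul _), integral_const_mul, integral_const_mul,
    integral_indicator_const _ (I.measurableSet_child _ _),
    integral_indicator_const _ (I.measurableSet_tail _ _)]
  simp only [smul_eq_mul]
  ring

theorem integral_haar_mul_self (p : D.Index) (u : Fin (D.numChildren p - 1)) :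
    ∫ x, I.haar p u x * I.haar p u x ∂μ = 1 := by
  have hu := u.2
  have h1 := measureReal_child_pos h I p (u.castLE (Nat.sub_le _ _))
  have h2 := measureReal_tail_pos h I p (u := u) (by omega)
  have h3 := measureReal_tail_pos h I p (u := u + 1) (by omega)
  have hsum := measureReal_tail h I p (u.castLE (Nat.sub_le _ _))
  have hdisj := I.disjoint_child_tail p (u.castLE (Nat.sub_le _ _))
  simp only [Fin.val_castLE] at hsum hdisj
  have heq : ∀ x, I.haar p u x * I.haar p u x =
      (μ.real (I.child p (u.castLE (Nat.sub_le _ _))) * μ.real (I.tail p u) *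
        μ.real (I.tail p (u + 1)))⁻¹ *
      (μ.real (I.tail p (u + 1)) ^ 2 *
          (I.child p (u.castLE (Nat.sub_le _ _))).indicator (fun _ => (1 : ℝ)) x +
        μ.real (I.child p (u.castLE (Nat.sub_le _ _))) ^ 2 *
          (I.tail p (u + 1)).indicator (fun _ => (1 : ℝ)) x) := by
    intro x
    rw [haar_apply h I p u, mul_mul_mul_comm, ← mul_inv, Real.mul_self_sqrt (by positivity)]
    congr 1
    by_cases hx : x ∈ I.child p (u.castLE (Nat.sub_le _ _))
    · have hx' := Set.disjoint_left.1 hdisj hx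
      simp only [Set.indicator_of_mem hx, Set.indicator_of_notMem hx']
      ring
    · simp only [Set.indicator_of_notMem hx]
      by_cases hx' : x ∈ I.tail p (u + 1)
      · simp only [Set.indicator_of_mem hx']; ring
      · simp only [Set.indicator_of_notMem hx']; ring
  simp_rw [heq]
  rw [integral_const_mul, integral_add ((integrable_indicator_child h I _ _).const_mul _)
    ((integrable_indicator_tail h I _ _).const_mul _), integral_const_mul, integral_const_mul,
    integral_indicator_const _ (I.measurableSet_child _ _),
    integral_indicator_const _ (I.measurableSet_tail _ _)]
  simp only [smul_eq_mul]
  rw [hsum]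
  field_simp
  ring

/-- Cancellation: a Haar function is orthogonal to any function that is constant on a set
containing its support. -/
theorem integral_mul_haar_eq_zero {p : D.Index} {u : Fin (D.numChildren p - 1)} {S : Set X}
    {g : X → ℝ} {c : ℝ} (hS : ∀ x ∉ S, I.haar p u x = 0) (hg : ∀ x ∈ S, g x = c) :
    ∫ x, g x * I.haar p u x ∂μ = 0 := by
  have : ∀ x, g x * I.haar p u x = c * I.haar p u x := by
    intro x
    by_cases hx : x ∈ S
    · rw [hg x hx]
    · rw [hS x hx, mul_zero, mul_zero]
  simp_rw [this]
  rw [integral_const_mul, integral_haar h I, mul_zero]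

theorem integral_haar_mul_haar (p q : D.Index) (u : Fin (D.numChildren p - 1))
    (v : Fin (D.numChildren q - 1)) (hne : (⟨p, u⟩ : Σ p : D.Index, Fin (D.numChildren p - 1)) ≠
      ⟨q, v⟩) : ∫ x, I.haar p u x * I.haar q v x ∂μ = 0 := by
  rcases lt_trichotomy p.1 q.1 with hpq | hpq | hpq
  · obtain ⟨c, hc⟩ := I.exists_haar_eq_const p q u hpq
    exact integral_mul_haar_eq_zero h I (fun x hx => I.haar_eq_zero_of_notMem hx) hc
  · obtain ⟨k, α⟩ := p
    obtain ⟨l, β⟩ := q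
    obtain rfl : k = l := hpq
    by_cases hαβ : α = β
    · subst hαβ
      have huv : u ≠ v := fun h => hne (by rw [h])
      have hlt : ∀ u v : Fin (D.numChildren ⟨k, α⟩ - 1), u < v →
          ∫ x, I.haar ⟨k, α⟩ u x * I.haar ⟨k, α⟩ v x ∂μ = 0 := by
        intro u v huv
        have huv' : (u : ℕ) + 1 ≤ v := huv
        obtain ⟨c, hc⟩ : ∃ c, ∀ x ∈ I.tail ⟨k, α⟩ v, I.haar ⟨k, α⟩ u x = c := by
          have key : ∀ a b d : ℝ, ∃ c, ∀ x ∈ I.tail ⟨k, α⟩ v, a * (b *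
              (I.child ⟨k, α⟩ (u.castLE (Nat.sub_le _ _))).indicator (fun _ => (1 : ℝ)) x -
              d * (I.tail ⟨k, α⟩ (u + 1)).indicator (fun _ => (1 : ℝ)) x) = c := by
            refine fun a b d => ⟨a * (b * 0 - d * 1), fun x hx => ?_⟩
            have hx' := I.tail_anti _ huv' hx
            rw [Set.indicator_of_mem hx', Set.indicator_of_notMem (Set.disjoint_right.1
              (I.disjoint_child_tail ⟨k, α⟩ (u.castLE (Nat.sub_le _ _))) hx')]
          simp_rw [haar_apply h I]
          exact key _ _ _
        refine integral_mul_haar_eq_zero h I (S := I.tail ⟨k, α⟩ v) (fun x hx => ?_) hc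
        · rw [haar_apply h I, Set.indicator_of_notMem, Set.indicator_of_notMem]
          · ring
          · exact fun h' => hx (I.tail_anti _ (Nat.le_succ _) h')
          · exact fun h' => hx (I.child_subset_tail _ le_rfl h')
      rcases lt_or_gt_of_ne huv with huv | huv
      · exact hlt u v huv
      · simp_rw [mul_comm (I.haar _ u _)]
        exact hlt v u huv
    · refine integral_mul_haar_eq_zero h I (S := D.Q ⟨k, β⟩) (c := 0)
        (fun x hx => I.haar_eq_zero_of_notMem hx) fun x hx => I.haar_eq_zero_of_notMem ?_
      exact Set.disjoint_right.1 (D.disjoint_cube k α β hαβ) hx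
  · obtain ⟨c, hc⟩ := I.exists_haar_eq_const q p v hpq
    simp_rw [mul_comm (I.haar p u _)]
    exact integral_mul_haar_eq_zero h I (fun x hx => I.haar_eq_zero_of_notMem hx) hc

end Haar

section Completeness

variable {X : Type*} [TopologicalSpace X] [MeasurableSpace X] {ρ : X → X → ℝ} {μ : Measure X}
  {D : DyadicSystem ρ} (h : IsHomogeneousType ρ μ) (I : ChildIndexing D μ)
  {𝕜 : Type*} [RCLike 𝕜] {ℓ : Set X → 𝕜}

include h in
/-- If a set function annihilates all Haar functions of a cube, it has the same average over all
children of that cube. -/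
theorem smul_apply_child
    (hadd : ∀ A B, MeasurableSet A → MeasurableSet B → μ A < ⊤ → μ B < ⊤ → Disjoint A B →
      ℓ (A ∪ B) = ℓ A + ℓ B)
    (hhaar : ∀ (p : D.Index) (u : Fin (D.numChildren p - 1)),
      μ.real (I.tail p (u + 1)) • ℓ (I.child p (u.castLE (Nat.sub_le _ _))) =
        μ.real (I.child p (u.castLE (Nat.sub_le _ _))) • ℓ (I.tail p (u + 1)))
    (p : D.Index) (u : Fin (D.numChildren p)) :
    μ.real (D.Q p) • ℓ (I.child p u) = μ.real (I.child p u) • ℓ (D.Q p) := by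
  simp only [RCLike.real_smul_eq_coe_mul] at hhaar ⊢
  have hadd' : ∀ u : Fin (D.numChildren p),
      ℓ (I.tail p u) = ℓ (I.child p u) + ℓ (I.tail p (u + 1)) := by
    intro u
    rw [I.tail_eq_union]
    exact hadd _ _ (I.measurableSet_child _ _) (I.measurableSet_tail _ _)
      (DyadicSystem.measure_cube_lt_top h _ _) (measure_tail_lt_top h I _ _)
      (I.disjoint_child_tail p u)
  have hpos : ∀ v : ℕ, v < D.numChildren p → (μ.real (I.tail p v) : 𝕜) ≠ 0 := fun v hv => by
    exact_mod_cast (measureReal_tail_pos h I p hv).ne'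
  have htail : ∀ v : ℕ, v < D.numChildren p →
      (μ.real (D.Q p) : 𝕜) * ℓ (I.tail p v) = μ.real (I.tail p v) * ℓ (D.Q p) := by
    intro v
    induction v with
    | zero => intro _; rw [I.tail_zero]
    | succ v ih =>
      intro hv
      have ih := ih (by omega)
      have h1 := hhaar p ⟨v, by omega⟩
      have h2 := hadd' ⟨v, by omega⟩
      have h3 := congrArg (fun r : ℝ => (r : 𝕜)) (measureReal_tail h I p ⟨v, by omega⟩)
      simp only [Fin.castLE_mk, RCLike.ofReal_add] at h1 h2 h3
      refine mul_left_cancel₀ (hpos v (by omega)) ?_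
      linear_combination (μ.real (I.tail p (v + 1)) : 𝕜) * ih
        + (μ.real (D.Q p) : 𝕜) * ℓ (I.tail p (v + 1)) * h3
        - (μ.real (D.Q p) : 𝕜) * h1 - (μ.real (D.Q p) : 𝕜) * μ.real (I.tail p (v + 1)) * h2
  have hu := u.2
  by_cases hlast : (u : ℕ) + 1 < D.numChildren p
  · have ih := htail u hu
    have h1 := hhaar p ⟨u, by omega⟩
    have h2 := hadd' u
    have h3 := congrArg (fun r : ℝ => (r : 𝕜)) (measureReal_tail h I p u)
    simp only [Fin.castLE_mk, RCLike.ofReal_add] at h1 h2 h3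
    refine mul_left_cancel₀ (hpos u (by omega)) ?_
    linear_combination (μ.real (I.child p u) : 𝕜) * ih
        + (μ.real (D.Q p) : 𝕜) * ℓ (I.child p u) * h3
        + (μ.real (D.Q p) : 𝕜) * h1 - (μ.real (D.Q p) : 𝕜) * μ.real (I.child p u) * h2
  · have hc : I.tail p u = I.child p u := by
      rw [I.tail_eq_union, I.tail_eq_empty p (by omega), Set.union_empty]
    rw [← hc]
    exact htail u hu

include h in
/-- Completeness of the Haar system on one factor: an additive set function that is `1/2`-Hölder
with respect to `μ` and annihilates all Haar functions vanishes on all dyadic cubes, provided the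
mean over the whole space, if that has finite measure, vanishes as well. -/
theorem apply_Q_eq_zero [BorelSpace X]
    (hadd : ∀ A B, MeasurableSet A → MeasurableSet B → μ A < ⊤ → μ B < ⊤ → Disjoint A B →
      ℓ (A ∪ B) = ℓ A + ℓ B)
    (hhaar : ∀ (p : D.Index) (u : Fin (D.numChildren p - 1)),
      μ.real (I.tail p (u + 1)) • ℓ (I.child p (u.castLE (Nat.sub_le _ _))) =
        μ.real (I.child p (u.castLE (Nat.sub_le _ _))) • ℓ (I.tail p (u + 1)))
    {K : ℝ} (hK : ∀ A, MeasurableSet A → μ A < ⊤ → ‖ℓ A‖ ≤ K * √(μ.real A))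
    (htop : μ Set.univ = ⊤ ∨ ℓ Set.univ = 0) (p : D.Index) : ℓ (D.Q p) = 0 := by
  have key : ∀ (n : ℕ) (k l : ℤ) (α : D.idx k) (β : D.idx l), l = k + n →
      D.cube l β ⊆ D.cube k α →
      μ.real (D.cube k α) • ℓ (D.cube l β) = μ.real (D.cube l β) • ℓ (D.cube k α) := by
    intro n
    induction n with
    | zero =>
      intro k l α β hl hsub
      obtain rfl : l = k := by simpa using hl
      have hx := DyadicSystem.center_mem h.quasiMetric l β
      obtain rfl := DyadicSystem.eq_of_mem_cube hx (hsub hx)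
      rfl
    | succ n ih =>
      intro k l α β hl hsub
      have hx := DyadicSystem.center_mem h.quasiMetric l β
      obtain ⟨γ, hγ⟩ := D.exists_mem_cube (k + n) (D.center l β)
      have hl' : l = k + n + 1 := by push_cast at hl; omega
      have hγα : D.cube (k + n) γ ⊆ D.cube k α :=
        DyadicSystem.cube_subset_of_mem (by omega) (hsub hx) hγ
      have hβγ : D.cube l β ⊆ D.cube (k + n) γ :=
        DyadicSystem.cube_subset_of_mem (by omega) hγ hx
      have h1 := ih k (k + n) α γ rfl hγα
      obtain ⟨u, hu⟩ := I.exists_child_eq hl' hβγ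
      have h2 := smul_apply_child h I hadd hhaar ⟨k + n, γ⟩ u
      rw [hu] at h2
      have h3 : (μ.real (D.cube (k + n) γ) : 𝕜) ≠ 0 := by
        exact_mod_cast (DyadicSystem.measureReal_cube_pos h _ _).ne'
      simp only [RCLike.real_smul_eq_coe_mul, DyadicSystem.Q] at h1 h2 ⊢
      refine mul_left_cancel₀ h3 ?_
      linear_combination (μ.real (D.cube k α) : 𝕜) * h2 + (μ.real (D.cube l β) : 𝕜) * h1
  have hanc : ∀ q : D.Index, q.1 ≤ p.1 → D.Q p ⊆ D.Q q →
      μ.real (D.Q q) • ℓ (D.Q p) = μ.real (D.Q p) • ℓ (D.Q q) := fun q hq hsub =>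
    key (p.1 - q.1).toNat q.1 p.1 q.2 p.2 (by omega) hsub
  have hp0 : 0 < μ.real (D.Q p) := DyadicSystem.measureReal_cube_pos h _ _
  by_cases hfin : μ Set.univ = ⊤
  · -- the average over a cube of measure `m` is at most `K / √m`, and `m` is unbounded
    by_contra hne
    have hpos : 0 < ‖ℓ (D.Q p)‖ := norm_pos_iff.2 hne
    set T : ℝ := μ.real (D.Q p) * K / ‖ℓ (D.Q p)‖ with hT
    obtain ⟨q, hq, hsub, hbig⟩ := D.exists_ancestor_measure_ge h hfin p
      (Real.toNNReal (T ^ 2 + 1))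
    have hq0 : 0 < μ.real (D.Q q) := DyadicSystem.measureReal_cube_pos h _ _
    have hbig' : T ^ 2 + 1 ≤ μ.real (D.Q q) := by
      have := ENNReal.toReal_mono (D.measure_cube_lt_top h q.1 q.2).ne hbig
      rwa [ENNReal.coe_toReal, Real.coe_toNNReal _ (by positivity)] at this
    have h1 := congrArg norm (hanc q hq hsub)
    rw [norm_smul, norm_smul, Real.norm_of_nonneg hq0.le, Real.norm_of_nonneg hp0.le] at h1
    have h2 := hK (D.Q q) (D.measurableSet_Q q) (D.measure_cube_lt_top h _ _)
    have h3 : √(μ.real (D.Q q)) ≤ T := by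
      rw [hT, le_div_iff₀ hpos]
      refine le_of_mul_le_mul_left ?_ (Real.sqrt_pos.2 hq0)
      rw [← mul_assoc, Real.mul_self_sqrt hq0.le, h1]
      calc μ.real (D.Q p) * ‖ℓ (D.Q q)‖ ≤ μ.real (D.Q p) * (K * √(μ.real (D.Q q))) := by gcongr
        _ = _ := by ring
    have h4 := Real.sq_sqrt hq0.le
    have h5 := Real.sqrt_nonneg (μ.real (D.Q q))
    nlinarith
  · obtain ⟨q, hq, hsub, hu⟩ := D.exists_ancestor_eq_univ h hfin p
    have h1 := hanc q hq hsub
    rw [hu, htop.resolve_left hfin, smul_zero] at h1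
    have hq0 : μ.real (D.Q q) ≠ 0 := (DyadicSystem.measureReal_cube_pos h _ _).ne'
    rw [hu] at hq0
    exact (smul_eq_zero.1 h1).resolve_left hq0

end Completeness

end ChildIndexing

/-! ### The product Haar system -/

theorem DyadicSystem.isCountablySpanning_cubes {X : Type*} [MeasurableSpace X] [Nonempty X]
    {ρ : X → X → ℝ} (D : DyadicSystem ρ) : IsCountablySpanning (Set.range D.Q) := by
  obtain ⟨α, -⟩ := D.exists_mem_cube 0 (Classical.arbitrary X)
  have : Nonempty (D.idx 0) := ⟨α⟩
  obtain ⟨s, hs⟩ := exists_surjective_nat (D.idx 0)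
  refine ⟨fun n => D.Q ⟨0, s n⟩, fun n => ⟨_, rfl⟩, ?_⟩
  exact (hs.iUnion_comp fun β => D.cube 0 β).trans (D.iUnion_cube 0)

/-- A form of `ChildIndexing.apply_Q_eq_zero` for linear functionals that are bounded on `L²`. -/
theorem ChildIndexing.apply_indicator_Q_eq_zero {X : Type*} [TopologicalSpace X]
    [MeasurableSpace X] [BorelSpace X] {ρ : X → X → ℝ} {μ : Measure X} {D : DyadicSystem ρ}
    (h : IsHomogeneousType ρ μ) (I : ChildIndexing D μ) {𝕜 : Type*} [RCLike 𝕜]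
    {Λ : (X → ℝ) → 𝕜}
    (hlin : ∀ φ φ', MemLp φ 2 μ → MemLp φ' 2 μ → ∀ a b : ℝ,
      Λ (fun x => a * φ x + b * φ' x) = a • Λ φ + b • Λ φ')
    {K : ℝ} (hK : ∀ φ, MemLp φ 2 μ → ‖Λ φ‖ ≤ K * √(∫ x, φ x * φ x ∂μ))
    (hhaar : ∀ (p : D.Index) (u : Fin (D.numChildren p - 1)), Λ (I.haar p u) = 0)
    (htop : μ Set.univ = ⊤ ∨ Λ (fun _ => 1) = 0) (p : D.Index) :
    Λ ((D.Q p).indicator fun _ => 1) = 0 := by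
  have hmem : ∀ A : Set X, MeasurableSet A → μ A < ⊤ →
      MemLp (A.indicator fun _ => (1 : ℝ)) 2 μ := fun A hA hμ =>
    memLp_indicator_const _ hA _ (Or.inr hμ.ne)
  refine apply_Q_eq_zero h I (ℓ := fun A => Λ (A.indicator fun _ => 1)) ?_ ?_ (K := K) ?_ ?_ p
  · intro A B hA hB hμA hμB hAB
    have := hlin _ _ (hmem A hA hμA) (hmem B hB hμB) 1 1
    simp only [one_mul, one_smul] at this
    rw [← this]
    congr 1
    ext x
    rw [Set.indicator_union_of_disjoint hAB]
  · intro p u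
    have hu := u.2
    have h1 := measureReal_child_pos h I p (u.castLE (Nat.sub_le _ _))
    have h2 := measureReal_tail_pos h I p (u := u) (by omega)
    have h3 := measureReal_tail_pos h I p (u := u + 1) (by omega)
    have hc := hmem _ (I.measurableSet_child p (u.castLE (Nat.sub_le _ _)))
      (DyadicSystem.measure_cube_lt_top h _ _)
    have ht := hmem _ (I.measurableSet_tail p (u + 1)) (measure_tail_lt_top h I _ _)
    have h4 := hhaar p u
    set w := (√(μ.real (I.child p (u.castLE (Nat.sub_le _ _))) * μ.real (I.tail p u) *
        μ.real (I.tail p (u + 1))))⁻¹ with hw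
    have hw0 : w ≠ 0 := by positivity
    have heq : I.haar p u = fun x => (w * μ.real (I.tail p (u + 1))) *
        (I.child p (u.castLE (Nat.sub_le _ _))).indicator (fun _ => (1 : ℝ)) x +
        (-(w * μ.real (I.child p (u.castLE (Nat.sub_le _ _))))) *
        (I.tail p (u + 1)).indicator (fun _ => (1 : ℝ)) x := by
      ext x
      rw [haar_apply h I p u]
      ring
    rw [heq, hlin _ _ hc ht, neg_smul, add_neg_eq_zero, mul_smul, mul_smul] at h4
    exact smul_right_injective 𝕜 hw0 h4
  · intro A hA hμ
    refine (hK _ (hmem A hA hμ)).trans_eq ?_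
    congr 2
    have : ∀ x, A.indicator (fun _ => (1 : ℝ)) x * A.indicator (fun _ => (1 : ℝ)) x =
        A.indicator (fun _ => (1 : ℝ)) x := by
      intro x
      by_cases hx : x ∈ A <;> simp [hx]
    simp_rw [this]
    rw [integral_indicator_const _ hA]
    simp
  · simpa using htop

section Pairing

variable {Y : Type*} [MeasurableSpace Y] {μ : Measure Y} {𝕜 : Type*} [RCLike 𝕜]

/-- A real square integrable function, as a vector of the scalar-valued space `L²`. -/
def realLp (𝕜 : Type*) [RCLike 𝕜] {F : Y → ℝ} (hF : MemLp F 2 μ) : Lp 𝕜 2 μ :=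
  (hF.ofReal (K := 𝕜)).toLp _

theorem inner_realLp {F : Y → ℝ} (hF : MemLp F 2 μ) (g : Lp 𝕜 2 μ) :
    inner 𝕜 (realLp 𝕜 hF) g = ∫ y, F y • g y ∂μ := by
  rw [L2.inner_def]
  refine integral_congr_ae ?_
  filter_upwards [(hF.ofReal (K := 𝕜)).coeFn_toLp] with y hy
  rw [realLp, hy]
  simp [RCLike.inner_apply, RCLike.real_smul_eq_coe_mul, mul_comm]

theorem inner_realLp_toLp {F : Y → ℝ} (hF : MemLp F 2 μ) {g : Y → 𝕜} (hg : MemLp g 2 μ) :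
    inner 𝕜 (realLp 𝕜 hF) (hg.toLp g) = ∫ y, F y • g y ∂μ := by
  rw [inner_realLp]
  refine integral_congr_ae ?_
  filter_upwards [hg.coeFn_toLp] with y hy
  rw [hy]

theorem inner_realLp_realLp {F G : Y → ℝ} (hF : MemLp F 2 μ) (hG : MemLp G 2 μ) :
    inner 𝕜 (realLp 𝕜 hF) (realLp 𝕜 hG) = ((∫ y, F y * G y ∂μ : ℝ) : 𝕜) := by
  rw [realLp, realLp, ← integral_ofReal]
  refine (inner_realLp_toLp hF _).trans (integral_congr_ae (ae_of_all _ fun y => ?_))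
  simp [RCLike.real_smul_eq_coe_mul]

theorem norm_realLp_sq {F : Y → ℝ} (hF : MemLp F 2 μ) :
    ‖realLp 𝕜 hF‖ ^ 2 = ∫ y, F y * F y ∂μ := by
  have := inner_realLp_realLp (𝕜 := 𝕜) hF hF
  rw [inner_self_eq_norm_sq_to_K] at this
  exact_mod_cast this

theorem integrable_smul_of_memLp_two {F : Y → ℝ} (hF : MemLp F 2 μ) {g : Y → 𝕜}
    (hg : MemLp g 2 μ) : Integrable (fun y => F y • g y) μ :=
  memLp_one_iff_integrable.1 (hg.smul hF)

theorem integral_add_smul_eq {F G : Y → ℝ} (hF : MemLp F 2 μ) (hG : MemLp G 2 μ) {g : Y → 𝕜}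
    (hg : MemLp g 2 μ) (a b : ℝ) :
    ∫ y, (a * F y + b * G y) • g y ∂μ = a • ∫ y, F y • g y ∂μ + b • ∫ y, G y • g y ∂μ := by
  have h1 := (integrable_smul_of_memLp_two hF hg).smul a
  have h2 := (integrable_smul_of_memLp_two hG hg).smul b
  rw [← integral_smul, ← integral_smul]
  refine Eq.trans (integral_congr_ae (ae_of_all _ fun y => ?_)) (integral_add h1 h2)
  simp [add_smul, smul_smul]

theorem norm_integral_smul_le {F : Y → ℝ} (hF : MemLp F 2 μ) {g : Y → 𝕜} (hg : MemLp g 2 μ) :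
    ‖∫ y, F y • g y ∂μ‖ ≤ √(∫ y, F y * F y ∂μ) * ‖hg.toLp g‖ := by
  rw [← inner_realLp_toLp hF hg, ← norm_realLp_sq (𝕜 := 𝕜) hF, Real.sqrt_sq (norm_nonneg _)]
  exact norm_inner_le_norm _ _

end Pairing

section Tensor

variable {X₁ X₂ : Type*} [MeasurableSpace X₁] [MeasurableSpace X₂]
  {μ₁ : Measure X₁} {μ₂ : Measure X₂}

theorem memLp_tensor {φ : X₁ → ℝ} {ψ : X₂ → ℝ} (hφ : MemLp φ 2 μ₁) (hψ : MemLp ψ 2 μ₂) :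
    MemLp (fun z : X₁ × X₂ => φ z.1 * ψ z.2) 2 (μ₁.prod μ₂) := by
  have hm : AEStronglyMeasurable (fun z : X₁ × X₂ => φ z.1 * ψ z.2) (μ₁.prod μ₂) :=
    hφ.1.comp_fst.mul hψ.1.comp_snd
  refine (memLp_two_iff_integrable_sq hm).2 ?_
  have := (hφ.integrable_sq).mul_prod (hψ.integrable_sq)
  simpa only [mul_pow] using this

theorem integral_tensor_mul_tensor [SFinite μ₁] [SFinite μ₂] (φ φ' : X₁ → ℝ) (ψ ψ' : X₂ → ℝ) :
    ∫ z : X₁ × X₂, (φ z.1 * ψ z.2) * (φ' z.1 * ψ' z.2) ∂(μ₁.prod μ₂) =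
      (∫ x, φ x * φ' x ∂μ₁) * ∫ x, ψ x * ψ' x ∂μ₂ := by
  rw [← integral_prod_mul]
  congr 1
  ext z
  ring

end Tensor

/-- Indices of the product Haar functions `h_{Q₁}^{u₁} h_{Q₂}^{u₂}`. -/
abbrev HaarIndex {X₁ X₂ : Type*} [MeasurableSpace X₁] [MeasurableSpace X₂]
    {ρ₁ : X₁ → X₁ → ℝ} {ρ₂ : X₂ → X₂ → ℝ} (D₁ : DyadicSystem ρ₁) (D₂ : DyadicSystem ρ₂) : Type :=
  (Σ p : D₁.Index, Fin (D₁.numChildren p - 1)) × (Σ q : D₂.Index, Fin (D₂.numChildren q - 1))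

section HaarSystem

variable {X₁ X₂ : Type*} [TopologicalSpace X₁] [TopologicalSpace X₂]
  [MeasurableSpace X₁] [MeasurableSpace X₂]
  {ρ₁ : X₁ → X₁ → ℝ} {ρ₂ : X₂ → X₂ → ℝ} {D₁ : DyadicSystem ρ₁} {D₂ : DyadicSystem ρ₂}
  {μ₁ : Measure X₁} {μ₂ : Measure X₂}
  (h₁ : IsHomogeneousType ρ₁ μ₁) (h₂ : IsHomogeneousType ρ₂ μ₂)
  (I₁ : ChildIndexing D₁ μ₁) (I₂ : ChildIndexing D₂ μ₂) {𝕜 : Type*} [RCLike 𝕜]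

/-- The rectangle `Q₁ × Q₂` on which a product Haar function lives. -/
def rect (j : HaarIndex D₁ D₂) : Set (X₁ × X₂) := D₁.Q j.1.1 ×ˢ D₂.Q j.2.1

/-- The Haar coefficients of `f`, as a family over a single index set. -/
def coeff (f : X₁ × X₂ → 𝕜) (j : HaarIndex D₁ D₂) : 𝕜 :=
  haarCoeff I₁ I₂ f j.1.1 j.2.1 j.1.2 j.2.2

include h₁ h₂ in
theorem memLp_haarProd (j : HaarIndex D₁ D₂) :
    MemLp (fun z : X₁ × X₂ => I₁.haar j.1.1 j.1.2 z.1 * I₂.haar j.2.1 j.2.2 z.2) 2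
      (μ₁.prod μ₂) :=
  memLp_tensor (ChildIndexing.memLp_haar h₁ I₁ _ _ _) (ChildIndexing.memLp_haar h₂ I₂ _ _ _)

/-- The product Haar functions as vectors in `L²`. -/
def haarLp (𝕜 : Type*) [RCLike 𝕜] (j : HaarIndex D₁ D₂) : Lp 𝕜 2 (μ₁.prod μ₂) :=
  realLp 𝕜 (memLp_haarProd h₁ h₂ I₁ I₂ j)

theorem inner_haarLp_toLp (j : HaarIndex D₁ D₂) {f : X₁ × X₂ → 𝕜}
    (hf : MemLp f 2 (μ₁.prod μ₂)) :
    inner 𝕜 (haarLp h₁ h₂ I₁ I₂ 𝕜 j) (hf.toLp f) = coeff I₁ I₂ f j :=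
  inner_realLp_toLp _ hf

include h₁ h₂ in
/-- Only the zero function has vanishing integral over all dyadic rectangles. -/
theorem ae_eq_zero_of_integral_rect_eq_zero [SigmaFinite μ₂] [BorelSpace X₁] [BorelSpace X₂]
    {g : X₁ × X₂ → 𝕜}
    (hg : MemLp g 2 (μ₁.prod μ₂))
    (hzero : ∀ (p : D₁.Index) (q : D₂.Index), ∫ z in D₁.Q p ×ˢ D₂.Q q, g z ∂(μ₁.prod μ₂) = 0) :
    g =ᵐ[μ₁.prod μ₂] 0 := by
  have hx₁ : Nonempty X₁ := by
    by_contra hne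
    rw [not_nonempty_iff] at hne
    exact h₁.measure_ne_zero (Measure.eq_zero_of_isEmpty μ₁)
  have hx₂ : Nonempty X₂ := by
    by_contra hne
    rw [not_nonempty_iff] at hne
    exact h₂.measure_ne_zero (Measure.eq_zero_of_isEmpty μ₂)
  have hgen : (inferInstance : MeasurableSpace (X₁ × X₂)) = MeasurableSpace.generateFrom
      (Set.image2 (· ×ˢ ·) (Set.range D₁.Q) (Set.range D₂.Q)) :=
    (generateFrom_eq_prod (D₁.generateFrom_cubes h₁).symm (D₂.generateFrom_cubes h₂).symm
      D₁.isCountablySpanning_cubes D₂.isCountablySpanning_cubes).symm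
  have hpi : IsPiSystem (Set.image2 (· ×ˢ ·) (Set.range D₁.Q) (Set.range D₂.Q)) :=
    DyadicSystem.isPiSystem_cubes.prod DyadicSystem.isPiSystem_cubes
  have hloc : ∀ (p : D₁.Index) (q : D₂.Index),
      g =ᵐ[(μ₁.prod μ₂).restrict (D₁.Q p ×ˢ D₂.Q q)] 0 := by
    intro p q
    have hfin : μ₁.prod μ₂ (D₁.Q p ×ˢ D₂.Q q) < ⊤ := by
      rw [Measure.prod_prod]
      exact ENNReal.mul_lt_top (D₁.measure_cube_lt_top h₁ _ _) (D₂.measure_cube_lt_top h₂ _ _)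
    have hint : Integrable g ((μ₁.prod μ₂).restrict (D₁.Q p ×ˢ D₂.Q q)) := by
      have : IsFiniteMeasure ((μ₁.prod μ₂).restrict (D₁.Q p ×ˢ D₂.Q q)) :=
        isFiniteMeasure_restrict.2 hfin.ne
      exact (hg.restrict _).integrable (by norm_num)
    suffices H : ∀ s, MeasurableSet s → ∫ z in s, g z ∂((μ₁.prod μ₂).restrict
        (D₁.Q p ×ˢ D₂.Q q)) = 0 from
      hint.ae_eq_zero_of_forall_setIntegral_eq_zero fun s hs _ => H s hs
    intro s hs
    induction s, hs using MeasurableSpace.induction_on_inter hgen hpi with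
    | empty => simp
    | basic t ht =>
      obtain ⟨_, ⟨p', rfl⟩, _, ⟨q', rfl⟩, rfl⟩ := ht
      rw [Measure.restrict_restrict ((D₁.measurableSet_Q p').prod (D₂.measurableSet_Q q'))]
      by_cases hne : ((D₁.Q p' ×ˢ D₂.Q q') ∩ (D₁.Q p ×ˢ D₂.Q q)).Nonempty
      · obtain ⟨_, ⟨p'', rfl⟩, _, ⟨q'', rfl⟩, heq⟩ :=
          hpi _ ⟨_, ⟨p', rfl⟩, _, ⟨q', rfl⟩, rfl⟩ _ ⟨_, ⟨p, rfl⟩, _, ⟨q, rfl⟩, rfl⟩ hne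
        rw [← heq]
        exact hzero _ _
      · rw [Set.not_nonempty_iff_eq_empty.1 hne]; simp
    | compl t ht ih =>
      have h1 := integral_add_compl ht hint
      rw [ih, zero_add] at h1
      rw [h1]
      exact hzero _ _
    | iUnion t hd ht ih =>
      have := (hasSum_integral_iUnion ht hd hint.integrableOn).tsum_eq
      rw [← this]
      simp [ih]
  have hcover : ⋃ j : D₁.idx 0 × D₂.idx 0, D₁.Q ⟨0, j.1⟩ ×ˢ D₂.Q ⟨0, j.2⟩ = Set.univ := by
    refine Set.eq_univ_of_forall fun z => ?_
    obtain ⟨α, hα⟩ := D₁.exists_mem_cube 0 z.1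
    obtain ⟨β, hβ⟩ := D₂.exists_mem_cube 0 z.2
    exact Set.mem_iUnion.2 ⟨(α, β), hα, hβ⟩
  rw [← Measure.restrict_univ (μ := μ₁.prod μ₂), ← hcover]
  exact (ae_restrict_iUnion_iff _ _).2 fun j => hloc _ _

variable [SigmaFinite μ₁] [SigmaFinite μ₂]

theorem orthonormal_haarLp : Orthonormal 𝕜 (haarLp h₁ h₂ I₁ I₂ 𝕜) := by
  refine ⟨fun j => ?_, fun i j hij => ?_⟩
  · have := norm_realLp_sq (𝕜 := 𝕜) (memLp_haarProd h₁ h₂ I₁ I₂ j)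
    rw [integral_tensor_mul_tensor, ChildIndexing.integral_haar_mul_self h₁,
      ChildIndexing.integral_haar_mul_self h₂, mul_one] at this
    exact (pow_eq_one_iff_of_nonneg (norm_nonneg _) two_ne_zero).1 this
  · change inner 𝕜 (realLp 𝕜 _) (realLp 𝕜 _) = 0
    rw [inner_realLp_realLp, integral_tensor_mul_tensor]
    have hne : i.1 ≠ j.1 ∨ i.2 ≠ j.2 := by
      by_contra hcon
      push Not at hcon
      exact hij (Prod.ext hcon.1 hcon.2)
    rcases hne with hne | hne
    · rw [ChildIndexing.integral_haar_mul_haar h₁ I₁ _ _ _ _ hne]; simp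
    · rw [ChildIndexing.integral_haar_mul_haar h₂ I₂ _ _ _ _ hne]; simp

include h₁ h₂ in
/-- Completeness of the product Haar system. -/
theorem ae_eq_zero_of_coeff_eq_zero [BorelSpace X₁] [BorelSpace X₂] {g : X₁ × X₂ → 𝕜}
    (hg : MemLp g 2 (μ₁.prod μ₂)) (hcoeff : ∀ j, coeff I₁ I₂ g j = 0)
    (H₁ : μ₁ Set.univ = ⊤ ∨ ∀ ψ : X₂ → ℝ, MemLp ψ 2 μ₂ →
      ∫ z, (1 * ψ z.2) • g z ∂(μ₁.prod μ₂) = 0)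
    (H₂ : μ₂ Set.univ = ⊤ ∨ ∀ φ : X₁ → ℝ, MemLp φ 2 μ₁ →
      ∫ z, (φ z.1 * 1) • g z ∂(μ₁.prod μ₂) = 0) : g =ᵐ[μ₁.prod μ₂] 0 := by
  have hlin₁ : ∀ ψ : X₂ → ℝ, MemLp ψ 2 μ₂ → ∀ φ φ' : X₁ → ℝ, MemLp φ 2 μ₁ → MemLp φ' 2 μ₁ →
      ∀ a b : ℝ, ∫ z, ((a * φ z.1 + b * φ' z.1) * ψ z.2) • g z ∂(μ₁.prod μ₂) =
        a • ∫ z, (φ z.1 * ψ z.2) • g z ∂(μ₁.prod μ₂) +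
          b • ∫ z, (φ' z.1 * ψ z.2) • g z ∂(μ₁.prod μ₂) := by
    intro ψ hψ φ φ' hφ hφ' a b
    rw [← integral_add_smul_eq (memLp_tensor hφ hψ) (memLp_tensor hφ' hψ) hg]
    refine integral_congr_ae (ae_of_all _ fun z => ?_)
    ring_nf
  have hlin₂ : ∀ φ : X₁ → ℝ, MemLp φ 2 μ₁ → ∀ ψ ψ' : X₂ → ℝ, MemLp ψ 2 μ₂ → MemLp ψ' 2 μ₂ →
      ∀ a b : ℝ, ∫ z, (φ z.1 * (a * ψ z.2 + b * ψ' z.2)) • g z ∂(μ₁.prod μ₂) =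
        a • ∫ z, (φ z.1 * ψ z.2) • g z ∂(μ₁.prod μ₂) +
          b • ∫ z, (φ z.1 * ψ' z.2) • g z ∂(μ₁.prod μ₂) := by
    intro φ hφ ψ ψ' hψ hψ' a b
    rw [← integral_add_smul_eq (memLp_tensor hφ hψ) (memLp_tensor hφ hψ') hg]
    refine integral_congr_ae (ae_of_all _ fun z => ?_)
    ring_nf
  have hbd : ∀ (φ : X₁ → ℝ) (ψ : X₂ → ℝ), MemLp φ 2 μ₁ → MemLp ψ 2 μ₂ →
      ‖∫ z, (φ z.1 * ψ z.2) • g z ∂(μ₁.prod μ₂)‖ ≤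
        √(∫ x, φ x * φ x ∂μ₁) * √(∫ x, ψ x * ψ x ∂μ₂) * ‖hg.toLp g‖ := by
    intro φ ψ hφ hψ
    have := norm_integral_smul_le (memLp_tensor hφ hψ) hg
    rwa [integral_tensor_mul_tensor, Real.sqrt_mul
      (integral_nonneg fun x => mul_self_nonneg _)] at this
  have step₁ : ∀ (p : D₁.Index) (q : D₂.Index) (v : Fin (D₂.numChildren q - 1)),
      ∫ z, ((D₁.Q p).indicator (fun _ => 1) z.1 * I₂.haar q v z.2) • g z ∂(μ₁.prod μ₂) = 0 := by
    intro p q v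
    have hψ := ChildIndexing.memLp_haar h₂ I₂ q v 2
    refine ChildIndexing.apply_indicator_Q_eq_zero h₁ I₁
      (Λ := fun φ => ∫ z, (φ z.1 * I₂.haar q v z.2) • g z ∂(μ₁.prod μ₂)) (hlin₁ _ hψ)
      (K := √(∫ x, I₂.haar q v x * I₂.haar q v x ∂μ₂) * ‖hg.toLp g‖) (fun φ hφ => ?_)
      (fun p' u => hcoeff (⟨p', u⟩, ⟨q, v⟩)) (H₁.imp_right fun H => H _ hψ) p
    exact (hbd _ _ hφ hψ).trans_eq (by ring)
  refine ae_eq_zero_of_integral_rect_eq_zero h₁ h₂ (D₁ := D₁) (D₂ := D₂) hg fun p q => ?_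
  have hφ : MemLp ((D₁.Q p).indicator fun _ => (1 : ℝ)) 2 μ₁ :=
    memLp_indicator_const _ (D₁.measurableSet_Q p) _ (Or.inr (D₁.measure_cube_lt_top h₁ _ _).ne)
  have step₂ : ∫ z, ((D₁.Q p).indicator (fun _ => (1 : ℝ)) z.1 *
      (D₂.Q q).indicator (fun _ => (1 : ℝ)) z.2) • g z ∂(μ₁.prod μ₂) = 0 := by
    refine ChildIndexing.apply_indicator_Q_eq_zero h₂ I₂
      (Λ := fun ψ => ∫ z, ((D₁.Q p).indicator (fun _ => 1) z.1 * ψ z.2) • g z ∂(μ₁.prod μ₂))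
      (hlin₂ _ hφ) (K := √(∫ x, (D₁.Q p).indicator (fun _ => 1) x *
        (D₁.Q p).indicator (fun _ => 1) x ∂μ₁) * ‖hg.toLp g‖) (fun ψ hψ => ?_)
      (fun q' v => step₁ p q' v) (H₂.imp_right fun H => H _ hφ) q
    exact (hbd _ _ hφ hψ).trans_eq (by ring)
  rw [← integral_indicator ((D₁.measurableSet_Q p).prod (D₂.measurableSet_Q q)), ← step₂]
  refine integral_congr_ae (ae_of_all _ fun z => ?_)
  by_cases hz₁ : z.1 ∈ D₁.Q p <;> by_cases hz₂ : z.2 ∈ D₂.Q q <;> simp [hz₁, hz₂, Set.indicator]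

/-- The Haar expansion of a square integrable function. In a factor of finite measure, the mean of
the function in that variable has to vanish. -/
theorem hasSum_coeff_smul_haarLp [BorelSpace X₁] [BorelSpace X₂] {f : X₁ × X₂ → 𝕜}
    (hf : MemLp f 2 (μ₁.prod μ₂))
    (H₁ : μ₁ Set.univ = ⊤ ∨ ∀ᵐ x₂ ∂μ₂, ∫ x₁, f (x₁, x₂) ∂μ₁ = 0)
    (H₂ : μ₂ Set.univ = ⊤ ∨ ∀ᵐ x₁ ∂μ₁, ∫ x₂, f (x₁, x₂) ∂μ₂ = 0) :
    HasSum (fun j => coeff I₁ I₂ f j • haarLp h₁ h₂ I₁ I₂ 𝕜 j) (hf.toLp f) := by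
  have hon := orthonormal_haarLp h₁ h₂ I₁ I₂ (𝕜 := 𝕜)
  have hsum : Summable fun j => coeff I₁ I₂ f j • haarLp h₁ h₂ I₁ I₂ 𝕜 j := by
    refine (hon.orthogonalFamily.summable_iff_norm_sq_summable _).2 ?_
    refine (hon.inner_products_summable (hf.toLp f)).congr fun j => ?_
    rw [inner_haarLp_toLp]
    rfl
  obtain ⟨P, hP⟩ := hsum
  -- the remainder is orthogonal to the Haar functions, and inherits the vanishing means
  have horth : ∀ j, inner 𝕜 (haarLp h₁ h₂ I₁ I₂ 𝕜 j) (hf.toLp f - P) = 0 := by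
    intro j
    have h1 := hP.mapL (innerSL 𝕜 (haarLp h₁ h₂ I₁ I₂ 𝕜 j))
    have h2 := h1.unique (hasSum_single j fun i hi => by
      simp [hon.2 hi.symm])
    simp only [innerSL_apply_apply, inner_smul_right, inner_self_eq_norm_sq_to_K, hon.1] at h2
    rw [inner_sub_right, inner_haarLp_toLp, h2]
    simp
  have hmean : ∀ (F : X₁ × X₂ → ℝ) (hF : MemLp F 2 (μ₁.prod μ₂)),
      (∀ j, inner 𝕜 (realLp 𝕜 hF) (haarLp h₁ h₂ I₁ I₂ 𝕜 j) = 0) →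
      ∫ z, F z • f z ∂(μ₁.prod μ₂) = 0 →
      ∫ z, F z • (hf.toLp f - P : Lp 𝕜 2 (μ₁.prod μ₂)) z ∂(μ₁.prod μ₂) = 0 := by
    intro F hF h0 hz
    rw [← inner_realLp hF, inner_sub_right, inner_realLp_toLp, hz, zero_sub, neg_eq_zero]
    have h1 := hP.mapL (innerSL 𝕜 (realLp 𝕜 hF))
    refine h1.unique ?_
    simp [h0, hasSum_zero]
  have hzero : ((hf.toLp f - P : Lp 𝕜 2 (μ₁.prod μ₂)) : X₁ × X₂ → 𝕜) =ᵐ[μ₁.prod μ₂] 0 := by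
    refine ae_eq_zero_of_coeff_eq_zero h₁ h₂ I₁ I₂ (Lp.memLp _) (fun j => ?_) ?_ ?_
    · rw [← inner_haarLp_toLp h₁ h₂ I₁ I₂ j (Lp.memLp _), Lp.toLp_coeFn]
      exact horth j
    · by_cases hfin : μ₁ Set.univ = ⊤
      · exact Or.inl hfin
      refine Or.inr fun ψ hψ => ?_
      have : IsFiniteMeasure μ₁ := ⟨lt_top_iff_ne_top.2 hfin⟩
      have hF := memLp_tensor (μ₁ := μ₁) (memLp_const (1 : ℝ)) hψ
      refine hmean (fun z => 1 * ψ z.2) hF (fun j => ?_) ?_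
      · change inner 𝕜 (realLp 𝕜 _) (realLp 𝕜 _) = 0
        rw [inner_realLp_realLp, integral_tensor_mul_tensor (fun _ => 1)]
        simp [ChildIndexing.integral_haar h₁ I₁]
      · rw [integral_prod_symm _ (integrable_smul_of_memLp_two hF hf)]
        refine integral_eq_zero_of_ae ?_
        filter_upwards [H₁.resolve_left hfin] with x₂ hx₂
        simp [integral_smul, hx₂]
    · by_cases hfin : μ₂ Set.univ = ⊤
      · exact Or.inl hfin
      refine Or.inr fun φ hφ => ?_
      have : IsFiniteMeasure μ₂ := ⟨lt_top_iff_ne_top.2 hfin⟩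
      have hF := memLp_tensor (μ₂ := μ₂) hφ (memLp_const (1 : ℝ))
      refine hmean (fun z => φ z.1 * 1) hF (fun j => ?_) ?_
      · change inner 𝕜 (realLp 𝕜 _) (realLp 𝕜 _) = 0
        rw [inner_realLp_realLp, integral_tensor_mul_tensor _ _ (fun _ => 1)]
        simp [ChildIndexing.integral_haar h₂ I₂]
      · rw [integral_prod _ (integrable_smul_of_memLp_two hF hf)]
        refine integral_eq_zero_of_ae ?_
        filter_upwards [H₂.resolve_left hfin] with x₁ hx₁
        simp [integral_smul, hx₁]
  have : hf.toLp f - P = 0 := (Lp.eq_zero_iff_ae_eq_zero).2 hzero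
  rwa [sub_eq_zero.1 this]

end HaarSystem

/-! ### The square function -/

section Inequalities

theorem tsum_mul_le_sqrt_mul_sqrt {ι : Type*} (f g : ι → ℝ≥0∞) :
    ∑' i, f i * g i ≤ (∑' i, f i ^ 2) ^ (1 / 2 : ℝ) * (∑' i, g i ^ 2) ^ (1 / 2 : ℝ) := by
  let _ : MeasurableSpace ι := ⊤
  have := ENNReal.lintegral_mul_le_Lp_mul_Lq (Measure.count : Measure ι) (f := f) (g := g)
    Real.HolderConjugate.two_two (measurable_from_top.aemeasurable)
    (measurable_from_top.aemeasurable)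
  simpa [lintegral_count] using this

/-- Minkowski's inequality in `ℓ²` for a series of nonnegative sequences. -/
theorem sqrt_tsum_sq_tsum_le {ι κ : Type*} (A : κ → ι → ℝ≥0∞) :
    (∑' i, (∑' k, A k i) ^ 2) ^ (1 / 2 : ℝ) ≤ ∑' k, (∑' i, A k i ^ 2) ^ (1 / 2 : ℝ) := by
  set T : κ → ℝ≥0∞ := fun k => (∑' i, A k i ^ 2) ^ (1 / 2 : ℝ)
  have h : ∑' i, (∑' k, A k i) ^ 2 ≤ (∑' k, T k) ^ 2 := by
    calc ∑' i, (∑' k, A k i) ^ 2 = ∑' i, ∑' k, ∑' l, A k i * A l i := by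
          simp_rw [sq, ← ENNReal.tsum_mul_left, ← ENNReal.tsum_mul_right]
          refine tsum_congr fun i => ENNReal.tsum_comm
      _ = ∑' k, ∑' l, ∑' i, A k i * A l i := by
          rw [ENNReal.tsum_comm]
          exact tsum_congr fun k => ENNReal.tsum_comm
      _ ≤ ∑' k, ∑' l, T k * T l :=
          ENNReal.tsum_le_tsum fun k => ENNReal.tsum_le_tsum fun l =>
            tsum_mul_le_sqrt_mul_sqrt _ _
      _ = (∑' k, T k) ^ 2 := by
          simp_rw [ENNReal.tsum_mul_left, ENNReal.tsum_mul_right, sq]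
  calc _ ≤ ((∑' k, T k) ^ 2) ^ (1 / 2 : ℝ) := ENNReal.rpow_le_rpow h (by norm_num)
    _ = _ := by
      rw [← ENNReal.rpow_natCast, ← ENNReal.rpow_mul]
      norm_num

variable {Y : Type*} [MeasurableSpace Y] {μ : Measure Y}

/-- Hölder's inequality on a set `Ω`, with the normalisation of atoms. -/
theorem lintegral_le_one_of_sq {F : Y → ℝ≥0∞} (hF : AEMeasurable F μ) {Ω : Set Y}
    (hΩ : MeasurableSet Ω) (hsupp : ∀ y ∉ Ω, F y = 0) (h : ∫⁻ y, F y ^ 2 ∂μ ≤ (μ Ω)⁻¹) :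
    ∫⁻ y, F y ∂μ ≤ 1 := by
  have h1 := ENNReal.lintegral_mul_le_Lp_mul_Lq μ (f := F) (g := Ω.indicator fun _ => 1)
    Real.HolderConjugate.two_two hF (measurable_const.indicator hΩ).aemeasurable
  have h2 : ∫⁻ y, (F * Ω.indicator (fun _ => (1 : ℝ≥0∞)) : Y → ℝ≥0∞) y ∂μ = ∫⁻ y, F y ∂μ := by
    refine lintegral_congr fun y => ?_
    by_cases hy : y ∈ Ω
    · simp [hy]
    · simp [hsupp y hy]
  have h3 : ∫⁻ y, Ω.indicator (fun _ => (1 : ℝ≥0∞)) y ^ (2 : ℝ) ∂μ = μ Ω := by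
    rw [← lintegral_indicator_one hΩ]
    refine lintegral_congr fun y => ?_
    by_cases hy : y ∈ Ω <;> simp [hy]
  rw [h2, h3] at h1
  refine h1.trans ?_
  rw [← ENNReal.mul_rpow_of_nonneg _ _ (by norm_num)]
  refine ENNReal.rpow_le_one ?_ (by norm_num)
  calc _ ≤ (μ Ω)⁻¹ * μ Ω := by
        gcongr
        simpa using h
    _ ≤ 1 := ENNReal.inv_mul_le_one _

theorem eLpNorm_two_sq {E : Type*} [NormedAddCommGroup E] (f : Y → E) :
    eLpNorm f 2 μ ^ 2 = ∫⁻ y, ‖f y‖ₑ ^ 2 ∂μ := by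
  rw [eLpNorm_eq_lintegral_rpow_enorm_toReal (by norm_num) (by norm_num), ← ENNReal.rpow_natCast,
    ← ENNReal.rpow_mul]
  norm_num

end Inequalities

section Series

variable {Y : Type*} [MeasurableSpace Y] {μ : Measure Y} {E : Type*} [NormedAddCommGroup E]
  {p : ℝ≥0∞}

theorem toLp_finsetSum {ι : Type*} {u : ι → Y → E} (hu : ∀ i, MemLp (u i) p μ) (s : Finset ι) :
    (memLp_finsetSum' s fun i _ => hu i).toLp (∑ i ∈ s, u i) = ∑ i ∈ s, (hu i).toLp (u i) := by
  classical
  induction s using Finset.induction_on with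
  | empty => simp
  | insert i s hi ih =>
    rw [Finset.sum_insert (f := fun i => (hu i).toLp (u i)) hi, ← ih, ← MemLp.toLp_add]
    exact MemLp.toLp_congr _ _ (Eq.eventuallyEq (Finset.sum_insert hi))

/-- Unconditional convergence in `L^p`, stated for functions and for their classes. -/
theorem hasSum_toLp_iff [Fact (1 ≤ p)] {ι : Type*} {u : ι → Y → E} (hu : ∀ i, MemLp (u i) p μ)
    {f : Y → E} (hf : MemLp f p μ) :
    HasSum (fun i => (hu i).toLp (u i)) (hf.toLp f) ↔
      Tendsto (fun s : Finset ι => eLpNorm (f - ∑ i ∈ s, u i) p μ) atTop (𝓝 0) := by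
  have := Lp.tendsto_Lp_iff_tendsto_eLpNorm'' (fi := atTop) (fun s : Finset ι => ∑ i ∈ s, u i)
    (fun s => memLp_finsetSum' s fun i _ => hu i) f hf
  simp_rw [toLp_finsetSum hu, eLpNorm_sub_comm _ f] at this
  exact this

end Series

section SquareFunction

variable {X₁ X₂ : Type*} [MeasurableSpace X₁] [MeasurableSpace X₂]
  {ρ₁ : X₁ → X₁ → ℝ} {ρ₂ : X₂ → X₂ → ℝ} {D₁ : DyadicSystem ρ₁} {D₂ : DyadicSystem ρ₂}
  {μ₁ : Measure X₁} {μ₂ : Measure X₂}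
  (I₁ : ChildIndexing D₁ μ₁) (I₂ : ChildIndexing D₂ μ₂) {𝕜 : Type*} [RCLike 𝕜]

theorem measurableSet_rect (j : HaarIndex D₁ D₂) : MeasurableSet (rect j) :=
  (D₁.measurableSet_Q _).prod (D₂.measurableSet_Q _)

theorem squareFunction_eq_tsum (f : X₁ × X₂ → 𝕜) (z : X₁ × X₂) :
    squareFunction I₁ I₂ f z = (∑' j : HaarIndex D₁ D₂, (‖coeff I₁ I₂ f j‖ₑ *
      (normIndicator μ₁ (D₁.Q j.1.1) z.1 * normIndicator μ₂ (D₂.Q j.2.1) z.2)) ^ 2) ^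
        (1 / 2 : ℝ) := by
  rw [squareFunction, ENNReal.tsum_prod']
  refine congrArg (· ^ (1 / 2 : ℝ)) (Eq.symm ?_)
  refine (ENNReal.tsum_sigma' _).trans (tsum_congr fun p => ?_)
  refine ENNReal.tsum_comm.trans ((ENNReal.tsum_sigma' _).trans (tsum_congr fun q => ?_))
  refine ENNReal.tsum_comm.trans ?_
  rw [tsum_fintype]
  refine Finset.sum_congr rfl fun u _ => ?_
  rw [tsum_fintype]
  refine Finset.sum_congr rfl fun v _ => ?_
  rw [← mul_assoc]
  rfl

theorem normIndicator_sq {X : Type*} [MeasurableSpace X] (μ : Measure X) (Q : Set X) (x : X) :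
    normIndicator μ Q x ^ 2 = Q.indicator (fun _ => (μ Q)⁻¹) x := by
  by_cases hx : x ∈ Q
  · simp only [normIndicator, Set.indicator_of_mem hx]
    rw [← ENNReal.rpow_natCast, ← ENNReal.rpow_mul]
    norm_num
    exact ENNReal.rpow_neg_one _
  · simp [normIndicator, hx]

theorem measurable_normIndicator {X : Type*} [MeasurableSpace X] {ρ : X → X → ℝ}
    (D : DyadicSystem ρ) (μ : Measure X) (p : D.Index) : Measurable (normIndicator μ (D.Q p)) :=
  measurable_const.indicator (D.measurableSet_Q p)

theorem measurable_squareFunction (f : X₁ × X₂ → 𝕜) : Measurable (squareFunction I₁ I₂ f) := by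
  have : squareFunction I₁ I₂ f = fun z => _ := funext (squareFunction_eq_tsum I₁ I₂ f)
  rw [this]
  refine Measurable.pow_const (Measurable.tsum fun j => ?_) _
  exact ((((measurable_normIndicator D₁ μ₁ j.1.1).comp measurable_fst).mul
    ((measurable_normIndicator D₂ μ₂ j.2.1).comp measurable_snd)).const_mul _).pow_const 2

theorem squareFunction_sq [TopologicalSpace X₁] [SFinite μ₂] (h₁ : IsHomogeneousType ρ₁ μ₁)
    (f : X₁ × X₂ → 𝕜) (z : X₁ × X₂) :
    squareFunction I₁ I₂ f z ^ 2 = ∑' j : HaarIndex D₁ D₂, ‖coeff I₁ I₂ f j‖ₑ ^ 2 *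
      (rect j).indicator (fun _ => (μ₁.prod μ₂ (rect j))⁻¹) z := by
  rw [squareFunction_eq_tsum, ← ENNReal.rpow_natCast, ← ENNReal.rpow_mul]
  norm_num
  refine tsum_congr fun j => ?_
  rw [mul_pow, mul_pow, normIndicator_sq, normIndicator_sq, rect, Measure.prod_prod]
  simp only [DyadicSystem.Q]
  rw [ENNReal.mul_inv (Or.inl (D₁.measure_cube_pos h₁ j.1.1.1 j.1.1.2).ne')
      (Or.inl (D₁.measure_cube_lt_top h₁ j.1.1.1 j.1.1.2).ne)]
  congr 1
  by_cases hz₁ : z.1 ∈ D₁.cube j.1.1.1 j.1.1.2 <;>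
    by_cases hz₂ : z.2 ∈ D₂.cube j.2.1.1 j.2.1.2 <;> simp [hz₁, hz₂, Set.indicator]

/-- A localised Parseval identity: a set `S` captures of each squared Haar coefficient the
proportion of its rectangle that lies in `S`. -/
theorem setLIntegral_squareFunction_sq [TopologicalSpace X₁] [SFinite μ₂]
    (h₁ : IsHomogeneousType ρ₁ μ₁) (f : X₁ × X₂ → 𝕜) (S : Set (X₁ × X₂)) :
    ∫⁻ z in S, squareFunction I₁ I₂ f z ^ 2 ∂(μ₁.prod μ₂) =
      ∑' j : HaarIndex D₁ D₂, ‖coeff I₁ I₂ f j‖ₑ ^ 2 *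
        ((μ₁.prod μ₂ (rect j))⁻¹ * μ₁.prod μ₂ (rect j ∩ S)) := by
  simp_rw [squareFunction_sq I₁ I₂ h₁]
  rw [lintegral_tsum fun j => ((measurable_const.indicator (measurableSet_rect j)).const_mul
    _).aemeasurable]
  refine tsum_congr fun j => ?_
  rw [lintegral_const_mul _ (measurable_const.indicator (measurableSet_rect j)),
    lintegral_indicator_const (measurableSet_rect j), Measure.restrict_apply (measurableSet_rect j)]

end SquareFunction

section SquareFunction

variable {X₁ X₂ : Type*} [TopologicalSpace X₁] [TopologicalSpace X₂]
  [MeasurableSpace X₁] [MeasurableSpace X₂]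
  {ρ₁ : X₁ → X₁ → ℝ} {ρ₂ : X₂ → X₂ → ℝ} {D₁ : DyadicSystem ρ₁} {D₂ : DyadicSystem ρ₂}
  {μ₁ : Measure X₁} {μ₂ : Measure X₂}
  (h₁ : IsHomogeneousType ρ₁ μ₁) (h₂ : IsHomogeneousType ρ₂ μ₂)
  (I₁ : ChildIndexing D₁ μ₁) (I₂ : ChildIndexing D₂ μ₂) {𝕜 : Type*} [RCLike 𝕜]

include h₁ h₂ in
theorem measure_rect_pos [SFinite μ₂] (j : HaarIndex D₁ D₂) : 0 < μ₁.prod μ₂ (rect j) := by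
  rw [rect, Measure.prod_prod]
  exact ENNReal.mul_pos (D₁.measure_cube_pos h₁ _ _).ne' (D₂.measure_cube_pos h₂ _ _).ne'

include h₁ h₂ in
theorem measure_rect_lt_top [SFinite μ₂] (j : HaarIndex D₁ D₂) : μ₁.prod μ₂ (rect j) < ⊤ := by
  rw [rect, Measure.prod_prod]
  exact ENNReal.mul_lt_top (D₁.measure_cube_lt_top h₁ _ _) (D₂.measure_cube_lt_top h₂ _ _)

include h₁ h₂ in
theorem coeff_sub_of_memLp_two {f g : X₁ × X₂ → 𝕜} (hf : MemLp f 2 (μ₁.prod μ₂))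
    (hg : MemLp g 2 (μ₁.prod μ₂)) (j : HaarIndex D₁ D₂) :
    coeff I₁ I₂ (f - g) j = coeff I₁ I₂ f j - coeff I₁ I₂ g j := by
  rw [← inner_haarLp_toLp h₁ h₂ I₁ I₂ j hf, ← inner_haarLp_toLp h₁ h₂ I₁ I₂ j hg,
    ← inner_haarLp_toLp h₁ h₂ I₁ I₂ j (hf.sub hg), MemLp.toLp_sub, inner_sub_right]

variable [SigmaFinite μ₁] [SigmaFinite μ₂]

include h₁ h₂ in
theorem tsum_enorm_coeff_sq_le {f : X₁ × X₂ → 𝕜} (hf : MemLp f 2 (μ₁.prod μ₂)) :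
    ∑' j, ‖coeff I₁ I₂ f j‖ₑ ^ 2 ≤ eLpNorm f 2 (μ₁.prod μ₂) ^ 2 := by
  have hon := orthonormal_haarLp h₁ h₂ I₁ I₂ (𝕜 := 𝕜)
  have h1 := hon.tsum_inner_products_le (hf.toLp f)
  have h2 := hon.inner_products_summable (hf.toLp f)
  simp_rw [inner_haarLp_toLp] at h1 h2
  have h3 := ENNReal.ofReal_le_ofReal h1
  rw [ENNReal.ofReal_tsum_of_nonneg (fun _ => by positivity) h2] at h3
  simpa [ENNReal.ofReal_pow, ofReal_norm, ENNReal.ofReal_toReal hf.2.ne] using h3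

include h₁ h₂ in
theorem enorm_coeff_le {f : X₁ × X₂ → 𝕜} (hf : MemLp f 2 (μ₁.prod μ₂)) (j : HaarIndex D₁ D₂) :
    ‖coeff I₁ I₂ f j‖ₑ ≤ eLpNorm f 2 (μ₁.prod μ₂) := by
  have := (ENNReal.le_tsum j).trans (tsum_enorm_coeff_sq_le h₁ h₂ I₁ I₂ hf)
  exact (ENNReal.pow_le_pow_left_iff two_ne_zero).1 this

include h₁ h₂ in
/-- A Haar coefficient of a rectangle atom vanishes unless the rectangle of the Haar function lies
inside that of the atom: otherwise one of the Haar factors is constant on the atom, which has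
cancellation in each variable. -/
theorem coeff_eq_zero_of_isRectAtom {p : D₁.Index} {q : D₂.Index} {b : X₁ × X₂ → 𝕜}
    (hb : IsRectAtom μ₁ μ₂ (D₁.Q p ×ˢ D₂.Q q) b) {j : HaarIndex D₁ D₂}
    (hj : ¬ rect j ⊆ D₁.Q p ×ˢ D₂.Q q) : coeff I₁ I₂ b j = 0 := by
  have hint := integrable_smul_of_memLp_two (memLp_haarProd h₁ h₂ I₁ I₂ j) hb.memLp
  have hb0 : ∀ z, z ∉ D₁.Q p ×ˢ D₂.Q q → b z = 0 := fun z hz => by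
    by_contra hne
    exact hz (hb.support_subset hne)
  change ∫ z, (I₁.haar j.1.1 j.1.2 z.1 * I₂.haar j.2.1 j.2.2 z.2) • b z ∂(μ₁.prod μ₂) = 0
  rcases I₁.Q_subset_or_haar_eq_const j.1.1 p j.1.2 with hsub₁ | ⟨c, hc⟩
  · rcases I₂.Q_subset_or_haar_eq_const j.2.1 q j.2.2 with hsub₂ | ⟨c, hc⟩
    · exact absurd (Set.prod_mono hsub₁ hsub₂) hj
    · rw [integral_prod _ hint]
      refine integral_eq_zero_of_ae ?_
      filter_upwards [hb.integral_snd] with x₁ hx₁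
      have : ∀ x₂, (I₁.haar j.1.1 j.1.2 x₁ * I₂.haar j.2.1 j.2.2 x₂) • b (x₁, x₂) =
          (I₁.haar j.1.1 j.1.2 x₁ * c) • b (x₁, x₂) := by
        intro x₂
        by_cases hx₂ : x₂ ∈ D₂.Q q
        · rw [hc x₂ hx₂]
        · rw [hb0 (x₁, x₂) (fun h => hx₂ h.2), smul_zero, smul_zero]
      simp [this, integral_smul, hx₁]
  · rw [integral_prod_symm _ hint]
    refine integral_eq_zero_of_ae ?_
    filter_upwards [hb.integral_fst] with x₂ hx₂
    have : ∀ x₁, (I₁.haar j.1.1 j.1.2 x₁ * I₂.haar j.2.1 j.2.2 x₂) • b (x₁, x₂) =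
        (c * I₂.haar j.2.1 j.2.2 x₂) • b (x₁, x₂) := by
      intro x₁
      by_cases hx₁ : x₁ ∈ D₁.Q p
      · rw [hc x₁ hx₁]
      · rw [hb0 (x₁, x₂) (fun h => hx₁ h.1), smul_zero, smul_zero]
    simp [this, integral_smul, hx₂]

end SquareFunction

/-! ### Series of atoms -/

section Support

variable {X₁ X₂ : Type*} [MeasurableSpace X₁] [MeasurableSpace X₂]
  {ρ₁ : X₁ → X₁ → ℝ} {ρ₂ : X₂ → X₂ → ℝ} {D₁ : DyadicSystem ρ₁} {D₂ : DyadicSystem ρ₂}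
  {μ₁ : Measure X₁} {μ₂ : Measure X₂}
  (I₁ : ChildIndexing D₁ μ₁) (I₂ : ChildIndexing D₂ μ₂) {𝕜 : Type*} [RCLike 𝕜]

theorem squareFunction_eq_zero [TopologicalSpace X₁] [SFinite μ₂]
    (h₁ : IsHomogeneousType ρ₁ μ₁) {Ω : Set (X₁ × X₂)} {a : X₁ × X₂ → 𝕜}
    (h : ∀ j : HaarIndex D₁ D₂, ¬ rect j ⊆ Ω → coeff I₁ I₂ a j = 0) {z : X₁ × X₂} (hz : z ∉ Ω) :
    squareFunction I₁ I₂ a z = 0 := by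
  have : squareFunction I₁ I₂ a z ^ 2 = 0 := by
    rw [squareFunction_sq I₁ I₂ h₁, ENNReal.tsum_eq_zero]
    intro j
    by_cases hj : rect j ⊆ Ω
    · rw [Set.indicator_of_notMem fun hzj => hz (hj hzj), mul_zero]
    · rw [h j hj]; simp
  exact pow_eq_zero_iff (two_ne_zero) |>.1 this

end Support

section Atoms

variable {X₁ X₂ : Type*} [TopologicalSpace X₁] [TopologicalSpace X₂]
  [MeasurableSpace X₁] [MeasurableSpace X₂]
  {ρ₁ : X₁ → X₁ → ℝ} {ρ₂ : X₂ → X₂ → ℝ} {D₁ : DyadicSystem ρ₁} {D₂ : DyadicSystem ρ₂}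
  {μ₁ : Measure X₁} {μ₂ : Measure X₂}
  (h₁ : IsHomogeneousType ρ₁ μ₁) (h₂ : IsHomogeneousType ρ₂ μ₂)
  (I₁ : ChildIndexing D₁ μ₁) (I₂ : ChildIndexing D₂ μ₂) {𝕜 : Type*} [RCLike 𝕜]
  [SigmaFinite μ₁] [SigmaFinite μ₂]

include h₁ h₂ in
/-- An atom has nonzero Haar coefficients only for rectangles inside its open set. -/
theorem coeff_eq_zero_of_tendsto {Ω : Set (X₁ × X₂)} {a : X₁ × X₂ → 𝕜}
    (ha : MemLp a 2 (μ₁.prod μ₂)) {b : maxRects D₁ D₂ Ω → X₁ × X₂ → 𝕜}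
    (hb : ∀ R, IsRectAtom μ₁ μ₂ R.1 (b R))
    (hlim : Tendsto (fun s : Finset (maxRects D₁ D₂ Ω) =>
        eLpNorm (a - ∑ R ∈ s, b R) 2 (μ₁.prod μ₂)) atTop (𝓝 0))
    {j : HaarIndex D₁ D₂} (hj : ¬ rect j ⊆ Ω) : coeff I₁ I₂ a j = 0 := by
  classical
  have hzero : ∀ R, coeff I₁ I₂ (b R) j = 0 := by
    rintro ⟨R, hR⟩
    obtain ⟨⟨p, q, rfl⟩, hRΩ⟩ := hR.1
    exact coeff_eq_zero_of_isRectAtom h₁ h₂ I₁ I₂ (hb ⟨_, hR⟩) fun hsub =>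
      hj (hsub.trans hRΩ)
  have hsum : ∀ s : Finset (maxRects D₁ D₂ Ω),
      coeff I₁ I₂ (a - ∑ R ∈ s, b R) j = coeff I₁ I₂ a j := by
    intro s
    induction s using Finset.induction_on with
    | empty => simp
    | insert R s hR ih =>
      rw [Finset.sum_insert hR, add_comm, ← sub_sub, coeff_sub_of_memLp_two h₁ h₂ I₁ I₂
        (ha.sub (memLp_finsetSum' s fun i _ => (hb i).memLp)) (hb R).memLp, ih, hzero, sub_zero]
  have hle : ‖coeff I₁ I₂ a j‖ₑ ≤ 0 := by
    refine ge_of_tendsto' hlim fun s => ?_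
    rw [← hsum s]
    exact enorm_coeff_le h₁ h₂ I₁ I₂ (ha.sub (memLp_finsetSum' s fun i _ => (hb i).memLp)) j
  simpa using hle

include h₁ h₂ in
theorem lintegral_squareFunction_sq_le {a : X₁ × X₂ → 𝕜} (ha : MemLp a 2 (μ₁.prod μ₂)) :
    ∫⁻ z, squareFunction I₁ I₂ a z ^ 2 ∂(μ₁.prod μ₂) ≤ eLpNorm a 2 (μ₁.prod μ₂) ^ 2 := by
  have := setLIntegral_squareFunction_sq I₁ I₂ h₁ a Set.univ
  rw [Measure.restrict_univ] at this
  rw [this]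
  refine le_trans (ENNReal.tsum_le_tsum fun j => ?_) (tsum_enorm_coeff_sq_le h₁ h₂ I₁ I₂ ha)
  rw [Set.inter_univ]
  exact mul_le_of_le_one_right' (ENNReal.inv_mul_le_one _)

include h₁ h₂ in
/-- Atoms are bounded in `L¹` and in the Hardy space norm. The dyadic square function of an atom
vanishes off its open set, so that the Hardy norm bound is Hölder's and Bessel's inequality. -/
theorem IsDyadicAtom.bounds [OpensMeasurableSpace (X₁ × X₂)] {a : X₁ × X₂ → 𝕜}
    (ha : IsDyadicAtom D₁ D₂ μ₁ μ₂ a) : MemLp a 2 (μ₁.prod μ₂) ∧ MemLp a 1 (μ₁.prod μ₂) ∧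
      eLpNorm a 1 (μ₁.prod μ₂) ≤ 1 ∧ hardyNorm I₁ I₂ a ≤ 1 := by
  obtain ⟨Ω, hΩ, -, hsupp, ha2, hnorm, b, hb, hlim, -⟩ := ha
  have hsq : eLpNorm a 2 (μ₁.prod μ₂) ^ 2 ≤ (μ₁.prod μ₂ Ω)⁻¹ := by
    refine (pow_le_pow_left' hnorm 2).trans_eq ?_
    rw [← ENNReal.rpow_natCast, ← ENNReal.rpow_mul, ← ENNReal.rpow_neg_one]
    norm_num
  have h1 : eLpNorm a 1 (μ₁.prod μ₂) ≤ 1 := by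
    rw [eLpNorm_one_eq_lintegral_enorm]
    refine lintegral_le_one_of_sq ha2.1.enorm hΩ.measurableSet (fun z hz => ?_) ?_
    · rw [enorm_eq_zero]
      by_contra hne
      exact hz (hsupp hne)
    · rwa [← eLpNorm_two_sq]
  refine ⟨ha2, ⟨ha2.1, h1.trans_lt ENNReal.one_lt_top⟩, h1, ?_⟩
  refine lintegral_le_one_of_sq (measurable_squareFunction I₁ I₂ a).aemeasurable
    hΩ.measurableSet (fun z hz => squareFunction_eq_zero I₁ I₂ h₁ (fun j hj =>
      coeff_eq_zero_of_tendsto h₁ h₂ I₁ I₂ ha2 hb hlim hj) hz) ?_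
  exact (lintegral_squareFunction_sq_le h₁ h₂ I₁ I₂ ha2).trans hsq

end Atoms

section Synthesis

variable {X₁ X₂ : Type*} [MeasurableSpace X₁] [MeasurableSpace X₂]
  {ρ₁ : X₁ → X₁ → ℝ} {ρ₂ : X₂ → X₂ → ℝ} {D₁ : DyadicSystem ρ₁} {D₂ : DyadicSystem ρ₂}
  {μ₁ : Measure X₁} {μ₂ : Measure X₂}
  (I₁ : ChildIndexing D₁ μ₁) (I₂ : ChildIndexing D₂ μ₂) {𝕜 : Type*} [RCLike 𝕜]

/-- Haar coefficients are continuous on `L¹`, because the Haar functions are bounded. -/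
theorem integrable_haarProd_smul {f : X₁ × X₂ → 𝕜} (hf : MemLp f 1 (μ₁.prod μ₂))
    (j : HaarIndex D₁ D₂) :
    Integrable (fun z => (I₁.haar j.1.1 j.1.2 z.1 * I₂.haar j.2.1 j.2.2 z.2) • f z)
      (μ₁.prod μ₂) ∧ ∃ K : ℝ≥0, ∀ g : X₁ × X₂ → 𝕜, ‖coeff I₁ I₂ g j‖ₑ ≤
        K * eLpNorm g 1 (μ₁.prod μ₂) := by
  obtain ⟨K₁, hK₁⟩ := I₁.exists_abs_haar_le j.1.1 j.1.2
  obtain ⟨K₂, hK₂⟩ := I₂.exists_abs_haar_le j.2.1 j.2.2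
  have hm : Measurable fun z : X₁ × X₂ => I₁.haar j.1.1 j.1.2 z.1 * I₂.haar j.2.1 j.2.2 z.2 :=
    ((I₁.measurable_haar _ _).comp measurable_fst).mul
      ((I₂.measurable_haar _ _).comp measurable_snd)
  have hK : ∀ z : X₁ × X₂, ‖I₁.haar j.1.1 j.1.2 z.1 * I₂.haar j.2.1 j.2.2 z.2‖ ≤ K₁ * K₂ := by
    intro z
    rw [norm_mul]
    exact mul_le_mul (hK₁ _) (hK₂ _) (norm_nonneg _) ((abs_nonneg _).trans (hK₁ z.1))
  refine ⟨(memLp_one_iff_integrable.1 hf).bdd_smul (K₁ * K₂) hm.aestronglyMeasurable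
    (ae_of_all _ hK), Real.toNNReal (K₁ * K₂), fun g => ?_⟩
  rw [eLpNorm_one_eq_lintegral_enorm, ← lintegral_const_mul' _ _ ENNReal.coe_ne_top]
  refine (enorm_integral_le_lintegral_enorm _).trans (lintegral_mono fun z => ?_)
  rw [enorm_smul]
  gcongr
  rw [← ofReal_norm]
  exact ENNReal.ofReal_le_ofReal (hK z)

theorem coeff_sub_sum_smul {f : X₁ × X₂ → 𝕜} (hf : MemLp f 1 (μ₁.prod μ₂)) {c : ℕ → 𝕜}
    {a : ℕ → X₁ × X₂ → 𝕜} (ha : ∀ k, MemLp (a k) 1 (μ₁.prod μ₂)) (j : HaarIndex D₁ D₂)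
    (s : Finset ℕ) : coeff I₁ I₂ (f - ∑ k ∈ s, c k • a k) j =
      coeff I₁ I₂ f j - ∑ k ∈ s, c k * coeff I₁ I₂ (a k) j := by
  have h1 := (integrable_haarProd_smul I₁ I₂ hf j).1
  have h2 := fun k => ((integrable_haarProd_smul I₁ I₂ (ha k) j).1).const_mul (c k)
  change _ = ∫ z, _ ∂_ - ∑ k ∈ s, c k * ∫ z, _ ∂_
  simp_rw [← integral_const_mul]
  rw [← integral_finsetSum s fun k _ => h2 k,
    ← integral_sub h1 (integrable_finsetSum s fun k _ => h2 k)]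
  refine integral_congr_ae (ae_of_all _ fun z => ?_)
  simp only [Pi.sub_apply, Finset.sum_apply, Pi.smul_apply, smul_sub, Finset.smul_sum, smul_eq_mul,
    RCLike.real_smul_eq_coe_mul]
  congr 1
  refine Finset.sum_congr rfl fun k _ => ?_
  ring

/-- The square function is countably sublinear. -/
theorem squareFunction_le_tsum {f : X₁ × X₂ → 𝕜} {c : ℕ → 𝕜}
    {a : ℕ → X₁ × X₂ → 𝕜} (ha : ∀ k, MemLp (a k) 1 (μ₁.prod μ₂))
    (hf : IsSeriesSum 1 (μ₁.prod μ₂) c a f) (z : X₁ × X₂) :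
    squareFunction I₁ I₂ f z ≤ ∑' k, ‖c k‖ₑ * squareFunction I₁ I₂ (a k) z := by
  have hcoeff : ∀ j : HaarIndex D₁ D₂,
      ‖coeff I₁ I₂ f j‖ₑ ≤ ∑' k, ‖c k‖ₑ * ‖coeff I₁ I₂ (a k) j‖ₑ := by
    intro j
    obtain ⟨-, K, hK⟩ := integrable_haarProd_smul I₁ I₂ hf.1 j
    have hlim := (ENNReal.Tendsto.const_mul hf.2 (Or.inr (ENNReal.coe_ne_top (r := K)))).add_const
      (∑' k, ‖c k‖ₑ * ‖coeff I₁ I₂ (a k) j‖ₑ)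
    rw [mul_zero, zero_add] at hlim
    refine ge_of_tendsto' hlim fun s => ?_
    calc ‖coeff I₁ I₂ f j‖ₑ = ‖coeff I₁ I₂ (f - ∑ k ∈ s, c k • a k) j +
            ∑ k ∈ s, c k * coeff I₁ I₂ (a k) j‖ₑ := by
          rw [coeff_sub_sum_smul I₁ I₂ hf.1 ha, sub_add_cancel]
      _ ≤ ‖coeff I₁ I₂ (f - ∑ k ∈ s, c k • a k) j‖ₑ +
            ‖∑ k ∈ s, c k * coeff I₁ I₂ (a k) j‖ₑ := enorm_add_le _ _
      _ ≤ _ := by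
          refine add_le_add (hK _) ((enorm_sum_le _ _).trans ?_)
          simp_rw [enorm_mul]
          exact ENNReal.sum_le_tsum s
  simp_rw [squareFunction_eq_tsum]
  set w : HaarIndex D₁ D₂ → ℝ≥0∞ := fun j =>
    normIndicator μ₁ (D₁.Q j.1.1) z.1 * normIndicator μ₂ (D₂.Q j.2.1) z.2
  calc (∑' j, (‖coeff I₁ I₂ f j‖ₑ * w j) ^ 2) ^ (1 / 2 : ℝ)
      ≤ (∑' j, (∑' k, ‖c k‖ₑ * (‖coeff I₁ I₂ (a k) j‖ₑ * w j)) ^ 2) ^ (1 / 2 : ℝ) := by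
        refine ENNReal.rpow_le_rpow (ENNReal.tsum_le_tsum fun j => ?_) (by norm_num)
        gcongr
        simp_rw [← mul_assoc]
        rw [ENNReal.tsum_mul_right]
        gcongr
        exact hcoeff j
    _ ≤ ∑' k, (∑' j, (‖c k‖ₑ * (‖coeff I₁ I₂ (a k) j‖ₑ * w j)) ^ 2) ^ (1 / 2 : ℝ) :=
        sqrt_tsum_sq_tsum_le _
    _ = _ := by
        refine tsum_congr fun k => ?_
        simp_rw [mul_pow (‖c k‖ₑ)]
        rw [ENNReal.tsum_mul_left, ENNReal.mul_rpow_of_nonneg _ _ (by norm_num),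
          ← ENNReal.rpow_natCast, ← ENNReal.rpow_mul]
        norm_num [w]

theorem isSeriesSum_congr {Y : Type*} [MeasurableSpace Y] {μ : Measure Y} {r : ℝ≥0∞} {c : ℕ → 𝕜}
    {a : ℕ → Y → 𝕜} {f g : Y → 𝕜} (hfg : f =ᵐ[μ] g) (hf : IsSeriesSum r μ c a f) :
    IsSeriesSum r μ c a g := by
  refine ⟨(memLp_congr_ae hfg).1 hf.1, hf.2.congr fun s => eLpNorm_congr_ae ?_⟩
  filter_upwards [hfg] with y hy
  simp [hy]

theorem exists_isSeriesSum_one {Y : Type*} [MeasurableSpace Y] {μ : Measure Y} {c : ℕ → 𝕜}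
    {a : ℕ → Y → 𝕜} (ha : ∀ k, MemLp (a k) 1 μ) (ha1 : ∀ k, eLpNorm (a k) 1 μ ≤ 1)
    (hc : ∑' k, ‖c k‖ₑ < ⊤) : ∃ f, IsSeriesSum 1 μ c a f := by
  have hca : ∀ k, MemLp (c k • a k) 1 μ := fun k => (ha k).const_smul (c k)
  have hsum : Summable fun k => (hca k).toLp (c k • a k) := by
    have hcs : Summable fun k => ‖c k‖ := by
      have := ENNReal.summable_toReal hc.ne
      simpa using this
    refine Summable.of_norm_bounded hcs fun k => ?_
    rw [Lp.norm_toLp]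
    refine ENNReal.toReal_le_of_le_ofReal (norm_nonneg _) ?_
    rw [eLpNorm_const_smul, ofReal_norm]
    exact mul_le_of_le_one_right' (ha1 k)
  obtain ⟨F, hF⟩ := hsum
  refine ⟨F, Lp.memLp F, (hasSum_toLp_iff hca (Lp.memLp F)).1 ?_⟩
  rwa [Lp.toLp_coeFn]

/-- Sums of a series in different Lebesgue spaces agree, since both are limits in measure. -/
theorem IsSeriesSum.ae_eq {Y : Type*} [MeasurableSpace Y] {μ : Measure Y} {c : ℕ → 𝕜}
    {a : ℕ → Y → 𝕜} {r s : ℝ≥0∞} (hr : r ≠ 0) (hs : s ≠ 0) (ha : ∀ k, MemLp (a k) r μ)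
    {f g : Y → 𝕜} (hf : IsSeriesSum r μ c a f) (hg : IsSeriesSum s μ c a g) : f =ᵐ[μ] g := by
  have hm : ∀ t : Finset ℕ, AEStronglyMeasurable (∑ k ∈ t, c k • a k) μ := fun t =>
    (memLp_finsetSum' t fun k _ => (ha k).const_smul (c k)).1
  have h1 := tendstoInMeasure_of_tendsto_eLpNorm (f := fun t : Finset ℕ => ∑ k ∈ t, c k • a k)
    (l := atTop) hr hm hf.1.1 (hf.2.congr fun t => eLpNorm_sub_comm _ _ _ _)
  have h2 := tendstoInMeasure_of_tendsto_eLpNorm (f := fun t : Finset ℕ => ∑ k ∈ t, c k • a k)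
    (l := atTop) hs hm hg.1.1 (hg.2.congr fun t => eLpNorm_sub_comm _ _ _ _)
  exact tendstoInMeasure_ae_unique h1 h2

end Synthesis

section Converse

variable {X₁ X₂ : Type*} [TopologicalSpace X₁] [TopologicalSpace X₂]
  [MeasurableSpace X₁] [MeasurableSpace X₂] [OpensMeasurableSpace (X₁ × X₂)]
  {ρ₁ : X₁ → X₁ → ℝ} {ρ₂ : X₂ → X₂ → ℝ} {D₁ : DyadicSystem ρ₁} {D₂ : DyadicSystem ρ₂}
  {μ₁ : Measure X₁} {μ₂ : Measure X₂}
  (h₁ : IsHomogeneousType ρ₁ μ₁) (h₂ : IsHomogeneousType ρ₂ μ₂)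
  (I₁ : ChildIndexing D₁ μ₁) (I₂ : ChildIndexing D₂ μ₂) {𝕜 : Type*} [RCLike 𝕜]
  [SigmaFinite μ₁] [SigmaFinite μ₂]

include h₁ h₂ in
/-- Absolutely convergent series of atoms belong to the Hardy space. -/
theorem memHardy_of_isSeriesSum {c : ℕ → 𝕜} {a : ℕ → X₁ × X₂ → 𝕜}
    (ha : ∀ k, IsDyadicAtom D₁ D₂ μ₁ μ₂ (a k)) (hc : ∑' k, ‖c k‖ₑ < ⊤) {f : X₁ × X₂ → 𝕜}
    (hf : IsSeriesSum 1 (μ₁.prod μ₂) c a f ∨ IsSeriesSum 2 (μ₁.prod μ₂) c a f) :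
    MemHardy I₁ I₂ f ∧ hardyNorm I₁ I₂ f ≤ ∑' k, ‖c k‖ₑ := by
  have hb := fun k => (ha k).bounds h₁ h₂ I₁ I₂
  have hf1 : IsSeriesSum 1 (μ₁.prod μ₂) c a f := by
    refine hf.elim id fun hf2 => ?_
    obtain ⟨g, hg⟩ := exists_isSeriesSum_one (fun k => (hb k).2.1) (fun k => (hb k).2.2.1) hc
    exact isSeriesSum_congr (hg.ae_eq one_ne_zero two_ne_zero (fun k => (hb k).2.1) hf2) hg
  have hle : hardyNorm I₁ I₂ f ≤ ∑' k, ‖c k‖ₑ := by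
    calc hardyNorm I₁ I₂ f
        ≤ ∫⁻ z, ∑' k, ‖c k‖ₑ * squareFunction I₁ I₂ (a k) z ∂(μ₁.prod μ₂) :=
          lintegral_mono (squareFunction_le_tsum I₁ I₂ (fun k => (hb k).2.1) hf1)
      _ = ∑' k, ‖c k‖ₑ * hardyNorm I₁ I₂ (a k) := by
          rw [lintegral_tsum fun k =>
            ((measurable_squareFunction I₁ I₂ (a k)).const_mul _).aemeasurable]
          exact tsum_congr fun k => lintegral_const_mul _ (measurable_squareFunction I₁ I₂ (a k))
      _ ≤ ∑' k, ‖c k‖ₑ := ENNReal.tsum_le_tsum fun k => mul_le_of_le_one_right' (hb k).2.2.2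
  exact ⟨⟨hf1.1, hle.trans_lt hc⟩, hle⟩

end Converse

/-! ### The strong maximal enlargement and maximal rectangles -/

section StrongMaximal

/-- The union of the dyadic rectangles of which more than half, in measure, is filled by `E`. -/
def enlargement {X₁ X₂ : Type*} [MeasurableSpace X₁] [MeasurableSpace X₂]
    {ρ₁ : X₁ → X₁ → ℝ} {ρ₂ : X₂ → X₂ → ℝ} (D₁ : DyadicSystem ρ₁) (D₂ : DyadicSystem ρ₂)
    (μ₁ : Measure X₁) (μ₂ : Measure X₂) (E : Set (X₁ × X₂)) : Set (X₁ × X₂) :=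
  ⋃ r ∈ {r : D₁.Index × D₂.Index | μ₁.prod μ₂ (D₁.Q r.1 ×ˢ D₂.Q r.2) <
    2 * μ₁.prod μ₂ (E ∩ D₁.Q r.1 ×ˢ D₂.Q r.2)}, D₁.Q r.1 ×ˢ D₂.Q r.2

variable {X₁ X₂ : Type*} [MeasurableSpace X₁] [MeasurableSpace X₂]
  {ρ₁ : X₁ → X₁ → ℝ} {ρ₂ : X₂ → X₂ → ℝ} {D₁ : DyadicSystem ρ₁} {D₂ : DyadicSystem ρ₂}
  {μ₁ : Measure X₁} {μ₂ : Measure X₂} [SigmaFinite μ₁] [SigmaFinite μ₂]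

/-- A weak type estimate for the strong dyadic maximal operator on sets. It follows from two
applications of the one-parameter estimate: if `E` fills more than half of `Q₁ × Q₂`, then for more
than a quarter of the points of `Q₁` the slice of `E` fills more than a quarter of `Q₂`. -/
theorem measure_enlargement_le {E : Set (X₁ × X₂)} (hE : MeasurableSet E) :
    μ₁.prod μ₂ (enlargement D₁ D₂ μ₁ μ₂ E) ≤ 16 * μ₁.prod μ₂ E := by
  -- the points of `X₁` whose slice fills more than a quarter of a given cube of `X₂`
  set A : D₂.Index → Set X₁ := fun q =>
    {x | μ₂ (D₂.Q q) < 4 * μ₂ (Prod.mk x ⁻¹' E ∩ D₂.Q q)} with hA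
  have hmeas : ∀ q, Measurable fun x => μ₂ (Prod.mk x ⁻¹' E ∩ D₂.Q q) := fun q =>
    measurable_measure_prodMk_left (ν := μ₂) (hE.inter (measurable_snd (D₂.measurableSet_Q q)))
  have hAm : ∀ q, MeasurableSet (A q) := fun q =>
    measurableSet_lt measurable_const ((hmeas q).const_mul 4)
  set F : Set (X₁ × X₂) := ⋃ q, A q ×ˢ D₂.Q q with hF
  have hFm : MeasurableSet F := MeasurableSet.iUnion fun q => (hAm q).prod (D₂.measurableSet_Q q)
  have hFE : μ₁.prod μ₂ F ≤ 4 * μ₁.prod μ₂ E := by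
    rw [Measure.prod_apply hFm, Measure.prod_apply hE,
      ← lintegral_const_mul _ (measurable_measure_prodMk_left hE)]
    refine lintegral_mono fun x => ?_
    refine (measure_mono ?_).trans (DyadicSystem.measure_biUnion_Q_le (D := D₂) (μ := μ₂)
      (E := Prod.mk x ⁻¹' E) (S := {q | x ∈ A q}) fun q hq => le_of_lt hq)
    intro y hy
    obtain ⟨q, hxq, hyq⟩ := Set.mem_iUnion.1 hy
    exact Set.mem_biUnion (show q ∈ {q | x ∈ A q} from hxq) hyq
  set B : D₁.Index → Set X₂ := fun p =>
    {y | μ₁ (D₁.Q p) < 4 * μ₁ ((fun x => (x, y)) ⁻¹' F ∩ D₁.Q p)} with hB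
  have hBm : ∀ p, MeasurableSet (B p) := fun p =>
    measurableSet_lt measurable_const ((measurable_measure_prodMk_right (μ := μ₁)
      (hFm.inter (measurable_fst (D₁.measurableSet_Q p)))).const_mul 4)
  set G : Set (X₁ × X₂) := ⋃ p, D₁.Q p ×ˢ B p with hG
  have hGm : MeasurableSet G := MeasurableSet.iUnion fun p => (D₁.measurableSet_Q p).prod (hBm p)
  have hGF : μ₁.prod μ₂ G ≤ 4 * μ₁.prod μ₂ F := by
    rw [Measure.prod_apply_symm hGm, Measure.prod_apply_symm hFm,
      ← lintegral_const_mul _ (measurable_measure_prodMk_right hFm)]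
    refine lintegral_mono fun y => ?_
    refine (measure_mono ?_).trans (DyadicSystem.measure_biUnion_Q_le (D := D₁) (μ := μ₁)
      (E := (fun x => (x, y)) ⁻¹' F) (S := {p | y ∈ B p}) fun p hp => le_of_lt hp)
    intro x hx
    obtain ⟨p, hxp, hyp⟩ := Set.mem_iUnion.1 hx
    exact Set.mem_biUnion (show p ∈ {p | y ∈ B p} from hyp) hxp
  have hsub : enlargement D₁ D₂ μ₁ μ₂ E ⊆ G := by
    refine Set.iUnion₂_subset fun ⟨p, q⟩ hr => ?_
    change μ₁.prod μ₂ (D₁.Q p ×ˢ D₂.Q q) < 2 * μ₁.prod μ₂ (E ∩ D₁.Q p ×ˢ D₂.Q q) at hr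
    rintro ⟨x, y⟩ ⟨hx, hy⟩
    refine Set.mem_iUnion.2 ⟨p, hx, ?_⟩
    by_contra hcon
    have hcon : 4 * μ₁ ((fun x => (x, y)) ⁻¹' F ∩ D₁.Q p) ≤ μ₁ (D₁.Q p) := not_lt.1 hcon
    have hAp : 4 * μ₁ (A q ∩ D₁.Q p) ≤ μ₁ (D₁.Q p) := by
      refine le_trans ?_ hcon
      gcongr
      exact fun x' hx' => Set.mem_iUnion.2 ⟨q, hx', hy⟩
    have hslice : ∀ x', 4 * μ₂ (Prod.mk x' ⁻¹' E ∩ D₂.Q q) ≤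
        μ₂ (D₂.Q q) * (4 * (A q).indicator (fun _ => 1) x' + 1) := by
      intro x'
      by_cases hx' : x' ∈ A q
      · rw [Set.indicator_of_mem hx', mul_one, mul_add, mul_one, mul_comm (μ₂ _)]
        exact le_add_right (by gcongr; exact Set.inter_subset_right)
      · rw [Set.indicator_of_notMem hx', mul_zero, zero_add, mul_one]
        exact not_lt.1 hx'
    have h4 : 4 * μ₁.prod μ₂ (E ∩ D₁.Q p ×ˢ D₂.Q q) ≤ 2 * μ₁.prod μ₂ (D₁.Q p ×ˢ D₂.Q q) := by
      calc 4 * μ₁.prod μ₂ (E ∩ D₁.Q p ×ˢ D₂.Q q)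
          = ∫⁻ x' in D₁.Q p, 4 * μ₂ (Prod.mk x' ⁻¹' E ∩ D₂.Q q) ∂μ₁ := by
            rw [Measure.prod_apply (hE.inter ((D₁.measurableSet_Q p).prod (D₂.measurableSet_Q q))),
              lintegral_const_mul _ (hmeas q), ← lintegral_indicator (D₁.measurableSet_Q p)]
            congr 1
            refine lintegral_congr fun x' => ?_
            by_cases hx' : x' ∈ D₁.Q p
            · rw [Set.indicator_of_mem hx']
              congr 1
              ext y'
              simp [hx']
            · rw [Set.indicator_of_notMem hx']
              simp [hx', Set.preimage]
        _ ≤ ∫⁻ x' in D₁.Q p, μ₂ (D₂.Q q) * (4 * (A q).indicator (fun _ => 1) x' + 1) ∂μ₁ :=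
            lintegral_mono hslice
        _ = μ₂ (D₂.Q q) * (4 * μ₁ (A q ∩ D₁.Q p) + μ₁ (D₁.Q p)) := by
            have hi : Measurable ((A q).indicator fun _ : X₁ => (1 : ℝ≥0∞)) :=
              measurable_const.indicator (hAm q)
            rw [lintegral_const_mul _ ((hi.const_mul 4).add_const 1),
              lintegral_add_right _ measurable_const, lintegral_const_mul _ hi,
              lintegral_indicator_const (hAm q), Measure.restrict_apply (hAm q)]
            simp
        _ ≤ μ₂ (D₂.Q q) * (μ₁ (D₁.Q p) + μ₁ (D₁.Q p)) := by gcongr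
        _ = 2 * μ₁.prod μ₂ (D₁.Q p ×ˢ D₂.Q q) := by rw [Measure.prod_prod]; ring
    have h5 : 2 * (2 * μ₁.prod μ₂ (E ∩ D₁.Q p ×ˢ D₂.Q q)) ≤
        2 * μ₁.prod μ₂ (D₁.Q p ×ˢ D₂.Q q) := by
      rw [← mul_assoc, show (2 : ℝ≥0∞) * 2 = 4 by norm_num]
      exact h4
    exact absurd hr (not_lt.2 ((ENNReal.mul_le_mul_iff_right (by norm_num) (by norm_num)).1 h5))
  calc μ₁.prod μ₂ (enlargement D₁ D₂ μ₁ μ₂ E) ≤ μ₁.prod μ₂ G := measure_mono hsub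
    _ ≤ 4 * (4 * μ₁.prod μ₂ E) := hGF.trans (by gcongr)
    _ = 16 * μ₁.prod μ₂ E := by rw [← mul_assoc]; norm_num

end StrongMaximal

section MaximalRectangles

variable {X₁ X₂ : Type*} [TopologicalSpace X₁] [TopologicalSpace X₂]
  [MeasurableSpace X₁] [MeasurableSpace X₂]
  {ρ₁ : X₁ → X₁ → ℝ} {ρ₂ : X₂ → X₂ → ℝ} {D₁ : DyadicSystem ρ₁} {D₂ : DyadicSystem ρ₂}
  {μ₁ : Measure X₁} {μ₂ : Measure X₂}
  (h₁ : IsHomogeneousType ρ₁ μ₁) (h₂ : IsHomogeneousType ρ₂ μ₂) [SFinite μ₂]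

include h₁ h₂ in
/-- In a set of finite measure, every dyadic rectangle lies in a maximal one: a rectangle whose
measure almost attains the supremum is maximal, because strictly larger dyadic rectangles are
larger by a fixed factor. -/
theorem exists_subset_maxRects {Ω : Set (X₁ × X₂)} (hΩ : μ₁.prod μ₂ Ω < ⊤) {R : Set (X₁ × X₂)}
    (hR : IsDyadicRect D₁ D₂ R) (hRΩ : R ⊆ Ω) : ∃ R' ∈ maxRects D₁ D₂ Ω, R ⊆ R' := by
  obtain ⟨η₁, hη₁, hgrow₁⟩ := D₁.exists_measure_growth h₁
  obtain ⟨η₂, hη₂, hgrow₂⟩ := D₂.exists_measure_growth h₂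
  set η := min η₁ η₂ with hη
  have hη1 : 1 < η := lt_min hη₁ hη₂
  have hgrow : ∀ R' R'', IsDyadicRect D₁ D₂ R' → IsDyadicRect D₁ D₂ R'' → R' ⊂ R'' →
      (η : ℝ≥0∞) * μ₁.prod μ₂ R' ≤ μ₁.prod μ₂ R'' := by
    rintro _ _ ⟨p, q, rfl⟩ ⟨p', q', rfl⟩ hss
    have hne : (D₁.Q p ×ˢ D₂.Q q).Nonempty :=
      ⟨(_, _), D₁.center_mem h₁.quasiMetric _ _, D₂.center_mem h₂.quasiMetric _ _⟩
    obtain ⟨hs₁, hs₂⟩ := (Set.prod_subset_prod_iff.1 hss.1).resolve_right fun h => by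
      rcases h with h | h <;> simp [h] at hne
    rw [Measure.prod_prod, Measure.prod_prod]
    by_cases heq : D₁.Q p = D₁.Q p'
    · have hss₂ : D₂.Q q ⊂ D₂.Q q' := hs₂.ssubset_of_ne fun h => hss.ne (by rw [heq, h])
      calc (η : ℝ≥0∞) * (μ₁ (D₁.Q p) * μ₂ (D₂.Q q))
          ≤ η₂ * (μ₁ (D₁.Q p) * μ₂ (D₂.Q q)) := by gcongr; exact min_le_right _ _
        _ = μ₁ (D₁.Q p) * (η₂ * μ₂ (D₂.Q q)) := by ring
        _ ≤ μ₁ (D₁.Q p') * μ₂ (D₂.Q q') := mul_le_mul' (measure_mono hs₁) (hgrow₂ _ _ hss₂)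
    · calc (η : ℝ≥0∞) * (μ₁ (D₁.Q p) * μ₂ (D₂.Q q))
          ≤ η₁ * (μ₁ (D₁.Q p) * μ₂ (D₂.Q q)) := by gcongr; exact min_le_left _ _
        _ = (η₁ * μ₁ (D₁.Q p)) * μ₂ (D₂.Q q) := by ring
        _ ≤ μ₁ (D₁.Q p') * μ₂ (D₂.Q q') :=
            mul_le_mul' (hgrow₁ _ _ (hs₁.ssubset_of_ne heq)) (measure_mono hs₂)
  have hpos : 0 < μ₁.prod μ₂ R := by
    obtain ⟨p, q, rfl⟩ := hR
    rw [Measure.prod_prod]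
    exact ENNReal.mul_pos (D₁.measure_cube_pos h₁ _ _).ne' (D₂.measure_cube_pos h₂ _ _).ne'
  set S : Set (Set (X₁ × X₂)) := {R' | IsDyadicRect D₁ D₂ R' ∧ R ⊆ R' ∧ R' ⊆ Ω}
  set s := ⨆ R' ∈ S, μ₁.prod μ₂ R' with hs
  have hs0 : 0 < s := hpos.trans_le (le_iSup₂_of_le R ⟨hR, subset_rfl, hRΩ⟩ le_rfl)
  have hs_fin : s ≠ ⊤ := ((iSup₂_le fun R' hR' => measure_mono hR'.2.2).trans_lt hΩ).ne
  have hlt : s / η < s := by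
    refine ENNReal.div_lt_of_lt_mul ?_
    conv_lhs => rw [← mul_one s]
    exact (ENNReal.mul_lt_mul_iff_right hs0.ne' hs_fin).2 (by exact_mod_cast hη1)
  obtain ⟨R', hR'⟩ := lt_iSup_iff.1 hlt
  obtain ⟨hR'S, hlt'⟩ := lt_iSup_iff.1 hR'
  refine ⟨R', ⟨⟨hR'S.1, hR'S.2.2⟩, fun R'' hR'' hle => ?_⟩, hR'S.2.1⟩
  by_contra hnot
  have h1 := hgrow R' R'' hR'S.1 hR''.1 ⟨hle, hnot⟩
  have h2 : μ₁.prod μ₂ R'' ≤ s := le_iSup₂_of_le R'' ⟨hR''.1, hR'S.2.1.trans hle, hR''.2⟩ le_rfl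
  have hη0 : (η : ℝ≥0∞) ≠ 0 := by
    have : (0 : ℝ≥0) < η := zero_lt_one.trans hη1
    exact_mod_cast this.ne'
  have h3 : μ₁.prod μ₂ R' ≤ s / η :=
    (ENNReal.le_div_iff_mul_le (Or.inl hη0) (Or.inl ENNReal.coe_ne_top)).2
      (by rw [mul_comm]; exact h1.trans h2)
  exact absurd hlt' (not_lt.2 h3)

include h₁ h₂ in
/-- A set of finite measure can be enlarged to an open set that is at most twice as large in
measure. If the set is null, the open set is empty, and only contains the dyadic rectangles of the
given set because there are none. -/
theorem exists_isOpen_measure_le [(μ₁.prod μ₂).OuterRegular] {E : Set (X₁ × X₂)}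
    (hE : μ₁.prod μ₂ E ≠ ⊤) : ∃ O : Set (X₁ × X₂), IsOpen O ∧
      μ₁.prod μ₂ O ≤ 2 * μ₁.prod μ₂ E ∧
      ∀ j : HaarIndex D₁ D₂, rect j ⊆ E → rect j ⊆ O := by
  by_cases h0 : μ₁.prod μ₂ E = 0
  · refine ⟨∅, isOpen_empty, by simp, fun j hj => absurd (measure_mono_null hj h0) ?_⟩
    exact (measure_rect_pos h₁ h₂ j).ne'
  · have hlt : μ₁.prod μ₂ E < 2 * μ₁.prod μ₂ E := by
      rw [two_mul]
      exact ENNReal.lt_add_right hE h0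
    obtain ⟨O, hEO, hO, hOlt⟩ := Set.exists_isOpen_lt_of_lt E _ hlt
    exact ⟨O, hO, hOlt.le, fun j hj => hj.trans hEO⟩

end MaximalRectangles

/-! ### Atoms from Haar series -/

section Hilbert

variable {𝕜 H : Type*} [RCLike 𝕜] [NormedAddCommGroup H] [InnerProductSpace 𝕜 H]
  {ι κ : Type*} {e : ι → H} {c : ι → 𝕜} {F : H}

/-- Parseval's identity for an orthonormal expansion. -/
theorem enorm_sq_eq_tsum_of_hasSum (he : Orthonormal 𝕜 e) (hF : HasSum (fun i => c i • e i) F) :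
    ‖F‖ₑ ^ 2 = ∑' i, ‖c i‖ₑ ^ 2 := by
  have hcoef : ∀ i, inner 𝕜 (e i) F = c i := by
    intro i
    have h1 := hF.mapL (innerSL 𝕜 (e i))
    have h2 := h1.unique (hasSum_single i fun l hl => by simp [he.2 hl.symm])
    simpa [he.1 i] using h2
  have h1 := (hF.mapL (innerSL 𝕜 F)).mapL RCLike.reCLM
  have h2 : HasSum (fun i => ‖c i‖ ^ 2) (‖F‖ ^ 2) := by
    have hl : ∀ i, RCLike.reCLM (innerSL 𝕜 F (c i • e i)) = ‖c i‖ ^ 2 := by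
      intro i
      rw [innerSL_apply_apply, inner_smul_right, ← inner_conj_symm, hcoef, RCLike.mul_conj]
      rw [← RCLike.ofReal_pow]
      exact RCLike.ofReal_re _
    have hr : RCLike.reCLM (innerSL 𝕜 F F) = ‖F‖ ^ 2 := by
      rw [innerSL_apply_apply, inner_self_eq_norm_sq_to_K]
      rw [← RCLike.ofReal_pow]
      exact RCLike.ofReal_re _
    rw [hr] at h1
    simpa only [hl] using h1
  have h3 := congrArg ENNReal.ofReal h2.tsum_eq
  rw [ENNReal.ofReal_tsum_of_nonneg (fun _ => by positivity) h2.summable] at h3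
  simpa [ENNReal.ofReal_pow, ofReal_norm] using h3.symm

/-- The terms of an orthonormal expansion may be grouped in an arbitrary way. -/
theorem exists_hasSum_fiber [CompleteSpace H] (he : Orthonormal 𝕜 e)
    (hF : HasSum (fun i => c i • e i) F) (π : ι → κ) : ∃ G : κ → H,
      (∀ k, HasSum (fun i : {i // π i = k} => c i • e i) (G k)) ∧ HasSum G F ∧
      ∑' k, ‖G k‖ₑ ^ 2 = ‖F‖ₑ ^ 2 := by
  have hG : ∀ k, HasSum (fun i : {i // π i = k} => c i • e i)
      (∑' i : {i // π i = k}, c i • e i) := fun k => (hF.summable.subtype _).hasSum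
  refine ⟨_, hG, ?_, ?_⟩
  · exact ((Equiv.sigmaFiberEquiv π).hasSum_iff.2 hF).sigma fun k => hG k
  · rw [enorm_sq_eq_tsum_of_hasSum he hF, ← (Equiv.sigmaFiberEquiv π).tsum_eq,
      ENNReal.tsum_sigma']
    exact tsum_congr fun k =>
      enorm_sq_eq_tsum_of_hasSum (he.comp _ Subtype.val_injective) (hG k)

end Hilbert

section Support

variable {Y : Type*} [MeasurableSpace Y] {μ : Measure Y} {𝕜 : Type*} [RCLike 𝕜]

/-- Vanishing outside a set passes to `L²` limits. -/
theorem indicator_ae_eq_of_hasSum {ι : Type*} {u : ι → Lp 𝕜 2 μ} {x : Lp 𝕜 2 μ} (hx : HasSum u x)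
    {S : Set Y} (hS : MeasurableSet S) (hu : ∀ i, ∀ᵐ y ∂μ, y ∉ S → u i y = 0) :
    S.indicator x =ᵐ[μ] x := by
  have h0 : ∀ i, LpToLpRestrictCLM Y 𝕜 𝕜 μ 2 Sᶜ (u i) = 0 := by
    intro i
    rw [Lp.eq_zero_iff_ae_eq_zero]
    filter_upwards [LpToLpRestrictCLM_coeFn 𝕜 Sᶜ (u i), (ae_restrict_iff' hS.compl).2 (hu i)]
      with y hy hy'
    rw [hy, hy']
    rfl
  have h1 : LpToLpRestrictCLM Y 𝕜 𝕜 μ 2 Sᶜ x = 0 := by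
    refine (hx.mapL (LpToLpRestrictCLM Y 𝕜 𝕜 μ 2 Sᶜ)).unique ?_
    simp [h0, hasSum_zero]
  have h2 : ∀ᵐ y ∂μ.restrict Sᶜ, x y = 0 := by
    filter_upwards [LpToLpRestrictCLM_coeFn 𝕜 Sᶜ x, Lp.eq_zero_iff_ae_eq_zero.1 h1] with y hy hy'
    rw [← hy, hy']
    rfl
  filter_upwards [(ae_restrict_iff' hS.compl).1 h2] with y hy
  by_cases hyS : y ∈ S
  · rw [Set.indicator_of_mem hyS]
  · rw [Set.indicator_of_notMem hyS, hy hyS]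

end Support

section RectangleAtoms

variable {X₁ X₂ : Type*} [TopologicalSpace X₁] [TopologicalSpace X₂]
  [MeasurableSpace X₁] [MeasurableSpace X₂]
  {ρ₁ : X₁ → X₁ → ℝ} {ρ₂ : X₂ → X₂ → ℝ} {D₁ : DyadicSystem ρ₁} {D₂ : DyadicSystem ρ₂}
  {μ₁ : Measure X₁} {μ₂ : Measure X₂}
  (h₁ : IsHomogeneousType ρ₁ μ₁) (h₂ : IsHomogeneousType ρ₂ μ₂)
  (I₁ : ChildIndexing D₁ μ₁) (I₂ : ChildIndexing D₂ μ₂) {𝕜 : Type*} [RCLike 𝕜]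
  {ι : Type*} {m : ι → HaarIndex D₁ D₂} {c : ι → 𝕜} {x : Lp 𝕜 2 (μ₁.prod μ₂)}

theorem indicator_ae_eq_of_hasSum_haarLp
    (hx : HasSum (fun i => c i • haarLp h₁ h₂ I₁ I₂ 𝕜 (m i)) x) {S : Set (X₁ × X₂)}
    (hS : MeasurableSet S) (hm : ∀ i, rect (m i) ⊆ S) : S.indicator x =ᵐ[μ₁.prod μ₂] x := by
  refine indicator_ae_eq_of_hasSum hx hS fun i => ?_
  filter_upwards [Lp.coeFn_smul (c i) (haarLp h₁ h₂ I₁ I₂ 𝕜 (m i)),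
    ((memLp_haarProd h₁ h₂ I₁ I₂ (m i)).ofReal (K := 𝕜)).coeFn_toLp] with z hz hz' hzS
  rw [hz, Pi.smul_apply, haarLp, realLp, hz']
  have hzm : z ∉ rect (m i) := fun h => hzS (hm i h)
  have : I₁.haar (m i).1.1 (m i).1.2 z.1 * I₂.haar (m i).2.1 (m i).2.2 z.2 = 0 := by
    by_cases hz₁ : z.1 ∈ D₁.Q (m i).1.1
    · rw [ChildIndexing.haar_eq_zero_of_notMem I₂ fun h => hzm ⟨hz₁, h⟩, mul_zero]
    · rw [ChildIndexing.haar_eq_zero_of_notMem I₁ hz₁, zero_mul]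
  simp [this]

theorem integral_tensor_smul_eq_zero [SFinite μ₁] [SFinite μ₂]
    (hx : HasSum (fun i => c i • haarLp h₁ h₂ I₁ I₂ 𝕜 (m i)) x)
    {φ : X₁ → ℝ} {ψ : X₂ → ℝ} (hφ : MemLp φ 2 μ₁) (hψ : MemLp ψ 2 μ₂)
    (h0 : ∀ i, ∫ y, φ y * I₁.haar (m i).1.1 (m i).1.2 y ∂μ₁ = 0 ∨
      ∫ y, ψ y * I₂.haar (m i).2.1 (m i).2.2 y ∂μ₂ = 0) :
    ∫ z, (φ z.1 * ψ z.2) • x z ∂(μ₁.prod μ₂) = 0 := by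
  rw [← inner_realLp (memLp_tensor hφ hψ)]
  refine (hx.mapL (innerSL 𝕜 (realLp 𝕜 (memLp_tensor hφ hψ)))).unique ?_
  have : ∀ i, inner 𝕜 (realLp 𝕜 (memLp_tensor hφ hψ)) (haarLp h₁ h₂ I₁ I₂ 𝕜 (m i)) = 0 := by
    intro i
    rw [haarLp, inner_realLp_realLp, integral_tensor_mul_tensor]
    rcases h0 i with h | h <;> simp [h]
  simp [this, hasSum_zero]

theorem ChildIndexing.integral_indicator_mul_haar {X : Type*} [TopologicalSpace X]
    [MeasurableSpace X] {ρ : X → X → ℝ} {μ : Measure X} {D : DyadicSystem ρ}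
    (h : IsHomogeneousType ρ μ) (I : ChildIndexing D μ) {p : D.Index}
    (u : Fin (D.numChildren p - 1)) {S : Set X} (hS : D.Q p ⊆ S) :
    ∫ y, S.indicator (fun _ => 1) y * I.haar p u y ∂μ = 0 := by
  rw [← integral_haar h I p u]
  refine integral_congr_ae (ae_of_all _ fun y => ?_)
  by_cases hy : y ∈ S
  · simp [hy]
  · simp [hy, ChildIndexing.haar_eq_zero_of_notMem I fun h => hy (hS h)]

/-- A Haar series over rectangles inside a fixed one has cancellation in each variable. -/
theorem isRectAtom_of_hasSum [SigmaFinite μ₁] [SigmaFinite μ₂]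
    (hx : HasSum (fun i => c i • haarLp h₁ h₂ I₁ I₂ 𝕜 (m i)) x) {p : D₁.Index} {q : D₂.Index}
    (hm : ∀ i, rect (m i) ⊆ D₁.Q p ×ˢ D₂.Q q) :
    IsRectAtom μ₁ μ₂ (D₁.Q p ×ˢ D₂.Q q) ((D₁.Q p ×ˢ D₂.Q q).indicator x) := by
  have hR : MeasurableSet (D₁.Q p ×ˢ D₂.Q q) := (D₁.measurableSet_Q p).prod (D₂.measurableSet_Q q)
  have hfin₁ : μ₁ (D₁.Q p) < ⊤ := D₁.measure_cube_lt_top h₁ _ _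
  have hfin₂ : μ₂ (D₂.Q q) < ⊤ := D₂.measure_cube_lt_top h₂ _ _
  have hmem : MemLp ((D₁.Q p ×ˢ D₂.Q q).indicator x) 2 (μ₁.prod μ₂) := (Lp.memLp x).indicator hR
  have hint : Integrable ((D₁.Q p ×ˢ D₂.Q q).indicator x) (μ₁.prod μ₂) := by
    have : IsFiniteMeasure ((μ₁.prod μ₂).restrict (D₁.Q p ×ˢ D₂.Q q)) := by
      refine isFiniteMeasure_restrict.2 ?_
      rw [Measure.prod_prod]
      exact (ENNReal.mul_lt_top hfin₁ hfin₂).ne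
    exact (integrable_indicator_iff hR).2 (((Lp.memLp x).restrict _).integrable (by norm_num))
  have hsub : ∀ i, D₁.Q (m i).1.1 ⊆ D₁.Q p ∧ D₂.Q (m i).2.1 ⊆ D₂.Q q := by
    intro i
    have hne : (rect (m i)).Nonempty :=
      ⟨(_, _), D₁.center_mem h₁.quasiMetric _ _, D₂.center_mem h₂.quasiMetric _ _⟩
    refine (Set.prod_subset_prod_iff.1 (hm i)).resolve_right fun h => ?_
    rcases h with h | h <;> simp [rect, h] at hne
  have hind₁ : ∀ A, MeasurableSet A → MemLp ((D₁.Q p ∩ A).indicator fun _ => (1 : ℝ)) 2 μ₁ :=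
    fun A hA => memLp_indicator_const _ ((D₁.measurableSet_Q p).inter hA) _
      (Or.inr (measure_inter_lt_top_of_left_ne_top hfin₁.ne).ne)
  have hind₂ : ∀ B, MeasurableSet B → MemLp ((D₂.Q q ∩ B).indicator fun _ => (1 : ℝ)) 2 μ₂ :=
    fun B hB => memLp_indicator_const _ ((D₂.measurableSet_Q q).inter hB) _
      (Or.inr (measure_inter_lt_top_of_left_ne_top hfin₂.ne).ne)
  have hrepr : ∀ A B, MeasurableSet A → MeasurableSet B →
      ∫ z in A ×ˢ B, (D₁.Q p ×ˢ D₂.Q q).indicator x z ∂(μ₁.prod μ₂) =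
        ∫ z, ((D₁.Q p ∩ A).indicator (fun _ => (1 : ℝ)) z.1 *
          (D₂.Q q ∩ B).indicator (fun _ => (1 : ℝ)) z.2) • x z ∂(μ₁.prod μ₂) := by
    intro A B hA hB
    rw [← integral_indicator (hA.prod hB)]
    refine integral_congr_ae (ae_of_all _ fun z => ?_)
    by_cases h1 : z.1 ∈ D₁.Q p <;> by_cases h2 : z.2 ∈ D₂.Q q <;> by_cases h3 : z.1 ∈ A <;>
      by_cases h4 : z.2 ∈ B <;> simp [Set.indicator, h1, h2, h3, h4]
  refine ⟨hmem, Set.support_indicator_subset, ?_, ?_⟩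
  · refine hint.integral_prod_right.ae_eq_zero_of_forall_setIntegral_eq_zero fun B hB _ => ?_
    have h1 := integral_prod_symm (μ := μ₁.restrict Set.univ) (ν := μ₂.restrict B)
      ((D₁.Q p ×ˢ D₂.Q q).indicator x) (by rw [Measure.prod_restrict]; exact hint.integrableOn)
    rw [Measure.prod_restrict] at h1
    simp only [Measure.restrict_univ] at h1
    rw [← h1, hrepr _ _ MeasurableSet.univ hB]
    refine integral_tensor_smul_eq_zero h₁ h₂ I₁ I₂ hx (hind₁ _ MeasurableSet.univ) (hind₂ _ hB)
      fun i => Or.inl ?_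
    rw [Set.inter_univ]
    exact ChildIndexing.integral_indicator_mul_haar h₁ I₁ _ (hsub i).1
  · refine hint.integral_prod_left.ae_eq_zero_of_forall_setIntegral_eq_zero fun A hA _ => ?_
    have h1 := setIntegral_prod (μ := μ₁) (ν := μ₂) (s := A) (t := Set.univ) _ hint.integrableOn
    simp only [Measure.restrict_univ] at h1
    rw [← h1, hrepr _ _ hA MeasurableSet.univ]
    refine integral_tensor_smul_eq_zero h₁ h₂ I₁ I₂ hx (hind₁ _ hA) (hind₂ _ MeasurableSet.univ)
      fun i => Or.inr ?_
    rw [Set.inter_univ]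
    exact ChildIndexing.integral_indicator_mul_haar h₂ I₂ _ (hsub i).2

end RectangleAtoms

section LevelAtom

variable {X₁ X₂ : Type*} [TopologicalSpace X₁] [TopologicalSpace X₂]
  [MeasurableSpace X₁] [MeasurableSpace X₂]
  {ρ₁ : X₁ → X₁ → ℝ} {ρ₂ : X₂ → X₂ → ℝ} {D₁ : DyadicSystem ρ₁} {D₂ : DyadicSystem ρ₂}
  {μ₁ : Measure X₁} {μ₂ : Measure X₂} {𝕜 : Type*} [RCLike 𝕜]

omit [TopologicalSpace X₁] [TopologicalSpace X₂] in
theorem IsRectAtom.const_smul {R : Set (X₁ × X₂)} {b : X₁ × X₂ → 𝕜} (hb : IsRectAtom μ₁ μ₂ R b)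
    (t : 𝕜) : IsRectAtom μ₁ μ₂ R (t • b) := by
  refine ⟨hb.memLp.const_smul t, (Function.support_const_smul_subset t b).trans
    hb.support_subset, ?_, ?_⟩
  · filter_upwards [hb.integral_fst] with y hy
    simp [integral_const_mul, hy]
  · filter_upwards [hb.integral_snd] with y hy
    simp [integral_const_mul, hy]

/-- The zero function is an atom for the empty open set, for which the size conditions are void:
the negative powers of its measure are infinite. -/
theorem isDyadicAtom_zero : IsDyadicAtom D₁ D₂ μ₁ μ₂ (0 : X₁ × X₂ → 𝕜) := by
  refine ⟨∅, isOpen_empty, by simp, by simp, MemLp.zero, by simp, fun _ => 0, fun R => ?_, ?_, ?_⟩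
  · exact ⟨MemLp.zero, by simp, by simp, by simp⟩
  · simp
  · simp

variable (h₁ : IsHomogeneousType ρ₁ μ₁) (h₂ : IsHomogeneousType ρ₂ μ₂)
  (I₁ : ChildIndexing D₁ μ₁) (I₂ : ChildIndexing D₂ μ₂) [SigmaFinite μ₁] [SigmaFinite μ₂]
  [OpensMeasurableSpace (X₁ × X₂)]

/-- A Haar series over rectangles inside an open set is a multiple of an atom. The pieces of the
atom collect the terms whose rectangles lie in a chosen maximal dyadic rectangle. -/
theorem exists_isDyadicAtom_of_hasSum {O : Set (X₁ × X₂)} (hO : IsOpen O)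
    (hOfin : μ₁.prod μ₂ O < ⊤) {ι : Type*} {m : ι → HaarIndex D₁ D₂}
    (hminj : Function.Injective m) (hm : ∀ i, rect (m i) ⊆ O) {c : ι → 𝕜}
    {G : Lp 𝕜 2 (μ₁.prod μ₂)} (hG : HasSum (fun i => c i • haarLp h₁ h₂ I₁ I₂ 𝕜 (m i)) G)
    {T : ℝ≥0} (hT : ‖G‖ₑ ^ 2 ≤ T ^ 2 * μ₁.prod μ₂ O) :
    ∃ (t : 𝕜) (a : X₁ × X₂ → 𝕜), IsDyadicAtom D₁ D₂ μ₁ μ₂ a ∧ t • a =ᵐ[μ₁.prod μ₂] G ∧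
      ‖t‖ₑ ≤ T * μ₁.prod μ₂ O := by
  -- a nonzero sum is normalised by its bound `T * μ O`, which is then nonzero
  by_cases hG0 : G = 0
  · refine ⟨0, 0, isDyadicAtom_zero, ?_, by simp⟩
    rw [hG0, smul_zero]
    exact (Lp.coeFn_zero 𝕜 2 (μ₁.prod μ₂)).symm
  have hTO : (T : ℝ≥0∞) * μ₁.prod μ₂ O ≠ 0 := by
    intro h
    rw [sq (T : ℝ≥0∞), mul_assoc, h, mul_zero, nonpos_iff_eq_zero] at hT
    simp [hG0] at hT
  set s : ℝ≥0 := T * (μ₁.prod μ₂ O).toNNReal with hs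
  have hsO : (s : ℝ≥0∞) = T * μ₁.prod μ₂ O := by
    rw [hs, ENNReal.coe_mul, ENNReal.coe_toNNReal hOfin.ne]
  set t : 𝕜 := ((s : ℝ) : 𝕜) with ht
  have hte : ‖t‖ₑ = s := by
    rw [ht, ← ofReal_norm, RCLike.norm_ofReal, abs_of_nonneg s.coe_nonneg,
      ENNReal.ofReal_coe_nnreal]
  have ht0 : t ≠ 0 := by
    rw [← enorm_ne_zero, hte, hsO]
    exact hTO
  have hsq : ‖t⁻¹‖ₑ ^ 2 * ‖G‖ₑ ^ 2 ≤ (μ₁.prod μ₂ O)⁻¹ := by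
    rw [enorm_inv ht0, hte, hsO, ← ENNReal.inv_pow, ENNReal.inv_mul_le_iff
      (pow_ne_zero 2 hTO) (ENNReal.pow_ne_top (ENNReal.mul_ne_top ENNReal.coe_ne_top hOfin.ne))]
    refine hT.trans_eq ?_
    rw [mul_pow, mul_assoc, sq (μ₁.prod μ₂ O), mul_assoc,
      ENNReal.mul_inv_cancel (right_ne_zero_of_mul hTO) hOfin.ne, mul_one]
  have hOm := hO.measurableSet
  have hGO := indicator_ae_eq_of_hasSum_haarLp h₁ h₂ I₁ I₂ hG hOm hm
  choose π hπ hπsub using fun i =>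
    exists_subset_maxRects h₁ h₂ hOfin ⟨_, _, rfl⟩ (hm i)
  obtain ⟨B, hB, hBG, hBsq⟩ := exists_hasSum_fiber
    ((orthonormal_haarLp h₁ h₂ I₁ I₂ (𝕜 := 𝕜)).comp m hminj) hG
    (fun i => (⟨π i, hπ i⟩ : maxRects D₁ D₂ O))
  have hBsub : ∀ (R : maxRects D₁ D₂ O) (i : {i // (⟨π i, hπ i⟩ : maxRects D₁ D₂ O) = R}),
      rect (m i) ⊆ R.1 := by
    rintro _ ⟨i, rfl⟩
    exact hπsub i
  have hbmem : ∀ R : maxRects D₁ D₂ O, MeasurableSet R.1 ∧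
      IsRectAtom μ₁ μ₂ R.1 (t⁻¹ • R.1.indicator (B R)) := by
    intro R
    have hsubR := hBsub R
    obtain ⟨p, q, hpq⟩ := R.2.1.1
    rw [hpq] at hsubR ⊢
    exact ⟨(D₁.measurableSet_Q p).prod (D₂.measurableSet_Q q),
      (isRectAtom_of_hasSum h₁ h₂ I₁ I₂ (hB R) hsubR).const_smul _⟩
  have hbR : ∀ R : maxRects D₁ D₂ O, t⁻¹ • R.1.indicator (B R) =ᵐ[μ₁.prod μ₂] t⁻¹ • B R := by
    intro R
    exact (indicator_ae_eq_of_hasSum_haarLp h₁ h₂ I₁ I₂ (hB R) (hbmem R).1 (hBsub R)).const_smul _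
  have hamem : MemLp (t⁻¹ • O.indicator G) 2 (μ₁.prod μ₂) :=
    ((Lp.memLp G).indicator hOm).const_smul _
  have hanorm : eLpNorm (t⁻¹ • O.indicator G) 2 (μ₁.prod μ₂) ^ 2 ≤ (μ₁.prod μ₂ O)⁻¹ := by
    rw [eLpNorm_congr_ae (hGO.const_smul t⁻¹), eLpNorm_const_smul, mul_pow, ← Lp.enorm_def]
    exact hsq
  refine ⟨t, t⁻¹ • O.indicator G, ⟨O, hO, hOfin, ?_, hamem, ?_,
    fun R => t⁻¹ • R.1.indicator (B R), fun R => (hbmem R).2, ?_, ?_⟩, ?_, ?_⟩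
  · exact (Function.support_const_smul_subset _ _).trans Set.support_indicator_subset
  · calc eLpNorm (t⁻¹ • O.indicator G) 2 (μ₁.prod μ₂)
        = (eLpNorm (t⁻¹ • O.indicator G) 2 (μ₁.prod μ₂) ^ 2) ^ (1 / 2 : ℝ) := by
          rw [← ENNReal.rpow_natCast, ← ENNReal.rpow_mul]
          norm_num
      _ ≤ (μ₁.prod μ₂ O)⁻¹ ^ (1 / 2 : ℝ) := ENNReal.rpow_le_rpow hanorm (by norm_num)
      _ = μ₁.prod μ₂ O ^ (-(1 / 2) : ℝ) := by rw [ENNReal.inv_rpow, ENNReal.rpow_neg]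
  · refine (hasSum_toLp_iff (fun R => (hbmem R).2.memLp) hamem).1 ?_
    have e1 : hamem.toLp _ = t⁻¹ • G := by
      refine Lp.ext ((hamem.coeFn_toLp).trans ((hGO.const_smul t⁻¹).trans ?_))
      exact (Lp.coeFn_smul _ _).symm
    have e2 : ∀ R, (hbmem R).2.memLp.toLp _ = t⁻¹ • B R := fun R =>
      Lp.ext (((hbmem R).2.memLp.coeFn_toLp).trans ((hbR R).trans (Lp.coeFn_smul _ _).symm))
    rw [e1]
    simp_rw [e2]
    exact hBG.const_smul _
  · refine le_trans (le_of_eq ?_) hsq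
    rw [← hBsq, ← ENNReal.tsum_mul_left]
    refine tsum_congr fun R => ?_
    rw [eLpNorm_congr_ae (hbR R), eLpNorm_const_smul, mul_pow, ← Lp.enorm_def]
  · rw [smul_smul, mul_inv_cancel₀ ht0, one_smul]
    exact hGO
  · rw [hte, hsO]

end LevelAtom

/-! ### The atomic decomposition -/

section Levels

/-- The dyadic form of the layer cake formula. -/
theorem tsum_indicator_two_zpow_le (s : ℝ≥0∞) :
    ∑' k : ℤ, {k : ℤ | ((2 ^ k : ℝ≥0) : ℝ≥0∞) < s}.indicator
      (fun k => ((2 ^ k : ℝ≥0) : ℝ≥0∞)) k ≤ 2 * s := by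
  rcases eq_or_ne s ⊤ with rfl | hs
  · simp
  lift s to ℝ≥0 using hs
  rcases eq_or_ne s 0 with rfl | hs0
  · simp
  obtain ⟨n, hn, hn'⟩ := exists_mem_Ioc_zpow (pos_iff_ne_zero.2 hs0) (one_lt_two : (1 : ℝ≥0) < 2)
  have hinj : Function.Injective fun i : ℕ => n - (i : ℤ) := fun i l h => by
    have h : n - (i : ℤ) = n - l := h
    omega
  rw [← hinj.tsum_eq]
  · have hterm : ∀ i : ℕ, {k : ℤ | ((2 ^ k : ℝ≥0) : ℝ≥0∞) < s}.indicator
        (fun k => ((2 ^ k : ℝ≥0) : ℝ≥0∞)) (n - i) ≤ s * 2⁻¹ ^ i := by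
      intro i
      refine (Set.indicator_le_self' (fun _ _ => zero_le) _).trans ?_
      have : (2 : ℝ≥0) ^ (n - (i : ℤ)) = 2 ^ n * (2⁻¹) ^ i := by
        rw [zpow_sub₀ two_ne_zero, zpow_natCast, inv_pow, div_eq_mul_inv]
      rw [this, ENNReal.coe_mul, ENNReal.coe_pow, ENNReal.coe_inv two_ne_zero]
      gcongr
      exact le_rfl
    refine (ENNReal.tsum_le_tsum hterm).trans_eq ?_
    rw [ENNReal.tsum_mul_left, ENNReal.tsum_geometric, ENNReal.one_sub_inv_two, inv_inv, mul_comm]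
  · intro k hk
    have hk : ((2 ^ k : ℝ≥0) : ℝ≥0∞) < s := by
      by_contra hcon
      exact hk (Set.indicator_of_notMem (s := {k : ℤ | ((2 ^ k : ℝ≥0) : ℝ≥0∞) < s}) hcon _)
    have hlt : (2 : ℝ≥0) ^ k < 2 ^ (n + 1) := (ENNReal.coe_lt_coe.1 hk).trans_le hn'
    have hkn := (zpow_lt_zpow_iff_right₀ one_lt_two).1 hlt
    exact ⟨(n - k).toNat, by simp only; omega⟩

variable {X₁ X₂ : Type*} [TopologicalSpace X₁] [TopologicalSpace X₂]
  [MeasurableSpace X₁] [MeasurableSpace X₂]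
  {ρ₁ : X₁ → X₁ → ℝ} {ρ₂ : X₂ → X₂ → ℝ} {D₁ : DyadicSystem ρ₁} {D₂ : DyadicSystem ρ₂}
  {μ₁ : Measure X₁} {μ₂ : Measure X₂}
  (h₁ : IsHomogeneousType ρ₁ μ₁) (h₂ : IsHomogeneousType ρ₂ μ₂)
  (I₁ : ChildIndexing D₁ μ₁) (I₂ : ChildIndexing D₂ μ₂) {𝕜 : Type*} [RCLike 𝕜]
  [SFinite μ₂]

include h₁ h₂ in
/-- On rectangles half of which lie where the square function is at most `t`, the coefficients
are controlled by the integral of its square over that part. -/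
theorem tsum_enorm_coeff_sq_le_of_squareFunction_le {f : X₁ × X₂ → 𝕜} {ι : Type*}
    {m : ι → HaarIndex D₁ D₂} (hminj : Function.Injective m) {O E : Set (X₁ × X₂)}
    (hO : MeasurableSet O) (hE : MeasurableSet E) {t : ℝ≥0∞}
    (ht : ∀ z, z ∉ E → squareFunction I₁ I₂ f z ≤ t) (hm : ∀ i, rect (m i) ⊆ O)
    (hhalf : ∀ i, 2 * μ₁.prod μ₂ (E ∩ rect (m i)) ≤ μ₁.prod μ₂ (rect (m i))) :
    ∑' i, ‖coeff I₁ I₂ f (m i)‖ₑ ^ 2 ≤ 2 * t ^ 2 * μ₁.prod μ₂ O := by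
  have hone : ∀ i, 1 ≤ 2 * ((μ₁.prod μ₂ (rect (m i)))⁻¹ *
      μ₁.prod μ₂ (rect (m i) ∩ (O \ E))) := by
    intro i
    have hpos := measure_rect_pos h₁ h₂ (m i)
    have hfin := measure_rect_lt_top h₁ h₂ (m i)
    have hdiff : rect (m i) ∩ (O \ E) = rect (m i) \ E := by
      ext z
      exact ⟨fun hz => ⟨hz.1, hz.2.2⟩, fun hz => ⟨hz.1, hm i hz.1, hz.2⟩⟩
    have hle : μ₁.prod μ₂ (rect (m i)) ≤ 2 * μ₁.prod μ₂ (rect (m i) \ E) := by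
      refine (ENNReal.add_le_add_iff_left hfin.ne).1 ?_
      calc μ₁.prod μ₂ (rect (m i)) + μ₁.prod μ₂ (rect (m i))
          = 2 * μ₁.prod μ₂ (E ∩ rect (m i)) + 2 * μ₁.prod μ₂ (rect (m i) \ E) := by
            rw [← mul_add, ← two_mul, Set.inter_comm, measure_inter_add_sdiff _ hE]
        _ ≤ _ := by gcongr; exact hhalf i
    rw [hdiff]
    calc (1 : ℝ≥0∞) = (μ₁.prod μ₂ (rect (m i)))⁻¹ * μ₁.prod μ₂ (rect (m i)) :=
          (ENNReal.inv_mul_cancel hpos.ne' hfin.ne).symm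
      _ ≤ (μ₁.prod μ₂ (rect (m i)))⁻¹ * (2 * μ₁.prod μ₂ (rect (m i) \ E)) := by gcongr
      _ = _ := by ring
  calc ∑' i, ‖coeff I₁ I₂ f (m i)‖ₑ ^ 2
      ≤ ∑' i, 2 * (‖coeff I₁ I₂ f (m i)‖ₑ ^ 2 * ((μ₁.prod μ₂ (rect (m i)))⁻¹ *
          μ₁.prod μ₂ (rect (m i) ∩ (O \ E)))) := by
        refine ENNReal.tsum_le_tsum fun i => ?_
        calc _ ≤ ‖coeff I₁ I₂ f (m i)‖ₑ ^ 2 * (2 * ((μ₁.prod μ₂ (rect (m i)))⁻¹ *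
              μ₁.prod μ₂ (rect (m i) ∩ (O \ E)))) := le_mul_of_one_le_right' (hone i)
          _ = _ := by ring
    _ ≤ 2 * ∫⁻ z in O \ E, squareFunction I₁ I₂ f z ^ 2 ∂(μ₁.prod μ₂) := by
        rw [ENNReal.tsum_mul_left, setLIntegral_squareFunction_sq I₁ I₂ h₁]
        gcongr
        exact ENNReal.tsum_comp_le_tsum_of_injective hminj _
    _ ≤ 2 * ∫⁻ _ in O \ E, t ^ 2 ∂(μ₁.prod μ₂) := by
        gcongr 2 * ?_
        refine setLIntegral_mono' (hO.diff hE) fun z hz => ?_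
        gcongr
        exact ht z hz.2
    _ ≤ 2 * t ^ 2 * μ₁.prod μ₂ O := by
        rw [setLIntegral_const, mul_assoc]
        gcongr
        exact Set.sdiff_subset

include h₁ h₂ in
/-- Every rectangle with a nonzero Haar coefficient has a highest level set of the square function
that fills more than half of it: the square function is bounded below on the rectangle, and the
measures of its level sets decay. -/
theorem exists_greatest_level {f : X₁ × X₂ → 𝕜} (hf : hardyNorm I₁ I₂ f < ⊤)
    {j : HaarIndex D₁ D₂} (hj : coeff I₁ I₂ f j ≠ 0) :
    ∃ k : ℤ, μ₁.prod μ₂ (rect j) < 2 * μ₁.prod μ₂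
        ({z | ((2 ^ k : ℝ≥0) : ℝ≥0∞) < squareFunction I₁ I₂ f z} ∩ rect j) ∧
      2 * μ₁.prod μ₂ ({z | ((2 ^ (k + 1) : ℝ≥0) : ℝ≥0∞) < squareFunction I₁ I₂ f z} ∩ rect j) ≤
        μ₁.prod μ₂ (rect j) := by
  have hpos := measure_rect_pos h₁ h₂ j
  have hfin := measure_rect_lt_top h₁ h₂ j
  set P : ℤ → Prop := fun k => μ₁.prod μ₂ (rect j) <
    2 * μ₁.prod μ₂ ({z | ((2 ^ k : ℝ≥0) : ℝ≥0∞) < squareFunction I₁ I₂ f z} ∩ rect j)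
  suffices H : (∃ b, ∀ k, P k → k ≤ b) ∧ ∃ k, P k by
    obtain ⟨k, hk, hmax⟩ := Int.exists_greatest_of_bdd H.1 H.2
    exact ⟨k, hk, not_lt.1 fun h => absurd (hmax _ h) (by omega)⟩
  constructor
  · obtain ⟨n, hn⟩ : ∃ n : ℕ, 2 * hardyNorm I₁ I₂ f / μ₁.prod μ₂ (rect j) < 2 ^ n := by
      have hb : 2 * hardyNorm I₁ I₂ f / μ₁.prod μ₂ (rect j) ≠ ⊤ :=
        ENNReal.div_ne_top (ENNReal.mul_ne_top (by norm_num) hf.ne) hpos.ne'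
      obtain ⟨n, hn⟩ := pow_unbounded_of_one_lt
        (2 * hardyNorm I₁ I₂ f / μ₁.prod μ₂ (rect j)).toNNReal (one_lt_two : (1 : ℝ≥0) < 2)
      refine ⟨n, ?_⟩
      rw [← ENNReal.coe_toNNReal hb]
      exact_mod_cast hn
    refine ⟨n, fun k hk => ?_⟩
    by_contra hcon
    push Not at hcon
    have h2 : ((2 ^ n : ℝ≥0) : ℝ≥0∞) ≤ ((2 ^ k : ℝ≥0) : ℝ≥0∞) := by
      rw [ENNReal.coe_le_coe, ← zpow_natCast]
      exact zpow_le_zpow_right₀ one_le_two hcon.le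
    have h3 : ((2 ^ k : ℝ≥0) : ℝ≥0∞) * μ₁.prod μ₂ (rect j) ≤ 2 * hardyNorm I₁ I₂ f := by
      calc _ ≤ ((2 ^ k : ℝ≥0) : ℝ≥0∞) * (2 * μ₁.prod μ₂
            {z | ((2 ^ k : ℝ≥0) : ℝ≥0∞) ≤ squareFunction I₁ I₂ f z}) := by
            gcongr
            refine hk.le.trans ?_
            gcongr
            exact fun z hz => (show _ < squareFunction I₁ I₂ f z from hz.1).le
        _ = 2 * (((2 ^ k : ℝ≥0) : ℝ≥0∞) * μ₁.prod μ₂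
            {z | ((2 ^ k : ℝ≥0) : ℝ≥0∞) ≤ squareFunction I₁ I₂ f z}) := by ring
        _ ≤ _ := by
            gcongr
            exact mul_meas_ge_le_lintegral (measurable_squareFunction I₁ I₂ f) _
    have h4 := (ENNReal.le_div_iff_mul_le (Or.inl hpos.ne') (Or.inl hfin.ne)).2 h3
    refine absurd (h2.trans h4) (not_le.2 ?_)
    exact_mod_cast hn
  · have hv : 0 < ‖coeff I₁ I₂ f j‖ₑ ^ 2 * (μ₁.prod μ₂ (rect j))⁻¹ :=
      ENNReal.mul_pos (pow_ne_zero 2 (enorm_ne_zero.2 hj)) (ENNReal.inv_ne_zero.2 hfin.ne)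
    obtain ⟨v, hv0, hv⟩ := ENNReal.lt_iff_exists_nnreal_btwn.1 hv
    obtain ⟨n, hn⟩ := exists_pow_lt_of_lt_one (ENNReal.coe_pos.1 hv0)
      (by norm_num : (2⁻¹ : ℝ≥0) ^ 2 < 1)
    refine ⟨-n, ?_⟩
    have hsub : rect j ⊆ {z | ((2 ^ (-n : ℤ) : ℝ≥0) : ℝ≥0∞) < squareFunction I₁ I₂ f z} := by
      intro z hz
      refine (ENNReal.pow_lt_pow_left_iff two_ne_zero).1 ?_
      calc ((2 ^ (-n : ℤ) : ℝ≥0) : ℝ≥0∞) ^ 2 = (((2⁻¹ ^ 2) ^ n : ℝ≥0) : ℝ≥0∞) := by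
            rw [← ENNReal.coe_pow, zpow_neg, zpow_natCast, ← inv_pow, pow_right_comm]
        _ < v := ENNReal.coe_lt_coe.2 hn
        _ < ‖coeff I₁ I₂ f j‖ₑ ^ 2 * (μ₁.prod μ₂ (rect j))⁻¹ := hv
        _ ≤ squareFunction I₁ I₂ f z ^ 2 := by
            rw [squareFunction_sq I₁ I₂ h₁]
            refine le_trans (le_of_eq ?_) (ENNReal.le_tsum j)
            rw [Set.indicator_of_mem hz]
    change μ₁.prod μ₂ (rect j) < 2 * μ₁.prod μ₂ (_ ∩ rect j)
    rw [Set.inter_eq_right.2 hsub, two_mul]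
    exact ENNReal.lt_add_right hfin.ne hpos.ne'

end Levels

section Decomposition

variable {X₁ X₂ : Type*} [TopologicalSpace X₁] [TopologicalSpace X₂]
  [MeasurableSpace X₁] [MeasurableSpace X₂] [BorelSpace X₁] [BorelSpace X₂]
  [OpensMeasurableSpace (X₁ × X₂)]
  {ρ₁ : X₁ → X₁ → ℝ} {ρ₂ : X₂ → X₂ → ℝ} {D₁ : DyadicSystem ρ₁} {D₂ : DyadicSystem ρ₂}
  {μ₁ : Measure X₁} {μ₂ : Measure X₂}
  (h₁ : IsHomogeneousType ρ₁ μ₁) (h₂ : IsHomogeneousType ρ₂ μ₂)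
  (I₁ : ChildIndexing D₁ μ₁) (I₂ : ChildIndexing D₂ μ₂) {𝕜 : Type*} [RCLike 𝕜]
  [SigmaFinite μ₁] [SigmaFinite μ₂] [(μ₁.prod μ₂).OuterRegular]

include h₁ h₂ in
/-- The atomic decomposition: the Haar expansion is split according to the highest level set of the
square function that fills more than half of the rectangle. -/
theorem exists_atomic_decomposition {f : X₁ × X₂ → 𝕜} (hf : MemLp f 2 (μ₁.prod μ₂))
    (hf1 : hardyNorm I₁ I₂ f < ⊤)
    (H₁ : μ₁ Set.univ = ⊤ ∨ ∀ᵐ x₂ ∂μ₂, ∫ x₁, f (x₁, x₂) ∂μ₁ = 0)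
    (H₂ : μ₂ Set.univ = ⊤ ∨ ∀ᵐ x₁ ∂μ₁, ∫ x₂, f (x₁, x₂) ∂μ₂ = 0) :
    ∃ (c : ℕ → 𝕜) (a : ℕ → X₁ × X₂ → 𝕜), (∀ k, IsDyadicAtom D₁ D₂ μ₁ μ₂ (a k)) ∧
      IsSeriesSum 2 (μ₁.prod μ₂) c a f ∧ IsSeriesSum 1 (μ₁.prod μ₂) c a f ∧
      ∑' k, ‖c k‖ₑ ≤ 256 * hardyNorm I₁ I₂ f := by
  set E : ℤ → Set (X₁ × X₂) := fun k =>
    {z | ((2 ^ k : ℝ≥0) : ℝ≥0∞) < squareFunction I₁ I₂ f z} with hE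
  have hEm : ∀ k, MeasurableSet (E k) := fun k =>
    measurableSet_lt measurable_const (measurable_squareFunction I₁ I₂ f)
  have hEfin : ∀ k, μ₁.prod μ₂ (E k) < ⊤ := by
    intro k
    have hk : ((2 ^ k : ℝ≥0) : ℝ≥0∞) ≠ 0 :=
      ENNReal.coe_ne_zero.2 (zpow_ne_zero k two_ne_zero)
    refine lt_of_le_of_lt ?_ (ENNReal.div_lt_top hf1.ne hk)
    exact (measure_mono fun z (hz : _ < squareFunction I₁ I₂ f z) => hz.le).trans
      (meas_ge_le_lintegral_div (measurable_squareFunction I₁ I₂ f).aemeasurable hk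
        ENNReal.coe_ne_top)
  have hOex : ∀ k, ∃ O : Set (X₁ × X₂), IsOpen O ∧ μ₁.prod μ₂ O ≤ 32 * μ₁.prod μ₂ (E k) ∧
      ∀ j : HaarIndex D₁ D₂, rect j ⊆ enlargement D₁ D₂ μ₁ μ₂ (E k) → rect j ⊆ O := by
    intro k
    have hle := measure_enlargement_le (D₁ := D₁) (D₂ := D₂) (μ₁ := μ₁) (μ₂ := μ₂) (hEm k)
    obtain ⟨O, hO, hOle, hOsub⟩ := exists_isOpen_measure_le h₁ h₂ (D₁ := D₁) (D₂ := D₂)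
      (hle.trans_lt (ENNReal.mul_lt_top (by norm_num) (hEfin k))).ne
    refine ⟨O, hO, hOle.trans ((mul_le_mul_right hle 2).trans_eq ?_), hOsub⟩
    rw [← mul_assoc]
    norm_num
  choose O hO hOle hOsub using hOex
  -- `κ j` is the level of the rectangle with index `j`
  choose κ hκ hκ' using fun j : {j // coeff I₁ I₂ f j ≠ 0} =>
    exists_greatest_level h₁ h₂ I₁ I₂ hf1 j.2
  have hsum : HasSum (fun j : {j // coeff I₁ I₂ f j ≠ 0} =>
      coeff I₁ I₂ f j • haarLp h₁ h₂ I₁ I₂ 𝕜 (j : HaarIndex D₁ D₂)) (hf.toLp f) := by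
    refine (hasSum_subtype_iff_of_support_subset (s := {j | coeff I₁ I₂ f j ≠ 0})
      fun j hj => ?_).2 (hasSum_coeff_smul_haarLp h₁ h₂ I₁ I₂ hf H₁ H₂)
    intro h0
    exact hj (by simp [h0])
  have hon := (orthonormal_haarLp h₁ h₂ I₁ I₂ (𝕜 := 𝕜)).comp
    (Subtype.val : {j // coeff I₁ I₂ f j ≠ 0} → _) Subtype.val_injective
  obtain ⟨G, hG, hGsum, -⟩ := exists_hasSum_fiber hon hsum κ
  have hinj : ∀ k, Function.Injective fun i : {i // κ i = k} => (i.1.1 : HaarIndex D₁ D₂) :=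
    fun k => Subtype.val_injective.comp Subtype.val_injective
  have hrect : ∀ k, ∀ i : {i // κ i = k}, rect i.1.1 ⊆ O k := by
    rintro _ ⟨i, rfl⟩
    exact hOsub _ _ (Set.subset_biUnion_of_mem
      (u := fun r : D₁.Index × D₂.Index => D₁.Q r.1 ×ˢ D₂.Q r.2)
      (x := (i.1.1.1, i.1.2.1)) (hκ i))
  have hatom : ∀ k, ∃ (t : 𝕜) (a : X₁ × X₂ → 𝕜), IsDyadicAtom D₁ D₂ μ₁ μ₂ a ∧
      t • a =ᵐ[μ₁.prod μ₂] G k ∧ ‖t‖ₑ ≤ ((4 * 2 ^ k : ℝ≥0) : ℝ≥0∞) * μ₁.prod μ₂ (O k) := by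
    intro k
    refine exists_isDyadicAtom_of_hasSum h₁ h₂ I₁ I₂ (hO k)
      ((hOle k).trans_lt (ENNReal.mul_lt_top (by norm_num) (hEfin k))) (hinj k) (hrect k) (hG k) ?_
    rw [enorm_sq_eq_tsum_of_hasSum (hon.comp _ Subtype.val_injective) (hG k)]
    refine (tsum_enorm_coeff_sq_le_of_squareFunction_le h₁ h₂ I₁ I₂ (hinj k) (hO k).measurableSet
      (hEm (k + 1)) (fun z hz => not_lt.1 hz) (hrect k) ?_).trans ?_
    · rintro ⟨i, rfl⟩
      exact hκ' i
    · gcongr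
      -- the square function is at most `2 ^ (k + 1)` off the next level set
      have : (2 : ℝ≥0) * (2 ^ (k + 1)) ^ 2 ≤ (4 * 2 ^ k) ^ 2 := by
        rw [zpow_add_one₀ two_ne_zero]
        calc (2 : ℝ≥0) * (2 ^ k * 2) ^ 2 = 8 * (2 ^ k) ^ 2 := by ring
          _ ≤ 16 * (2 ^ k) ^ 2 := by gcongr; norm_num
          _ = (4 * 2 ^ k) ^ 2 := by ring
      exact_mod_cast this
  choose t a ha hta ht using hatom
  set e : ℕ ≃ ℤ := Equiv.intEquivNat.symm
  have hb := fun k => (ha k).bounds h₁ h₂ I₁ I₂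
  have hle : ∑' n, ‖t (e n)‖ₑ ≤ 256 * hardyNorm I₁ I₂ f := by
    rw [e.tsum_eq fun k => ‖t k‖ₑ]
    calc ∑' k, ‖t k‖ₑ
        ≤ ∑' k : ℤ, 128 * ∫⁻ z, (E k).indicator (fun _ => ((2 ^ k : ℝ≥0) : ℝ≥0∞)) z
            ∂(μ₁.prod μ₂) := by
          refine ENNReal.tsum_le_tsum fun k => (ht k).trans ?_
          rw [lintegral_indicator_const (hEm k)]
          calc ((4 * 2 ^ k : ℝ≥0) : ℝ≥0∞) * μ₁.prod μ₂ (O k)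
              ≤ ((4 * 2 ^ k : ℝ≥0) : ℝ≥0∞) * (32 * μ₁.prod μ₂ (E k)) := by gcongr; exact hOle k
            _ = 4 * 32 * (((2 ^ k : ℝ≥0) : ℝ≥0∞) * μ₁.prod μ₂ (E k)) := by
                rw [ENNReal.coe_mul, ENNReal.coe_ofNat]
                ring
            _ = _ := by norm_num
      _ = 128 * ∫⁻ z, ∑' k : ℤ, (E k).indicator (fun _ => ((2 ^ k : ℝ≥0) : ℝ≥0∞)) z
            ∂(μ₁.prod μ₂) := by
          rw [ENNReal.tsum_mul_left, lintegral_tsum fun k =>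
            (measurable_const.indicator (hEm k)).aemeasurable]
      _ ≤ 128 * ∫⁻ z, 2 * squareFunction I₁ I₂ f z ∂(μ₁.prod μ₂) := by
          gcongr with z
          exact tsum_indicator_two_zpow_le (squareFunction I₁ I₂ f z)
      _ = 256 * hardyNorm I₁ I₂ f := by
          rw [lintegral_const_mul _ (measurable_squareFunction I₁ I₂ f), ← mul_assoc]
          norm_num [hardyNorm]
  have hta2 : ∀ n, MemLp (t (e n) • a (e n)) 2 (μ₁.prod μ₂) := fun n => (hb _).1.const_smul _
  have h2 : IsSeriesSum 2 (μ₁.prod μ₂) (fun n => t (e n)) (fun n => a (e n)) f := by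
    refine ⟨hf, (hasSum_toLp_iff hta2 hf).1 ?_⟩
    have hG' : ∀ n, (hta2 n).toLp _ = G (e n) := fun n =>
      Lp.ext ((hta2 n).coeFn_toLp.trans (hta (e n)))
    simp_rw [hG']
    exact e.hasSum_iff.2 hGsum
  obtain ⟨g, hg⟩ := exists_isSeriesSum_one (c := fun n => t (e n)) (a := fun n => a (e n))
    (fun n => (hb _).2.1) (fun n => (hb _).2.2.1)
    (hle.trans_lt (ENNReal.mul_lt_top (by norm_num) hf1))
  exact ⟨_, _, fun n => ha _, h2, isSeriesSum_congr
    (hg.ae_eq one_ne_zero two_ne_zero (fun n => (hb _).2.1) h2) hg, hle⟩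

end Decomposition

end DyadicHardy
end

theorem mainTheorem6
    {X₁ X₂ : Type*}
    [TopologicalSpace X₁] [MeasurableSpace X₁] [BorelSpace X₁]
    [TopologicalSpace X₂] [MeasurableSpace X₂] [BorelSpace X₂]
    {𝕜 : Type*} [RCLike 𝕜]
    (ρ₁ : X₁ → X₁ → ℝ) (ρ₂ : X₂ → X₂ → ℝ) (μ₁ : Measure X₁) (μ₂ : Measure X₂)
    (hX₁ : IsHomogeneousType ρ₁ μ₁) (hX₂ : IsHomogeneousType ρ₂ μ₂)
    (D₁ : DyadicSystem ρ₁) (D₂ : DyadicSystem ρ₂)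
    (I₁ : ChildIndexing D₁ μ₁) (I₂ : ChildIndexing D₂ μ₂) :
    ∃ C : ℝ≥0,
      (∀ f : X₁ × X₂ → 𝕜, MemHardy I₁ I₂ f → MemLp f 2 (μ₁.prod μ₂) →
        (μ₁ Set.univ = ⊤ ∨ ∀ᵐ x₂ ∂μ₂, ∫ x₁, f (x₁, x₂) ∂μ₁ = 0) →
        (μ₂ Set.univ = ⊤ ∨ ∀ᵐ x₁ ∂μ₁, ∫ x₂, f (x₁, x₂) ∂μ₂ = 0) →
        ∃ (c : ℕ → 𝕜) (a : ℕ → X₁ × X₂ → 𝕜),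
          (∀ k, IsDyadicAtom D₁ D₂ μ₁ μ₂ (a k)) ∧
          IsSeriesSum 2 (μ₁.prod μ₂) c a f ∧
          IsSeriesSum 1 (μ₁.prod μ₂) c a f ∧
          ∑' k, ‖c k‖ₑ ≤ C * hardyNorm I₁ I₂ f) ∧
      (∀ (c : ℕ → 𝕜) (a : ℕ → X₁ × X₂ → 𝕜),
        (∀ k, IsDyadicAtom D₁ D₂ μ₁ μ₂ (a k)) → ∑' k, ‖c k‖ₑ < ⊤ →
        (∃ f, IsSeriesSum 1 (μ₁.prod μ₂) c a f) ∧
        ∀ f, IsSeriesSum 1 (μ₁.prod μ₂) c a f ∨ IsSeriesSum 2 (μ₁.prod μ₂) c a f →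
          MemHardy I₁ I₂ f ∧ hardyNorm I₁ I₂ f ≤ C * ∑' k, ‖c k‖ₑ) := by
  have := hX₁.pseudoMetrizableSpace
  have := hX₂.pseudoMetrizableSpace
  have := D₁.secondCountableTopology hX₁
  have := D₂.secondCountableTopology hX₂
  have := hX₁.isLocallyFiniteMeasure
  have := hX₂.isLocallyFiniteMeasure
  have := D₁.sigmaFinite hX₁
  have := D₂.sigmaFinite hX₂
  refine ⟨256, fun f hf hf2 H₁ H₂ => ?_, fun c a ha hc => ⟨?_, fun f hf => ?_⟩⟩
  · exact exists_atomic_decomposition hX₁ hX₂ I₁ I₂ hf2 hf.2 H₁ H₂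
  · have hb := fun k => (ha k).bounds hX₁ hX₂ I₁ I₂
    exact exists_isSeriesSum_one (fun k => (hb k).2.1) (fun k => (hb k).2.2.1) hc
  · obtain ⟨hmem, hle⟩ := memHardy_of_isSeriesSum hX₁ hX₂ I₁ I₂ ha hc hf
    exact ⟨hmem, hle.trans (le_mul_of_one_le_left' (by norm_num))⟩
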